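/- **Setting.** Let $\mathcal S,\mathcal A$ be measurable spaces (possibly infinite), $H\ge 1$, $d\ge 1$, $d_{\mathrm{lin}}$ integers. An episodic *vector-valued MDP* (VMDP) has a fixed initial state $s_1$; at step $h=1,\dots,H$, taking action $a_h$ in state $s_h$ produces a random return vector in the closed unit ball of $\mathbb R^d$, with mean $\mathbf r_h(s_h,a_h)$, and a next state $s_{h+1}\sim\mathbb P_h(\cdot\mid s_h,a_h)$. A policy $\pi$ consists of $H$ measurable maps $\pi_h$ from states to distributions over actions, and $\mathbf V^\pi=\mathbb E_\pi[\sum_{h=1}^H\mathbf r_h(s_h,a_h)]$. For a VMDP with cost, a random cost in $[-1,1]$ with mean $c_h(s_h,a_h)$ is observed along with the return vector, and $C^\pi=\mathbb E_\pi[\sum_{h=1}^H c_h(s_h,a_h)]$. Let $\phi:\mathcal S\times\mathcal A\to\mathbb R^{d_{\mathrm{lin}}}$ be a known measurable feature map with $\|\phi\|\le 1$, regular enough for maximization over actions: there are measurable $g_n:\mathcal S\to\mathcal A$, $n\in\mathbb N$, such that $\{\phi(s,g_n(s))\}_n$ is dense in $\phi(s,\mathcal A)$ for every $s$ (automatic if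 $\mathcal A$ is countable and nonempty, or separable and nonempty with $\phi(s,\cdot)$ continuous). A VMDP is *linear* (with feature map $\phi$) if for each $h$ there are a vector $\mu_h$ of $d_{\mathrm{lin}}$ signed measures on $\mathcal S$ with $\|\mu_h(\mathcal S)\|\le\sqrt{d_{\mathrm{lin}}}$ and a matrix $W_h\in\mathbb R^{d\times d_{\mathrm{lin}}}$ with $\|W_h\|\le\sqrt{d_{\mathrm{lin}}}$ such that $\mathbb P_h(\cdot\mid s,a)=\langle\mu_h(\cdot),\phi(s,a)\rangle$ and $\mathbf r_h(s,a)=W_h\phi(s,a)$ for all $(s,a)$; for a linear VMDP with cost we require in addition $c_h(s,a)=\langle w_h,\phi(s,a)\rangle$ with $\|w_h\|\le\sqrt{d_{\mathrm{lin}}}$. An *algorithm with $m$ episodes* chooses, for each episode, a policy as a measurable function of the data (states, actions, observed return vectors and costs) of the previous episodes, and after $m$ episodes outputs a policy $\pi^{\mathrm{out}}$ that is a uniform mixture of finitely many policies depending measurably on all the data; its value and cost are the averages over the mixture. It knows $\phi$, $H$, $d$, the target set and $\epsilon,\delta$, but not $\mathbb P$, $\mathbf r$, $c$. **Statement.** There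 is an absolute constant $K>0$ such that for all such $\mathcal S,\mathcal A,H,d,d_{\mathrm{lin}},\phi$, every nonempty convex set $\mathcal C\subseteq\mathbb R^d$, every $\epsilon\in(0,H]$ and $\delta\in(0,1]$, with $\iota=\log\frac{d_{\mathrm{lin}}\,d\,H}{\epsilon\delta}$: 1. (Approachability) there is an algorithm with $m\le K\,d_{\mathrm{lin}}^3H^6\iota^2/\epsilon^2$ episodes such that, in every linear VMDP with feature map $\phi$, with probability at least $1-\delta$, $$\mathrm{dist}(\mathbf V^{\pi^{\mathrm{out}}},\mathcal C)\le\inf_\pi\mathrm{dist}(\mathbf V^\pi,\mathcal C)+\epsilon;$$ 2. (CMDP with convex constraints) there is an algorithm with $m\le K\,d_{\mathrm{lin}}^3H^6\iota^3/\epsilon^2$ episodes such that, in every linear VMDP with cost with feature map $\phi$ for which some policy satisfies $\mathbf V^\pi\in\mathcal C$, with probability at least $1-\delta$, $$C^{\pi^{\mathrm{out}}}-\inf_{\pi:\,\mathbf V^\pi\in\mathcal C}C^\pi\le\epsilon\quad\text{and}\quad\mathrm{dist}(\mathbf V^{\pi^{\mathrm{out}}},\mathcal C)\le\epsilon.$$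 -/

import Mathlib

open MeasureTheory ProbabilityTheory

noncomputable section

/-- `ℝⁿ` with the Euclidean norm. -/
abbrev Vec (n : ℕ) : Type := EuclideanSpace ℝ (Fin n)

/-- The record of one episode: for each step `h`, the tuple
`(s_h, a_h, y_h, s_{h+1})` of state, action, observed feedback and next state. -/
abbrev Episode (S A Y : Type*) (H : ℕ) : Type _ := Fin H → S × A × Y × S

/-- The records of `k` consecutive episodes. -/
abbrev Data (S A Y : Type*) (H k : ℕ) : Type _ := Fin k → Episode S A Y H

section Models

variable {X S A Y : Type*} [MeasurableSpace X] [MeasurableSpace S] [MeasurableSpace A]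
  [MeasurableSpace Y]

/-- A (randomized, time-dependent, Markov) policy: at each step `h` a measurable map from states to
probability distributions over actions. A `Policy (X × S) A H` is a family of policies on `S`
that depends measurably on a parameter in `X`. -/
structure Policy (S A : Type*) [MeasurableSpace S] [MeasurableSpace A] (H : ℕ) where
  act : Fin H → Kernel S A
  isMarkov : ∀ h, IsMarkovKernel (act h)

/-- The member with parameter `x` of a measurable family of policies. -/
def Policy.at {H : ℕ} (π : Policy (X × S) A H) (x : X) : Policy S A H where
  act h := (π.act h).comap (fun s => (x, s)) (by fun_prop)
  isMarkov h := by
    have := π.isMarkov h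
    infer_instance

/-- A policy seen as a family with the one-point parameter space. -/
def Policy.lift {H : ℕ} (π : Policy S A H) : Policy (Unit × S) A H where
  act h := (π.act h).comap Prod.snd measurable_snd
  isMarkov h := by
    have := π.isMarkov h
    infer_instance

/-- An episodic controlled environment with horizon `H`: a fixed initial state, and for each step
`h` the joint law of (stochastic feedback, next state) after action `a` in state `s`. -/
structure Env (S A Y : Type*) [MeasurableSpace S] [MeasurableSpace A] [MeasurableSpace Y]
    (H : ℕ) where
  init : S
  step : Fin H → Kernel (S × A) (Y × S)
  isMarkov : ∀ h, IsMarkovKernel (step h)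

/-- The transition probabilities `ℙ_h(· | s, a)`. -/
def Env.trans {H : ℕ} (M : Env S A Y H) (h : Fin H) : Kernel (S × A) S := (M.step h).snd

/-- One step from state `s`, for the parameter `x`: the law of `(s, a, y, s')` where `a` is drawn
from `κ (x, s)` and then `(y, s')` from `P (s, a)`. -/
def stepKernel (κ : Kernel (X × S) A) (P : Kernel (S × A) (Y × S)) :
    Kernel (X × S) (S × A × Y × S) :=
  Kernel.deterministic Prod.snd measurable_snd ×ₖ
    (κ ⊗ₖ P.comap (fun p : (X × S) × A => (p.1.2, p.2)) (by fun_prop))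

/-- The law of `n` consecutive steps, for the parameter `x` and the starting state `s`. -/
def rollout : (n : ℕ) → (Fin n → Kernel (X × S) A) → (Fin n → Kernel (S × A) (Y × S)) →
    Kernel (X × S) (Fin n → S × A × Y × S)
  | 0, _, _ => Kernel.deterministic (fun _ => Fin.elim0) measurable_const
  | n + 1, κ, P =>
      (stepKernel (κ 0) (P 0) ⊗ₖ
        (rollout n (fun i => κ i.succ) (fun i => P i.succ)).comap
          (fun p : (X × S) × (S × A × Y × S) => (p.1.1, p.2.2.2.2)) (by fun_prop)).map
        (fun q => (Fin.cons q.1 q.2 : Fin (n + 1) → S × A × Y × S))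

/-- The law of one episode of `M`, played with the policy of parameter `x`. -/
def Env.episode {H : ℕ} (M : Env S A Y H) (π : Policy (X × S) A H) :
    Kernel X (Episode S A Y H) :=
  (rollout H π.act M.step).comap (fun x => (x, M.init)) (by fun_prop)

/-- `E_π[∑_h f_h(s_h, a_h)]`, the expected cumulative value of `f` in an episode that starts in
the initial state and follows `π`. -/
def Env.total {H : ℕ} {E : Type*} [NormedAddCommGroup E] [NormedSpace ℝ E] (M : Env S A Y H)
    (f : Fin H → S → A → E) (π : Policy S A H) : E :=
  ∫ τ, ∑ h, f h (τ h).1 (τ h).2.1 ∂(M.episode π.lift ())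

/-- A learning algorithm that interacts for `m` episodes. The policy of episode `k` is a function
of the records of the previous episodes; after `m` episodes the output is the uniform mixture of
finitely many policies that are functions of all the records. The algorithm sees the environment
only through these records. -/
structure Learner (S A Y : Type*) [MeasurableSpace S] [MeasurableSpace A] [MeasurableSpace Y]
    (H m : ℕ) where
  play : (k : ℕ) → Policy (Data S A Y H k × S) A H
  size : ℕ
  out : Fin (size + 1) → Policy (Data S A Y H m × S) A H

/-- The joint law of the records of the first `k` episodes when the learner `L` plays in `M`. -/
def Learner.law {H m : ℕ} (L : Learner S A Y H m) (M : Env S A Y H) :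
    (k : ℕ) → Measure (Data S A Y H k)
  | 0 => Measure.dirac Fin.elim0
  | k + 1 => ((L.law M k) ⊗ₘ (M.episode (L.play k))).map
      (fun q => (Fin.snoc q.1 q.2 : Fin (k + 1) → Episode S A Y H))

/-- Expected cumulative value of `f` under the output policy for the records `D`: the output is a
uniform mixture (one of the policies is drawn at the start of the episode and then followed). -/
def Learner.outTotal {H m : ℕ} {E : Type*} [NormedAddCommGroup E] [NormedSpace ℝ E]
    (L : Learner S A Y H m) (M : Env S A Y H) (f : Fin H → S → A → E) (D : Data S A Y H m) : E :=
  ((L.size : ℝ) + 1)⁻¹ • ∑ i, M.total f ((L.out i).at D)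

/-- Linear transitions: `ℙ_h(· | s, a) = ⟨μ_h(·), φ(s, a)⟩` for signed measures
`μ_h = (μ_h^{(1)}, …, μ_h^{(p)})` with `‖μ_h(S)‖ ≤ √p`. -/
def Env.HasLinearTrans {H p : ℕ} (M : Env S A Y H) (φ : S × A → Vec p) : Prop :=
  ∀ h, ∃ μ : Fin p → SignedMeasure S,
    ‖(WithLp.toLp 2 (fun i => μ i Set.univ) : Vec p)‖ ≤ √(p : ℝ) ∧
    ∀ s a B, MeasurableSet B → (M.trans h (s, a)).real B = ∑ i, μ i B * φ (s, a) i

/-- A function with values in a normed space is linear in the features, at each step, with linear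
maps of operator norm at most `√p`. -/
def IsLinearIn {H p : ℕ} {E : Type*} [NormedAddCommGroup E] [NormedSpace ℝ E]
    (φ : S × A → Vec p) (f : Fin H → S → A → E) : Prop :=
  ∀ h, ∃ W : Vec p →L[ℝ] E, ‖W‖ ≤ √(p : ℝ) ∧ ∀ s a, f h s a = W (φ (s, a))

/-- A known feature map: measurable, with values in the unit ball. The last condition is the
measurability that maximization over actions needs: countably many measurable action rules whose
features are dense in `φ(s, A)`, for each state `s`. It holds when `A` is countable, and when `A`
is a separable space and `φ(s, ·)` is continuous for each `s` (with constant rules). -/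
structure IsFeatureMap {p : ℕ} (φ : S × A → Vec p) : Prop where
  measurable : Measurable φ
  norm_le : ∀ x, ‖φ x‖ ≤ 1
  selectors : ∃ g : ℕ → S → A, (∀ n, Measurable (g n)) ∧
    ∀ s a, φ (s, a) ∈ closure (Set.range fun n => φ (s, g n s))

end Models

section VMDP

variable {S A : Type*} [MeasurableSpace S] [MeasurableSpace A]

/-- A vector-valued MDP with `d`-dimensional returns: the observed feedback is a stochastic sample
of the return vector, in the unit ball almost surely. -/
structure VMDP (S A : Type*) [MeasurableSpace S] [MeasurableSpace A] (H d : ℕ)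
    extends Env S A (Vec d) H where
  ball : ∀ h s a, ∀ᵐ y ∂(step h (s, a)), ‖y.1‖ ≤ 1

/-- The return function `r_h(s, a)`, the mean of the return samples. -/
def VMDP.ret {H d : ℕ} (M : VMDP S A H d) (h : Fin H) (s : S) (a : A) : Vec d :=
  ∫ y, y.1 ∂(M.step h (s, a))

/-- Linear VMDP with feature map `φ`. -/
def VMDP.IsLinear {H d p : ℕ} (M : VMDP S A H d) (φ : S × A → Vec p) : Prop :=
  M.HasLinearTrans φ ∧ IsLinearIn φ M.ret

/-- With probability at least `1 - δ` after `m` episodes in `M`, the output policy satisfies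
`dist(V^out, C) ≤ inf_π dist(V^π, C) + ε`. -/
def Learner.Approaches {H d m : ℕ} (L : Learner S A (Vec d) H m) (M : VMDP S A H d)
    (C : Set (Vec d)) (ε δ : ℝ) : Prop :=
  L.law M.toEnv m {D | ¬ ∀ π : Policy S A H,
    Metric.infDist (L.outTotal M.toEnv M.ret D) C ≤
      Metric.infDist (M.total M.ret π) C + ε} ≤ ENNReal.ofReal δ

/-- A VMDP with a scalar cost: the feedback is a sample of the return vector, in the unit ball, and
a sample of the cost, in `[-1, 1]`. -/
structure CostVMDP (S A : Type*) [MeasurableSpace S] [MeasurableSpace A] (H d : ℕ)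
    extends Env S A (Vec d × ℝ) H where
  ball : ∀ h s a, ∀ᵐ y ∂(step h (s, a)), ‖y.1.1‖ ≤ 1 ∧ |y.1.2| ≤ 1

/-- The return function `r_h(s, a)`. -/
def CostVMDP.ret {H d : ℕ} (M : CostVMDP S A H d) (h : Fin H) (s : S) (a : A) : Vec d :=
  ∫ y, y.1.1 ∂(M.step h (s, a))

/-- The cost function `c_h(s, a)`. -/
def CostVMDP.cost {H d : ℕ} (M : CostVMDP S A H d) (h : Fin H) (s : S) (a : A) : ℝ :=
  ∫ y, y.1.2 ∂(M.step h (s, a))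

/-- Transitions, returns and costs are linear in the features. -/
def CostVMDP.IsLinear {H d p : ℕ} (M : CostVMDP S A H d) (φ : S × A → Vec p) : Prop :=
  M.HasLinearTrans φ ∧ IsLinearIn φ M.ret ∧ IsLinearIn φ M.cost

/-- Some policy satisfies the constraint `V^π ∈ C`. -/
def CostVMDP.IsFeasible {H d : ℕ} (M : CostVMDP S A H d) (C : Set (Vec d)) : Prop :=
  ∃ π : Policy S A H, M.total M.ret π ∈ C

/-- With probability at least `1 - δ` after `m` episodes in `M`, the output policy has cost at most
`inf {C^π | V^π ∈ C} + ε`, and `dist(V^out, C) ≤ ε`. -/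
def Learner.SolvesCMDP {H d m : ℕ} (L : Learner S A (Vec d × ℝ) H m) (M : CostVMDP S A H d)
    (C : Set (Vec d)) (ε δ : ℝ) : Prop :=
  L.law M.toEnv m {D | ¬ ((∀ π : Policy S A H, M.total M.ret π ∈ C →
      L.outTotal M.toEnv M.cost D ≤ M.total M.cost π + ε) ∧
    Metric.infDist (L.outTotal M.toEnv M.ret D) C ≤ ε)} ≤ ENNReal.ofReal δ

end VMDP

end

set_option linter.unusedSectionVars false

noncomputable section

/-! ### Episode laws and backward recursion for expected totals -/

section Rollout

variable {X S A Y : Type*} [MeasurableSpace X] [MeasurableSpace S] [MeasurableSpace A]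
  [MeasurableSpace Y]

/-! Exploration never looks at the target set or at the cost objective. It estimates the value
vectors of finitely many policies, and a mixture is selected from the estimates at the end. With
return and cost placed in one Hilbert space, both statements follow from
`IsFeatureMap.exists_estimates`.

Finite reduction. Approximate barycentric spanners (`exists_anchors`) replace the features by at
most `p` coordinates bounded by 2, and turn linearity into "determined by the values at the anchors"
(`Env.fits_of_linear`). Action value functions are then linear in bounded coordinates, so nearly
greedy rules for a finite grid of directions suffice: for every direction θ some sequence of rules
is nearly optimal (`FeatureModel.exists_rules_val_ge`). Hence no direction separates the value of a
policy from the values of these sequences, and an approximate Carathéodory argument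
(`exists_mixture`) gives uniform mixtures of one fixed size that approximate the value of every
policy.

Exploration. The environments that fit the features have a finite net for all relevant quantities
(`FeatureModel.exists_net`). The learner retains the candidates in the net whose regression
residuals are small for a finite class of targets: the feedback, and clipped functions of the next
state. Up to rounding the latter include the value functions of all sequences of rules in all linear
models (`FeatureModel.exists_val_det_eq`); no bonus enters these functions, so the logarithm of the
size of the class is only of order `q log N`. The residuals obey a martingale inequality in Hilbert
space that is free of dimension (`Learner.law_residSum_le`), so `d` costs nothing.

Each episode plays a sequence of rules on which two surviving candidates disagree by more than ε/4,
if there is one. A simulation lemma (`FeatureModel.abs_val_sub_val_le`) bounds the error of each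
candidate by an expected elliptical bonus under the true environment, so disagreement forces a large
expected bonus (`Explorer.total_bonus_ge`). The bonus is paid for by the growth of log-determinants
of Gram matrices, which is bounded; an exponential supermartingale shows that disagreement is
unlikely to last for all `m` episodes (`Explorer.law_goodHist_allWide_le`). Confidence sets only
shrink, so after that no sequence is in dispute, and since a neighbour of the truth survives, all
survivors are accurate.

Count. With ℓ of order log(pH²/(εδ)), the confidence level is `L ~ pℓ`, the total potential is `~
L·pℓ`, and the gain per episode is `~ εα/H²` with `α ~ ε/H²`. So `m ~ p²H⁴ℓ²/ε²`, and ℓ = O(Hι)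
gives the stated power of `H` for `p ≥ 2`. For `p ≤ 1` all policies have equal value and no episode
is needed. -/

instance stepKernel.isMarkov (κ : Kernel (X × S) A) (P : Kernel (S × A) (Y × S))
    [IsMarkovKernel κ] [IsMarkovKernel P] : IsMarkovKernel (stepKernel κ P) := by
  unfold stepKernel
  infer_instance

theorem measurable_finCons {Z : Type*} [MeasurableSpace Z] (n : ℕ) :
    Measurable (fun q : Z × (Fin n → Z) => (Fin.cons q.1 q.2 : Fin (n + 1) → Z)) := by
  refine measurable_pi_lambda _ fun i => ?_
  refine Fin.cases ?_ (fun j => ?_) i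
  · simpa using measurable_fst
  · simpa using measurable_pi_iff.1 measurable_snd j

theorem measurable_finSnoc {Z : Type*} [MeasurableSpace Z] (n : ℕ) :
    Measurable (fun q : (Fin n → Z) × Z => (Fin.snoc q.1 q.2 : Fin (n + 1) → Z)) := by
  refine measurable_pi_lambda _ fun i => ?_
  refine Fin.lastCases ?_ (fun j => ?_) i
  · simpa using measurable_snd
  · simpa using measurable_pi_iff.1 measurable_fst j

theorem measurable_finInit {Z : Type*} [MeasurableSpace Z] (n : ℕ) :
    Measurable (fun D : Fin (n + 1) → Z => (Fin.init D : Fin n → Z)) :=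
  measurable_pi_lambda _ fun i => measurable_pi_apply i.castSucc

theorem isMarkovKernel_rollout : ∀ (n : ℕ) (κ : Fin n → Kernel (X × S) A)
    (P : Fin n → Kernel (S × A) (Y × S)), (∀ i, IsMarkovKernel (κ i)) →
    (∀ i, IsMarkovKernel (P i)) → IsMarkovKernel (rollout n κ P)
  | 0, _, _, _, _ => by unfold rollout; infer_instance
  | n + 1, κ, P, hκ, hP => by
      have := isMarkovKernel_rollout n (fun i => κ i.succ) (fun i => P i.succ)
        (fun i => hκ i.succ) (fun i => hP i.succ)
      have := hκ 0
      have := hP 0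
      unfold rollout
      exact Kernel.IsMarkovKernel.map _ (measurable_finCons n)

theorem stepKernel_apply (κ : Kernel (X × S) A) (P : Kernel (S × A) (Y × S))
    [IsMarkovKernel κ] [IsMarkovKernel P] (x : X) (s : S) :
    stepKernel κ P (x, s) =
      ((κ ⊗ₖ P.comap (fun p : (X × S) × A => (p.1.2, p.2)) (by fun_prop)) (x, s)).map
        (Prod.mk s) := by
  rw [stepKernel, Kernel.prod_apply, Kernel.deterministic_apply, Measure.dirac_prod]

theorem lintegral_rollout_succ (n : ℕ) (κ : Fin (n + 1) → Kernel (X × S) A)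
    (P : Fin (n + 1) → Kernel (S × A) (Y × S)) (hκ : ∀ i, IsMarkovKernel (κ i))
    (hP : ∀ i, IsMarkovKernel (P i)) (x : X) (s : S)
    {F : (Fin (n + 1) → S × A × Y × S) → ENNReal} (hF : Measurable F) :
    ∫⁻ τ, F τ ∂(rollout (n + 1) κ P (x, s)) =
      ∫⁻ a, ∫⁻ z, ∫⁻ τ, F (Fin.cons (s, a, z) τ)
        ∂(rollout n (fun i => κ i.succ) (fun i => P i.succ) (x, z.2))
        ∂(P 0 (s, a)) ∂(κ 0 (x, s)) := by
  have := isMarkovKernel_rollout n (fun i => κ i.succ) (fun i => P i.succ)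
        (fun i => hκ i.succ) (fun i => hP i.succ)
  have := hκ 0
  have := hP 0
  have hc := measurable_finCons (Z := S × A × Y × S) n
  have hFc : Measurable (fun q : (S × A × Y × S) × (Fin n → S × A × Y × S) =>
    F (Fin.cons q.1 q.2)) := hF.comp hc
  rw [rollout, Kernel.lintegral_map _ hc _ hF, Kernel.lintegral_compProd _ _ _ hFc,
    stepKernel_apply]
  have h1 : Measurable (fun b : S × A × Y × S => ∫⁻ c, F (Fin.cons b c)
      ∂(rollout n (fun i => κ i.succ) (fun i => P i.succ) (x, b.2.2.2))) := by
    have : Measurable (Function.uncurry fun (b : S × A × Y × S)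
        (c : Fin n → S × A × Y × S) => F (Fin.cons b c)) := hF.comp hc
    exact this.lintegral_kernel_prod_right
      (κ := (rollout n (fun i => κ i.succ) (fun i => P i.succ)).comap
        (fun b : S × A × Y × S => (x, b.2.2.2)) (by fun_prop))
  simp only [Kernel.comap_apply]
  rw [lintegral_map h1 (by fun_prop)]
  exact Kernel.lintegral_compProd _ _ _ (h1.comp measurable_prodMk_left)

theorem integral_rollout_succ {E : Type*} [NormedAddCommGroup E] [NormedSpace ℝ E]
    [MeasurableSpace E] [BorelSpace E] [SecondCountableTopology E]
    (n : ℕ) (κ : Fin (n + 1) → Kernel (X × S) A)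
    (P : Fin (n + 1) → Kernel (S × A) (Y × S)) (hκ : ∀ i, IsMarkovKernel (κ i))
    (hP : ∀ i, IsMarkovKernel (P i)) (x : X) (s : S)
    {F : (Fin (n + 1) → S × A × Y × S) → E} (hF : Measurable F) {C : ℝ} (hC : ∀ τ, ‖F τ‖ ≤ C) :
    ∫ τ, F τ ∂(rollout (n + 1) κ P (x, s)) =
      ∫ a, ∫ z, ∫ τ, F (Fin.cons (s, a, z) τ)
        ∂(rollout n (fun i => κ i.succ) (fun i => P i.succ) (x, z.2))
        ∂(P 0 (s, a)) ∂(κ 0 (x, s)) := by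
  have := isMarkovKernel_rollout n (fun i => κ i.succ) (fun i => P i.succ)
        (fun i => hκ i.succ) (fun i => hP i.succ)
  have := hκ 0
  have := hP 0
  have hc := measurable_finCons (Z := S × A × Y × S) n
  have hFc : Measurable (fun q : (S × A × Y × S) × (Fin n → S × A × Y × S) =>
    F (Fin.cons q.1 q.2)) := hF.comp hc
  rw [rollout, Kernel.map_apply _ hc, integral_map hc.aemeasurable
    hF.stronglyMeasurable.aestronglyMeasurable, ProbabilityTheory.integral_compProd
      (.of_bound hFc.stronglyMeasurable.aestronglyMeasurable C (.of_forall fun _ => hC _)),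
    stepKernel_apply]
  have h1 : StronglyMeasurable (fun b : S × A × Y × S => ∫ c, F (Fin.cons b c)
      ∂(rollout n (fun i => κ i.succ) (fun i => P i.succ) (x, b.2.2.2))) := by
    have : StronglyMeasurable (Function.uncurry fun (b : S × A × Y × S)
        (c : Fin n → S × A × Y × S) => F (Fin.cons b c)) := (hF.comp hc).stronglyMeasurable
    exact this.integral_kernel_prod_right
      (κ := (rollout n (fun i => κ i.succ) (fun i => P i.succ)).comap
        (fun b : S × A × Y × S => (x, b.2.2.2)) (by fun_prop))
  simp only [Kernel.comap_apply]
  rw [integral_map (by fun_prop) h1.aestronglyMeasurable, ProbabilityTheory.integral_compProd]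
  · simp only [Kernel.comap_apply]
  · refine .of_bound (h1.comp_measurable (by fun_prop)).aestronglyMeasurable C
      (.of_forall fun b => ?_)
    refine (norm_integral_le_of_norm_le_const (.of_forall fun _ => hC _)).trans ?_
    simp

/-- A bound for the expectation of a function of one step, from a conditional bound. -/
theorem lintegral_rollout_coord_le : ∀ (n : ℕ) (κ : Fin n → Kernel (X × S) A)
    (P : Fin n → Kernel (S × A) (Y × S)), (∀ i, IsMarkovKernel (κ i)) →
    (∀ i, IsMarkovKernel (P i)) → ∀ (x : X) (s : S) (h : Fin n)
    {F : S × A × Y × S → ENNReal}, Measurable F → ∀ {c : ENNReal},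
    (∀ s a, ∫⁻ z, F (s, a, z) ∂(P h (s, a)) ≤ c) →
    ∫⁻ τ, F (τ h) ∂(rollout n κ P (x, s)) ≤ c
  | 0, _, _, _, _, _, _, h, _, _, _, _ => h.elim0
  | n + 1, κ, P, hκ, hP, x, s, h, F, hF, c, hc => by
      have := isMarkovKernel_rollout n (fun i => κ i.succ) (fun i => P i.succ)
        (fun i => hκ i.succ) (fun i => hP i.succ)
      have := hκ 0
      have := hP 0
      have hFh : Measurable (fun τ : Fin (n + 1) → S × A × Y × S => F (τ h)) :=
        hF.comp (measurable_pi_apply h)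
      rw [lintegral_rollout_succ n κ P hκ hP x s hFh]
      revert hc
      refine Fin.cases (fun hc => ?_) (fun j hc => ?_) h
      · simp only [Fin.cons_zero, lintegral_const, measure_univ, mul_one]
        exact (lintegral_mono fun a => hc s a).trans (by simp)
      · simp only [Fin.cons_succ]
        calc _ ≤ ∫⁻ a, ∫⁻ _, c ∂(P 0 (s, a)) ∂(κ 0 (x, s)) :=
              lintegral_mono fun a => lintegral_mono fun z : Y × S =>
                lintegral_rollout_coord_le n _ _ (fun i => hκ i.succ) (fun i => hP i.succ) x z.2 j
                  hF hc
          _ = c := by simp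

/-- Singletons of `S` need not be measurable, so "the first recorded state is the initial one" is
expressed through measurable sets that contain it. -/
theorem ae_rollout_init (n : ℕ) (κ : Fin (n + 1) → Kernel (X × S) A)
    (P : Fin (n + 1) → Kernel (S × A) (Y × S)) (hκ : ∀ i, IsMarkovKernel (κ i))
    (hP : ∀ i, IsMarkovKernel (P i)) (x : X) (s : S) {B : Set S} (hB : MeasurableSet B)
    (hs : s ∈ B) : rollout (n + 1) κ P (x, s) {τ | (τ 0).1 ∉ B} = 0 := by
  have hm : MeasurableSet {τ : Fin (n + 1) → S × A × Y × S | (τ 0).1 ∉ B} :=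
    (((measurable_pi_apply 0).fst) hB).compl
  rw [← lintegral_indicator_one hm, lintegral_rollout_succ n κ P hκ hP x s
    (measurable_one.indicator hm)]
  simp [Set.indicator, hs]

variable {E : Type*} [NormedAddCommGroup E] [NormedSpace ℝ E]

/-- Expected cumulative value over `n` steps, by backward recursion. -/
def val : (n : ℕ) → (Fin n → S → Measure A) → (Fin n → Kernel (S × A) (Y × S)) →
    (Fin n → S → A → E) → S → E
  | 0, _, _, _, _ => 0
  | n + 1, κ, P, f, s =>
      ∫ a, (f 0 s a + ∫ z, val n (fun i => κ i.succ) (fun i => P i.succ) (fun i => f i.succ) z.2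
        ∂(P 0 (s, a))) ∂(κ 0 s)

variable [MeasurableSpace E] [BorelSpace E] [SecondCountableTopology E] [CompleteSpace E]

theorem measurable_rewardSum {n : ℕ} {f : Fin n → S → A → E}
    (hf : ∀ h, Measurable (Function.uncurry (f h))) :
    Measurable (fun τ : Fin n → S × A × Y × S => ∑ h, f h (τ h).1 (τ h).2.1) := by
  refine Finset.measurable_sum _ fun h _ => ?_
  exact (hf h).comp (by fun_prop : Measurable fun τ : Fin n → S × A × Y × S =>
    ((τ h).1, (τ h).2.1))

theorem norm_rewardSum_le {n : ℕ} {f : Fin n → S → A → E} {C : ℝ} (hC : ∀ h s a, ‖f h s a‖ ≤ C)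
    (τ : Fin n → S × A × Y × S) : ‖∑ h, f h (τ h).1 (τ h).2.1‖ ≤ n * C :=
  (norm_sum_le _ _).trans ((Finset.sum_le_sum fun h _ => hC h _ _).trans (by simp))

theorem integral_rollout : ∀ (n : ℕ) (κ : Fin n → Kernel (X × S) A)
    (P : Fin n → Kernel (S × A) (Y × S)), (∀ i, IsMarkovKernel (κ i)) →
    (∀ i, IsMarkovKernel (P i)) → ∀ (x : X) (s : S)
    {f : Fin n → S → A → E}, (∀ h, Measurable (Function.uncurry (f h))) → ∀ {C : ℝ},
    (∀ h s a, ‖f h s a‖ ≤ C) →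
    ∫ τ, ∑ h, f h (τ h).1 (τ h).2.1 ∂(rollout n κ P (x, s)) =
      val n (fun i s => κ i (x, s)) P f s
  | 0, _, _, _, _, _, _, _, _, _, _ => by simp [val]
  | n + 1, κ, P, hκ, hP, x, s, f, hf, C, hC => by
      have hM := isMarkovKernel_rollout n (fun i => κ i.succ) (fun i => P i.succ)
        (fun i => hκ i.succ) (fun i => hP i.succ)
      have := hκ 0
      have := hP 0
      rw [integral_rollout_succ n κ P hκ hP x s (measurable_rewardSum hf) (norm_rewardSum_le hC),
        val]
      have hmt := measurable_rewardSum (Y := Y) (fun h => hf h.succ)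
      have hsm : StronglyMeasurable fun z : Y × S =>
          ∫ τ, ∑ h, f (Fin.succ h) (τ h).1 (τ h).2.1
          ∂(rollout n (fun i => κ i.succ) (fun i => P i.succ) (x, z.2)) :=
        (StronglyMeasurable.integral_kernel (κ := rollout n (fun i => κ i.succ)
          (fun i => P i.succ)) hmt.stronglyMeasurable).comp_measurable
          (by fun_prop : Measurable fun z : Y × S => (x, z.2))
      refine integral_congr_ae (.of_forall fun a => ?_)
      have key : ∀ z : Y × S, ∫ τ, ∑ h, f h ((Fin.cons (s, a, z) τ : Fin (n + 1) → _) h).1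
          ((Fin.cons (s, a, z) τ : Fin (n + 1) → S × A × Y × S) h).2.1
          ∂(rollout n (fun i => κ i.succ) (fun i => P i.succ) (x, z.2)) =
          f 0 s a + ∫ τ, ∑ h, f (Fin.succ h) (τ h).1 (τ h).2.1
            ∂(rollout n (fun i => κ i.succ) (fun i => P i.succ) (x, z.2)) := by
        intro z
        simp only [Fin.sum_univ_succ, Fin.cons_zero, Fin.cons_succ]
        rw [integral_add (integrable_const _) (.of_bound
          hmt.stronglyMeasurable.aestronglyMeasurable _ (.of_forall
            (norm_rewardSum_le fun h => hC h.succ)))]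
        simp
      simp only [key]
      rw [integral_add (integrable_const _) (.of_bound hsm.aestronglyMeasurable (n * C)
        (.of_forall fun z => ?_))]
      · simp only [integral_const, probReal_univ, one_smul]
        congr 1
        refine integral_congr_ae (.of_forall fun z => ?_)
        exact integral_rollout n _ _ (fun i => hκ i.succ) (fun i => hP i.succ) x z.2
          (fun h => hf h.succ) (fun h => hC h.succ)
      · refine (norm_integral_le_of_norm_le_const (.of_forall
          (norm_rewardSum_le fun h => hC h.succ))).trans ?_
        simp

/-- Measurability in the starting state is read off from the integral of a fixed function against
the rollout kernel, with a one-point parameter space. -/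
theorem stronglyMeasurable_val (n : ℕ) (κ : Fin n → Kernel S A)
    (P : Fin n → Kernel (S × A) (Y × S)) (hκ : ∀ i, IsMarkovKernel (κ i))
    (hP : ∀ i, IsMarkovKernel (P i)) {f : Fin n → S → A → E}
    (hf : ∀ h, Measurable (Function.uncurry (f h))) {C : ℝ} (hC : ∀ h s a, ‖f h s a‖ ≤ C) :
    StronglyMeasurable (val n (fun i s => κ i s) P f) := by
  let κ' : Fin n → Kernel (Unit × S) A := fun i => (κ i).comap Prod.snd measurable_snd
  have hκ' : ∀ i, IsMarkovKernel (κ' i) := fun i => by have := hκ i; dsimp [κ']; infer_instance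
  have := isMarkovKernel_rollout n κ' P hκ' hP
  have h1 := (StronglyMeasurable.integral_kernel (κ := rollout n κ' P)
    (measurable_rewardSum (Y := Y) hf).stronglyMeasurable).comp_measurable
    (by fun_prop : Measurable fun s : S => ((), s))
  convert h1 using 1
  ext s
  exact (integral_rollout n κ' P hκ' hP () s hf hC).symm

theorem norm_val_le (n : ℕ) (κ : Fin n → Kernel S A)
    (P : Fin n → Kernel (S × A) (Y × S)) (hκ : ∀ i, IsMarkovKernel (κ i))
    (hP : ∀ i, IsMarkovKernel (P i)) {f : Fin n → S → A → E}
    (hf : ∀ h, Measurable (Function.uncurry (f h))) {C : ℝ} (hC : ∀ h s a, ‖f h s a‖ ≤ C)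
    (s : S) : ‖val n (fun i s => κ i s) P f s‖ ≤ n * C := by
  let κ' : Fin n → Kernel (Unit × S) A := fun i => (κ i).comap Prod.snd measurable_snd
  have hκ' : ∀ i, IsMarkovKernel (κ' i) := fun i => by have := hκ i; dsimp [κ']; infer_instance
  have := isMarkovKernel_rollout n κ' P hκ' hP
  rw [show val n (fun i s => κ i s) P f s = _ from
    (integral_rollout n κ' P hκ' hP () s hf hC).symm]
  refine (norm_integral_le_of_norm_le_const (.of_forall
          (norm_rewardSum_le hC))).trans ?_
  simp

end Rollout

/-! ### Laws of the data, selected policies, and total values -/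

section Law

variable {X S A Y : Type*} [MeasurableSpace X] [MeasurableSpace S] [MeasurableSpace A]
  [MeasurableSpace Y]

instance Env.isMarkovKernel_episode {H : ℕ} (M : Env S A Y H) (π : Policy (X × S) A H) :
    IsMarkovKernel (M.episode π) := by
  have := isMarkovKernel_rollout H π.act M.step π.isMarkov M.isMarkov
  unfold Env.episode
  infer_instance

instance Learner.isProbabilityMeasure_law {H m : ℕ} (L : Learner S A Y H m) (M : Env S A Y H) :
    ∀ k, IsProbabilityMeasure (L.law M k)
  | 0 => by unfold Learner.law; infer_instance
  | k + 1 => by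
      have := Learner.isProbabilityMeasure_law L M k
      unfold Learner.law
      exact Measure.isProbabilityMeasure_map (measurable_finSnoc k).aemeasurable

theorem Learner.lintegral_law_succ {H m : ℕ} (L : Learner S A Y H m) (M : Env S A Y H) (k : ℕ)
    {G : Data S A Y H (k + 1) → ENNReal} (hG : Measurable G) :
    ∫⁻ D, G D ∂(L.law M (k + 1)) =
      ∫⁻ D, ∫⁻ τ, G (Fin.snoc D τ) ∂(M.episode (L.play k) D) ∂(L.law M k) := by
  have hs := measurable_finSnoc (Z := Episode S A Y H) k
  rw [Learner.law, lintegral_map hG hs]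
  exact Measure.lintegral_compProd (hG.comp hs)

/-- A nonnegative supermartingale along the data has expectation at most its initial value. -/
theorem Learner.lintegral_law_le {H m : ℕ} (L : Learner S A Y H m) (M : Env S A Y H)
    (G : (k : ℕ) → Data S A Y H k → ENNReal) (hG : ∀ k, Measurable (G k))
    (hstep : ∀ k D, ∫⁻ τ, G (k + 1) (Fin.snoc D τ) ∂(M.episode (L.play k) D) ≤ G k D) :
    ∀ k, ∫⁻ D, G k D ∂(L.law M k) ≤ G 0 Fin.elim0
  | 0 => by simp [Learner.law, lintegral_dirac' _ (hG 0)]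
  | k + 1 => by
      rw [L.lintegral_law_succ M k (hG (k + 1))]
      exact (lintegral_mono fun D => hstep k D).trans (Learner.lintegral_law_le L M G hG hstep k)

theorem Learner.law_init_preimage {H m : ℕ} (L : Learner S A Y H m) (M : Env S A Y H) (k : ℕ)
    {B : Set (Data S A Y H k)} (hB : MeasurableSet B) :
    L.law M (k + 1) {D | Fin.init D ∈ B} = L.law M k B := by
  have hm : MeasurableSet {D : Data S A Y H (k + 1) | (Fin.init D : Data S A Y H k) ∈ B} :=
    measurable_finInit k hB
  rw [← lintegral_indicator_one hm, L.lintegral_law_succ M k (measurable_one.indicator hm),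
    ← lintegral_indicator_one hB]
  refine lintegral_congr fun D => ?_
  by_cases hD : D ∈ B <;> simp [Set.indicator, Fin.init_snoc, hD]

/-- A policy selected among finitely many by a measurable code. -/
def Policy.select {J : Type*} [Countable J] [MeasurableSpace J] [MeasurableSingletonClass J]
    {H : ℕ} (code : X → J) (hcode : Measurable code) (pol : J → Policy S A H) :
    Policy (X × S) A H where
  act h :=
    { toFun := fun p => (pol (code p.1)).act h p.2
      measurable' := by
        have h1 : Measurable (fun q : J × S => (pol q.1).act h q.2) :=
          measurable_from_prod_countable_right fun j => ((pol j).act h).measurable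
        exact h1.comp (by fun_prop : Measurable fun p : X × S => (code p.1, p.2)) }
  isMarkov h := ⟨fun p => by
    have := (pol (code p.1)).isMarkov h
    change IsProbabilityMeasure ((pol (code p.1)).act h p.2)
    infer_instance⟩

theorem Policy.at_select {J : Type*} [Countable J] [MeasurableSpace J]
    [MeasurableSingletonClass J] {H : ℕ} (code : X → J) (hcode : Measurable code)
    (pol : J → Policy S A H) (x : X) :
    (Policy.select code hcode pol).at x = pol (code x) := by
  have h : ((Policy.select code hcode pol).at x).act = (pol (code x)).act := by
    funext h
    ext s B hB
    rfl
  cases hp : pol (code x)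
  cases hq : (Policy.select code hcode pol).at x
  simp_all

/-- The policy that follows deterministic rules. -/
def detPolicy {H : ℕ} (g : Fin H → S → A) (hg : ∀ h, Measurable (g h)) : Policy S A H where
  act h := Kernel.deterministic (g h) (hg h)
  isMarkov _ := inferInstance

variable {E : Type*} [NormedAddCommGroup E] [NormedSpace ℝ E]
  [MeasurableSpace E] [BorelSpace E] [SecondCountableTopology E] [CompleteSpace E]

theorem Env.total_eq_val {H : ℕ} (M : Env S A Y H) {f : Fin H → S → A → E}
    (hf : ∀ h, Measurable (Function.uncurry (f h))) {C : ℝ} (hC : ∀ h s a, ‖f h s a‖ ≤ C)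
    (π : Policy S A H) :
    M.total f π = val H (fun i s => π.act i s) M.step f M.init := by
  rw [Env.total, Env.episode, Kernel.comap_apply]
  exact integral_rollout H _ _ π.lift.isMarkov M.isMarkov () M.init hf hC

theorem Env.integral_episode {H : ℕ} (M : Env S A Y H) {f : Fin H → S → A → E}
    (hf : ∀ h, Measurable (Function.uncurry (f h))) {C : ℝ} (hC : ∀ h s a, ‖f h s a‖ ≤ C)
    (π : Policy (X × S) A H) (x : X) :
    ∫ τ, ∑ h, f h (τ h).1 (τ h).2.1 ∂(M.episode π x) = M.total f (π.at x) := by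
  rw [M.total_eq_val hf hC, Env.episode, Kernel.comap_apply]
  exact integral_rollout H _ _ π.isMarkov M.isMarkov x M.init hf hC

theorem Env.norm_total_le {H : ℕ} (M : Env S A Y H) {f : Fin H → S → A → E}
    {C : ℝ} (hC : ∀ h s a, ‖f h s a‖ ≤ C)
    (π : Policy S A H) : ‖M.total f π‖ ≤ H * C := by
  refine (norm_integral_le_of_norm_le_const (.of_forall (norm_rewardSum_le hC))).trans ?_
  simp

theorem Env.total_clm {H : ℕ} {F : Type*} [NormedAddCommGroup F] [NormedSpace ℝ F]
    [CompleteSpace F] (M : Env S A Y H) {f : Fin H → S → A → E}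
    (hf : ∀ h, Measurable (Function.uncurry (f h))) {C : ℝ} (hC : ∀ h s a, ‖f h s a‖ ≤ C)
    (π : Policy S A H) (T : E →L[ℝ] F) :
    M.total (fun h s a => T (f h s a)) π = T (M.total f π) := by
  rw [Env.total, Env.total, ← T.integral_comp_comm]
  · simp
  · exact .of_bound (measurable_rewardSum hf).stronglyMeasurable.aestronglyMeasurable _
      (.of_forall (norm_rewardSum_le hC))

end Law

/-! ### Martingale concentration in a Hilbert space -/

section Concentration

/-- Convexity of `u ↦ cosh √u`, in the form used for martingales with values in a Hilbert space. -/
theorem cosh_sqrt_le {r a t : ℝ} (ht1 : -1 ≤ t) (ht2 : t ≤ 1) :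
    Real.cosh (√(r ^ 2 + 2 * (r * a * t) + a ^ 2)) ≤
      Real.cosh r * Real.cosh a + t * (Real.sinh r * Real.sinh a) := by
  have hu : 0 ≤ r ^ 2 + 2 * (r * a * t) + a ^ 2 := by
    nlinarith [mul_nonneg (by linarith : 0 ≤ 1 + t) (sq_nonneg (r + a)),
      mul_nonneg (by linarith : 0 ≤ 1 - t) (sq_nonneg (r - a))]
  have h0 := Real.hasSum_cosh (√(r ^ 2 + 2 * (r * a * t) + a ^ 2))
  have h1 := (Real.hasSum_cosh (r + a)).mul_left ((1 + t) / 2)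
  have h2 := (Real.hasSum_cosh (r - a)).mul_left ((1 - t) / 2)
  have h3 := hasSum_le (fun n => ?_) h0 (h1.add h2)
  · refine h3.trans (le_of_eq ?_)
    rw [Real.cosh_add, Real.cosh_sub]
    ring
  · rw [pow_mul, Real.sq_sqrt hu, pow_mul, pow_mul]
    -- The power series of `cosh √u` has terms `uⁿ/(2n)!`, each convex in `u ≥ 0`; the argument is
    -- the combination of `(r+a)²` and `(r-a)²` with weights `(1±t)/2`.
    have hc := (convexOn_pow (𝕜 := ℝ) n).2 (Set.mem_Ici.2 (sq_nonneg (r + a)))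
      (Set.mem_Ici.2 (sq_nonneg (r - a))) (by linarith : 0 ≤ (1 + t) / 2)
      (by linarith : 0 ≤ (1 - t) / 2) (by ring)
    simp only [smul_eq_mul] at hc
    rw [show (1 + t) / 2 * (r + a) ^ 2 + (1 - t) / 2 * (r - a) ^ 2 =
      r ^ 2 + 2 * (r * a * t) + a ^ 2 by ring] at hc
    rw [← mul_div_assoc, ← mul_div_assoc, ← add_div]
    gcongr

variable {E : Type*} [NormedAddCommGroup E] [InnerProductSpace ℝ E]

/-- Apply `cosh_sqrt_le` with `t = ⟪x, ξ⟫ / (‖x‖ b)`. What exceeds the factor `exp (b²/2)` is linear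
in ξ, with a coefficient that does not depend on ξ, so it disappears for centred increments. -/
theorem exists_cosh_norm_add_le (x : E) {b : ℝ} (hb : 0 ≤ b) :
    ∃ c : ℝ, ∀ ξ : E, ‖ξ‖ ≤ b →
      Real.cosh ‖x + ξ‖ ≤ Real.cosh ‖x‖ * Real.exp (b ^ 2 / 2) + c * inner ℝ x ξ := by
  have hcosh := Real.cosh_le_exp_half_sq b
  rcases eq_or_ne x 0 with rfl | hx
  · refine ⟨0, fun ξ hξ => ?_⟩
    simp only [zero_add, norm_zero, Real.cosh_zero, one_mul, zero_mul, add_zero]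
    exact (Real.cosh_le_cosh.2 (by rwa [abs_norm, abs_of_nonneg hb])).trans hcosh
  have hr : 0 < ‖x‖ := norm_pos_iff.2 hx
  rcases hb.eq_or_lt with rfl | hb'
  · refine ⟨0, fun ξ hξ => ?_⟩
    rw [norm_le_zero_iff.1 hξ]
    simp
  refine ⟨Real.sinh ‖x‖ * Real.sinh b / (‖x‖ * b), fun ξ hξ => ?_⟩
  have hin := abs_le.1 ((abs_real_inner_le_norm x ξ).trans
    (mul_le_mul_of_nonneg_left hξ (norm_nonneg x)))
  have hrb : 0 < ‖x‖ * b := mul_pos hr hb'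
  have h1 := cosh_sqrt_le (r := ‖x‖) (a := b) (t := inner ℝ x ξ / (‖x‖ * b))
    (by rw [le_div_iff₀ hrb]; linarith [hin.1]) (by rw [div_le_iff₀ hrb]; linarith [hin.2])
  rw [mul_div_cancel₀ _ hrb.ne'] at h1
  have h2 : ‖x + ξ‖ ≤ √(‖x‖ ^ 2 + 2 * inner ℝ x ξ + b ^ 2) := by
    refine Real.le_sqrt_of_sq_le ?_
    rw [norm_add_sq_real]
    gcongr
  have h3 : Real.cosh ‖x + ξ‖ ≤ Real.cosh √(‖x‖ ^ 2 + 2 * inner ℝ x ξ + b ^ 2) :=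
    Real.cosh_le_cosh.2 (by rwa [abs_norm, abs_of_nonneg (Real.sqrt_nonneg _)])
  have h4 := mul_le_mul_of_nonneg_left hcosh (Real.cosh_pos ‖x‖).le
  calc _ ≤ _ := h3.trans h1
    _ ≤ _ := by
      refine add_le_add h4 (le_of_eq ?_)
      ring

variable [MeasurableSpace E] [BorelSpace E] [SecondCountableTopology E] [CompleteSpace E]

/-- One step of the supermartingale: the linear term has mean zero. The dimension of `E` does not
enter. -/
theorem lintegral_cosh_norm_add_le {Ω : Type*} [MeasurableSpace Ω] (μ : Measure Ω)
    [IsProbabilityMeasure μ] {ξ : Ω → E} (hξ : Measurable ξ) {b : ℝ}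
    (hbound : ∀ ω, ‖ξ ω‖ ≤ b) (hmean : ∫ ω, ξ ω ∂μ = 0) (x : E) :
    ∫⁻ ω, ENNReal.ofReal (Real.cosh ‖x + ξ ω‖) ∂μ ≤
      ENNReal.ofReal (Real.cosh ‖x‖ * Real.exp (b ^ 2 / 2)) := by
  have hb : 0 ≤ b := by
    obtain ⟨ω⟩ := μ.nonempty_of_neZero
    exact (norm_nonneg _).trans (hbound ω)
  obtain ⟨c, hc⟩ := exists_cosh_norm_add_le x hb
  have hint : Integrable ξ μ :=
    .of_bound hξ.aestronglyMeasurable b (.of_forall hbound)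
  have hint2 : Integrable (fun ω => c * inner ℝ x (ξ ω)) μ := (hint.const_inner x).const_mul c
  calc _ ≤ ∫⁻ ω, ENNReal.ofReal (Real.cosh ‖x‖ * Real.exp (b ^ 2 / 2) + c * inner ℝ x (ξ ω)) ∂μ :=
        lintegral_mono fun ω => ENNReal.ofReal_le_ofReal (hc _ (hbound ω))
    _ = ENNReal.ofReal (∫ ω, Real.cosh ‖x‖ * Real.exp (b ^ 2 / 2) + c * inner ℝ x (ξ ω) ∂μ) := by
        refine (ofReal_integral_eq_lintegral_ofReal ((integrable_const _).add hint2)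
          (.of_forall fun ω => ?_)).symm
        exact (Real.cosh_pos _).le.trans (hc _ (hbound ω))
    _ = _ := by
        have h0 : ∫ ω, c * inner ℝ x (ξ ω) ∂μ = 0 := by
          rw [integral_const_mul, integral_inner hint, hmean, inner_zero_right, mul_zero]
        rw [integral_add (integrable_const _) hint2, h0]
        simp

variable {S A Y : Type*} [MeasurableSpace S] [MeasurableSpace A] [MeasurableSpace Y] {H q : ℕ}

/-- The sum, weighted by `⟨θ, ψ⟩`, of the deviations at step `h` of the observed targets from the
linear predictions with coefficients `mu`. -/
def residSum (ψ : S × A → Fin q → ℝ) (h : Fin H) (tgt : Y × S → E) (mu : Fin q → E)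
    (θ : Fin q → ℝ) {k : ℕ} (D : Data S A Y H k) : E :=
  ∑ i, (θ ⬝ᵥ ψ ((D i h).1, (D i h).2.1)) •
    (tgt (D i h).2.2 - ∑ j, ψ ((D i h).1, (D i h).2.1) j • mu j)

/-- The sum of the squares of `⟨θ, ψ⟩` at step `h`. -/
def featSq (ψ : S × A → Fin q → ℝ) (h : Fin H) (θ : Fin q → ℝ) {k : ℕ} (D : Data S A Y H k) : ℝ :=
  ∑ i, (θ ⬝ᵥ ψ ((D i h).1, (D i h).2.1)) ^ 2

variable {ψ : S × A → Fin q → ℝ}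

theorem measurable_dotProduct_feat (hψ : Measurable ψ) (θ : Fin q → ℝ) :
    Measurable fun x => θ ⬝ᵥ ψ x := by
  simp only [dotProduct]
  fun_prop

theorem measurable_residSum (hψ : Measurable ψ) (h : Fin H) {tgt : Y × S → E}
    (ht : Measurable tgt) (mu : Fin q → E) (θ : Fin q → ℝ) (k : ℕ) :
    Measurable (fun D : Data S A Y H k => residSum ψ h tgt mu θ D) := by
  unfold residSum
  refine Finset.measurable_sum _ fun i _ => ?_
  have h1 : Measurable fun D : Data S A Y H k => ((D i h).1, (D i h).2.1) := by fun_prop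
  have h2 : Measurable fun D : Data S A Y H k => (D i h).2.2 := by fun_prop
  refine ((measurable_dotProduct_feat hψ θ).comp h1).smul ((ht.comp h2).sub ?_)
  exact Finset.measurable_sum _ fun j _ => ((measurable_pi_iff.1 hψ j).comp h1).smul_const _

theorem measurable_featSq (hψ : Measurable ψ) (h : Fin H) (θ : Fin q → ℝ) (k : ℕ) :
    Measurable (fun D : Data S A Y H k => featSq ψ h θ D) := by
  unfold featSq
  refine Finset.measurable_sum _ fun i _ => ?_
  have h1 : Measurable fun D : Data S A Y H k => ((D i h).1, (D i h).2.1) := by fun_prop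
  exact ((measurable_dotProduct_feat hψ θ).comp h1).pow_const 2

theorem residSum_snoc (h : Fin H) (tgt : Y × S → E) (mu : Fin q → E) (θ : Fin q → ℝ) {k : ℕ}
    (D : Data S A Y H k) (τ : Episode S A Y H) :
    residSum ψ h tgt mu θ (Fin.snoc D τ : Data S A Y H (k + 1)) = residSum ψ h tgt mu θ D +
      (θ ⬝ᵥ ψ ((τ h).1, (τ h).2.1)) •
        (tgt (τ h).2.2 - ∑ j, ψ ((τ h).1, (τ h).2.1) j • mu j) := by
  simp [residSum, Fin.sum_univ_castSucc]

theorem featSq_snoc (h : Fin H) (θ : Fin q → ℝ) {k : ℕ}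
    (D : Data S A Y H k) (τ : Episode S A Y H) :
    featSq ψ h θ (Fin.snoc D τ : Data S A Y H (k + 1)) = featSq ψ h θ D +
      (θ ⬝ᵥ ψ ((τ h).1, (τ h).2.1)) ^ 2 := by
  simp [featSq, Fin.sum_univ_castSucc]

/-- Self-normalized concentration in one direction `θ`, for targets bounded by `2` whose
conditional means are linear in the features. -/
theorem Learner.law_residSum_le {m : ℕ} (L : Learner S A Y H m) (M : Env S A Y H)
    (hψ : Measurable ψ) (h : Fin H) {tgt : Y × S → E} (ht : Measurable tgt)
    (ht2 : ∀ z, ‖tgt z‖ ≤ 2) (mu : Fin q → E)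
    (hmu : ∀ s a, ∫ z, tgt z ∂(M.step h (s, a)) = ∑ j, ψ (s, a) j • mu j)
    (θ : Fin q → ℝ) (ℓ : ℝ) (k : ℕ) :
    L.law M k {D | ℓ + 8 * featSq ψ h θ D < ‖residSum ψ h tgt mu θ D‖} ≤
      ENNReal.ofReal (2 * Real.exp (-ℓ)) := by
  -- Supermartingale with compensator `8 * featSq`: an increment is `w` times a centred target of
  -- norm at most 4, and `(4|w|)²/2 = 8w²`.
  let G : (k : ℕ) → Data S A Y H k → ENNReal := fun k D =>
    ENNReal.ofReal (Real.cosh ‖residSum ψ h tgt mu θ D‖ * Real.exp (-(8 * featSq ψ h θ D)))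
  have hG : ∀ k, Measurable (G k) := fun k => by
    have := measurable_residSum hψ h ht mu θ k
    have := measurable_featSq (Y := Y) hψ h θ k
    have hc := Real.continuous_cosh.measurable
    dsimp [G]
    fun_prop
  have hstep : ∀ k D, ∫⁻ τ, G (k + 1) (Fin.snoc D τ) ∂(M.episode (L.play k) D) ≤ G k D := by
    intro k D
    simp only [G, residSum_snoc, featSq_snoc]
    set x := residSum ψ h tgt mu θ D
    rw [Env.episode, Kernel.comap_apply]
    have hms : Measurable fun y : S × A × Y × S => ∑ j, ψ (y.1, y.2.1) j • mu j :=
      Finset.measurable_sum _ fun j _ => (((measurable_pi_iff.1 hψ j).comp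
        (by fun_prop : Measurable fun y : S × A × Y × S => (y.1, y.2.1)))).smul_const _
    have hmd : Measurable fun y : S × A × Y × S => θ ⬝ᵥ ψ (y.1, y.2.1) :=
      (measurable_dotProduct_feat hψ θ).comp
        (by fun_prop : Measurable fun y : S × A × Y × S => (y.1, y.2.1))
    refine lintegral_rollout_coord_le H _ _ (L.play k).isMarkov M.isMarkov D M.init h
      (F := fun y => ENNReal.ofReal (Real.cosh ‖x + (θ ⬝ᵥ ψ (y.1, y.2.1)) •
        (tgt y.2.2 - ∑ j, ψ (y.1, y.2.1) j • mu j)‖ * Real.exp (-(8 * (featSq ψ h θ D +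
          (θ ⬝ᵥ ψ (y.1, y.2.1)) ^ 2))))) ?_ ?_
    · have hc := Real.continuous_cosh.measurable
      have hm2 : Measurable fun y : S × A × Y × S => tgt y.2.2 := ht.comp (by fun_prop)
      fun_prop
    intro s a
    have := M.isMarkov h
    set w := θ ⬝ᵥ ψ (s, a)
    simp only [← hmu s a]
    have hI : ‖∫ z, tgt z ∂(M.step h (s, a))‖ ≤ 2 :=
      (norm_integral_le_of_norm_le_const (.of_forall ht2)).trans (by simp)
    have hint : Integrable tgt (M.step h (s, a)) :=
      .of_bound ht.aestronglyMeasurable 2 (.of_forall ht2)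
    have h1 := lintegral_cosh_norm_add_le (M.step h (s, a))
      (ξ := fun z => w • (tgt z - ∫ z, tgt z ∂(M.step h (s, a)))) (by fun_prop) (b := |w| * 4)
      (fun z => by
        rw [norm_smul, Real.norm_eq_abs]
        gcongr
        calc _ ≤ _ := norm_sub_le _ _
          _ ≤ 2 + 2 := add_le_add (ht2 z) hI
          _ = 4 := by norm_num)
      (by rw [integral_smul, integral_sub hint (integrable_const _)]; simp) x
    have h2 : ∀ z, ENNReal.ofReal (Real.cosh ‖x + w • (tgt z - ∫ z, tgt z ∂(M.step h (s, a)))‖ *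
        Real.exp (-(8 * (featSq ψ h θ D + w ^ 2)))) =
        ENNReal.ofReal (Real.cosh ‖x + w • (tgt z - ∫ z, tgt z ∂(M.step h (s, a)))‖) *
        ENNReal.ofReal (Real.exp (-(8 * (featSq ψ h θ D + w ^ 2)))) := fun z =>
      ENNReal.ofReal_mul (Real.cosh_pos _).le
    refine (lintegral_congr h2).trans_le ?_
    rw [lintegral_mul_const' _ _ ENNReal.ofReal_ne_top]
    refine (mul_le_mul_left h1 _).trans (le_of_eq ?_)
    rw [← ENNReal.ofReal_mul (by positivity), mul_assoc, ← Real.exp_add]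
    congr 3
    rw [mul_pow, sq_abs]
    ring
  have hle := L.lintegral_law_le M G hG hstep k
  have h0 : G 0 Fin.elim0 = 1 := by simp [G, residSum, featSq]
  rw [h0] at hle
  have hexp : ENNReal.ofReal (Real.exp ℓ / 2) ≠ 0 := by
    rw [Ne, ENNReal.ofReal_eq_zero, not_le]; positivity
  -- Markov's inequality, using `exp u ≤ 2 cosh u`; this is the source of the factor 2.
  calc _ ≤ L.law M k {D | ENNReal.ofReal (Real.exp ℓ / 2) ≤ G k D} := by
        refine measure_mono fun D hD => ?_
        simp only [Set.mem_ofPred_eq] at hD ⊢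
        refine ENNReal.ofReal_le_ofReal ?_
        rw [Real.exp_neg, ← div_eq_mul_inv, le_div_iff₀ (Real.exp_pos _), div_mul_eq_mul_div,
          ← Real.exp_add, Real.cosh_eq]
        have := Real.exp_le_exp.2 hD.le
        have := Real.exp_pos (-‖residSum ψ h tgt mu θ D‖)
        linarith
    _ ≤ (∫⁻ D, G k D ∂(L.law M k)) / ENNReal.ofReal (Real.exp ℓ / 2) :=
        meas_ge_le_lintegral_div (hG k).aemeasurable hexp ENNReal.ofReal_ne_top
    _ ≤ 1 / ENNReal.ofReal (Real.exp ℓ / 2) := by gcongr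
    _ = _ := by
        rw [one_div, ← ENNReal.ofReal_inv_of_pos (by positivity), Real.exp_neg]
        congr 1
        field_simp

end Concentration

/-! ### Gram matrices, determinants and elliptical norms -/

section Gram

open Matrix

variable {q k : ℕ}

/-- The regularized Gram matrix `I + ∑ xᵢ xᵢᵀ`. -/
def regGram (x : Fin k → Fin q → ℝ) : Matrix (Fin q) (Fin q) ℝ :=
  1 + ∑ i, vecMulVec (x i) (x i)

theorem posDef_regGram (x : Fin k → Fin q → ℝ) : (regGram x).PosDef := by
  refine PosDef.add_posSemidef PosDef.one (posSemidef_sum _ fun i _ => ?_)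
  simpa using posSemidef_vecMulVec_self_star (x i)

theorem regGram_mulVec (x : Fin k → Fin q → ℝ) (v : Fin q → ℝ) :
    regGram x *ᵥ v = v + ∑ i, (v ⬝ᵥ x i) • x i := by
  simp only [regGram, add_mulVec, one_mulVec, sum_mulVec, vecMulVec_mulVec]
  congr 1
  refine Finset.sum_congr rfl fun i _ => ?_
  rw [dotProduct_comm]
  ext j
  simp [mul_comm]

theorem dotProduct_regGram_mulVec (x : Fin k → Fin q → ℝ) (v : Fin q → ℝ) :
    v ⬝ᵥ (regGram x *ᵥ v) = v ⬝ᵥ v + ∑ i, (v ⬝ᵥ x i) ^ 2 := by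
  rw [regGram_mulVec, dotProduct_add, dotProduct_sum]
  simp [sq]

/-- The matrix determinant lemma. It makes the squared elliptical norm of a new feature visible as
growth of the log-determinant. -/
theorem det_regGram_add (x : Fin k → Fin q → ℝ) (y : Fin q → ℝ) :
    (regGram x + vecMulVec y y).det = (regGram x).det * (1 + y ⬝ᵥ ((regGram x)⁻¹ *ᵥ y)) := by
  have hu : IsUnit (regGram x).det := (posDef_regGram x).det_pos.ne'.isUnit
  have h := det_add_replicateCol_mul_replicateRow (ι := Unit) hu y y
  rw [← vecMulVec_eq] at h
  rw [h, dotProduct_mulVec, det_unique (n := Unit)]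
  simp [Matrix.mul_apply, replicateRow, replicateCol, dotProduct, vecMul, Finset.sum_mul, mul_assoc]

theorem dotProduct_inv_regGram_nonneg (x : Fin k → Fin q → ℝ) (y : Fin q → ℝ) :
    0 ≤ y ⬝ᵥ ((regGram x)⁻¹ *ᵥ y) := by
  simpa using (posDef_regGram x).inv.posSemidef.dotProduct_mulVec_nonneg y

/-- Every eigenvalue is at most the trace; the resulting bound on the log-determinant is all that is
needed. -/
theorem det_regGram_le (x : Fin k → Fin q → ℝ) {b : ℝ} (hb : ∀ i j, |x i j| ≤ b) :
    (regGram x).det ≤ (q + q * k * b ^ 2) ^ q := by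
  have hp := posDef_regGram x
  have htr : (regGram x).trace ≤ q + q * k * b ^ 2 := by
    rw [regGram, trace_add, trace_one, trace_sum]
    simp only [Fintype.card_fin, trace_vecMulVec]
    gcongr
    calc _ ≤ ∑ _i : Fin k, ∑ _j : Fin q, b ^ 2 := by
          refine Finset.sum_le_sum fun i _ => Finset.sum_le_sum fun j _ => ?_
          rw [← sq]
          exact sq_le_sq' (abs_le.1 (hb i j)).1 (abs_le.1 (hb i j)).2
      _ = _ := by simp; ring
  rw [hp.isHermitian.det_eq_prod_eigenvalues]
  have hnn : ∀ i, 0 ≤ hp.isHermitian.eigenvalues i := fun i => (hp.eigenvalues_pos i).le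
  have hts := hp.isHermitian.trace_eq_sum_eigenvalues
  simp only [RCLike.ofReal_real_eq_id, id] at hts ⊢
  calc ∏ i, hp.isHermitian.eigenvalues i ≤ ∏ _i : Fin q, ((q : ℝ) + q * k * b ^ 2) := by
        refine Finset.prod_le_prod (fun i _ => hnn i) fun i _ => le_trans ?_ htr
        rw [hts]
        exact Finset.single_le_sum (f := hp.isHermitian.eigenvalues) (fun i _ => hnn i)
          (Finset.mem_univ i)
    _ = _ := by simp

theorem one_le_det_regGram (x : Fin k → Fin q → ℝ) : 1 ≤ (regGram x).det := by
  induction k with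
  | zero => simp [regGram]
  | succ k ih =>
    have h : regGram x = regGram (Fin.init x) + vecMulVec (x (Fin.last k)) (x (Fin.last k)) := by
      simp [regGram, Fin.sum_univ_castSucc, Fin.init, add_assoc]
    rw [h, det_regGram_add]
    have := ih (Fin.init x)
    have := dotProduct_inv_regGram_nonneg (Fin.init x) (x (Fin.last k))
    nlinarith

/-- Truncation at 1 is what allows a logarithm to dominate a linear function: compare slopes for `ν
≤ 1`, and use `log 2 ≥ 1/2` beyond. -/
theorem min_one_le_log {B ν : ℝ} (hB : 1 ≤ B) (hν : 0 ≤ ν) :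
    min 1 (B * ν) ≤ 2 * B * Real.log (1 + ν) := by
  rcases le_total ν 1 with h | h
  · refine (min_le_right _ _).trans ?_
    have := Real.le_log_one_add_of_nonneg hν
    have h2 : ν / 2 ≤ 2 * ν / (ν + 2) := by
      rw [div_le_div_iff₀ (by norm_num) (by linarith)]
      nlinarith
    nlinarith
  · refine (min_le_left _ _).trans ?_
    have h2 : Real.log 2 ≤ Real.log (1 + ν) := Real.log_le_log (by norm_num) (by linarith)
    have := Real.log_two_gt_d9
    nlinarith

variable {E : Type*} [NormedAddCommGroup E] [InnerProductSpace ℝ E]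

theorem norm_sum_smul_le {v : Fin q → ℝ} {e : Fin q → E} {a b : ℝ} (ha : 0 ≤ a)
    (hv : ∀ j, |v j| ≤ a) (he : ∀ j, ‖e j‖ ≤ b) : ‖∑ j, v j • e j‖ ≤ q * (a * b) := by
  calc _ ≤ ∑ j, ‖v j • e j‖ := norm_sum_le _ _
    _ ≤ ∑ _j : Fin q, a * b := Finset.sum_le_sum fun j _ => by
        rw [norm_smul, Real.norm_eq_abs]
        exact mul_le_mul (hv j) (he j) (norm_nonneg _) ha
    _ = _ := by simp

theorem abs_dotProduct_le {v w : Fin q → ℝ} {a b : ℝ} (ha : 0 ≤ a)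
    (hv : ∀ j, |v j| ≤ a) (hw : ∀ j, |w j| ≤ b) : |v ⬝ᵥ w| ≤ q * (a * b) := by
  simpa [dotProduct] using norm_sum_smul_le (E := ℝ) ha hv hw

/-- From bounds in finitely many directions `θ` to a bound in the norm of the inverse Gram
matrix. -/
theorem norm_sum_smul_sq_le {x : Fin k → Fin q → ℝ} (hx : ∀ i j, |x i j| ≤ 2) {e : Fin q → E}
    (he : ∀ j, ‖e j‖ ≤ 4) {Θ : Set (Fin q → ℝ)} {L γ : ℝ} (hL1 : 1 ≤ L) (hLq : (q : ℝ) ≤ L)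
    (hγ0 : 0 ≤ γ) (hγ1 : γ ≤ 1) (hγ : 16 * k * q ^ 2 * γ ≤ 1)
    (hΘ : ∀ θ : Fin q → ℝ, (∀ j, |θ j| ≤ √L) → ∃ θ' ∈ Θ, ∀ j, |θ j - θ' j| ≤ γ)
    (hbd : ∀ θ ∈ Θ, ‖∑ i, (θ ⬝ᵥ x i) • ∑ j, x i j • e j‖ ≤
      2 * L + 1 + 16 * ∑ i, (θ ⬝ᵥ x i) ^ 2) (y : Fin q → ℝ) :
    ‖∑ j, y j • e j‖ ^ 2 ≤ 56 ^ 2 * L * (y ⬝ᵥ ((regGram x)⁻¹ *ᵥ y)) := by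
  set ν := y ⬝ᵥ ((regGram x)⁻¹ *ᵥ y) with hν
  have hν0 : 0 ≤ ν := dotProduct_inv_regGram_nonneg x y
  have hu : IsUnit (regGram x).det := (posDef_regGram x).det_pos.ne'.isUnit
  set θ₀ := (regGram x)⁻¹ *ᵥ y with hθ₀
  have hΛ : regGram x *ᵥ θ₀ = y := by rw [hθ₀, mulVec_mulVec, mul_nonsing_inv _ hu, one_mulVec]
  have hνθ : θ₀ ⬝ᵥ θ₀ + ∑ i, (θ₀ ⬝ᵥ x i) ^ 2 = ν := by
    rw [← dotProduct_regGram_mulVec, hΛ, dotProduct_comm]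
  rcases hν0.eq_or_lt with h0 | hpos
  · have h1 : θ₀ ⬝ᵥ θ₀ = 0 := by
      have : 0 ≤ θ₀ ⬝ᵥ θ₀ := by simpa using dotProduct_star_self_nonneg θ₀
      have : 0 ≤ ∑ i, (θ₀ ⬝ᵥ x i) ^ 2 := by positivity
      linarith
    have h2 : y = 0 := by rw [← hΛ, dotProduct_self_eq_zero.1 h1, mulVec_zero]
    simp [h2, ← h0]
  -- The direction `θ = s Λ⁻¹ y` is scaled so that `θᵀ Λ θ = L`. The linear and the quadratic part
  -- of the bound in direction θ are then both of order `L`, and `s y = Λ θ` recovers `y`.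
  set s := √L / √ν
  have hsν : 0 < √ν := Real.sqrt_pos.2 hpos
  have hLpos : 0 < L := by linarith
  have hs : 0 < s := div_pos (Real.sqrt_pos.2 hLpos) hsν
  have hs2 : s ^ 2 * ν = L := by
    simp only [s]
    rw [div_pow, Real.sq_sqrt hLpos.le, Real.sq_sqrt hν0]
    field_simp
  set θ := s • θ₀ with hθ
  have hθν : θ ⬝ᵥ θ + ∑ i, (θ ⬝ᵥ x i) ^ 2 = L := by
    rw [← hs2, ← hνθ, mul_add, Finset.mul_sum]
    simp only [hθ, smul_dotProduct, dotProduct_smul, smul_eq_mul, mul_pow]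
    ring
  have hQ0 : 0 ≤ ∑ i, (θ ⬝ᵥ x i) ^ 2 := by positivity
  have hθθ0 : 0 ≤ θ ⬝ᵥ θ := by simpa using dotProduct_star_self_nonneg θ
  have hθj : ∀ j, |θ j| ≤ √L := fun j => by
    refine Real.abs_le_sqrt ?_
    have : θ j * θ j ≤ θ ⬝ᵥ θ := Finset.single_le_sum (f := fun j => θ j * θ j)
      (fun j _ => mul_self_nonneg _) (Finset.mem_univ j)
    nlinarith
  obtain ⟨θ', hθ', hclose⟩ := hΘ θ hθj
  have hdot : ∀ i, |(θ - θ') ⬝ᵥ x i| ≤ q * (γ * 2) := fun i =>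
    abs_dotProduct_le hγ0 (fun j => hclose j) (hx i)
  have hQ : ∑ i, (θ' ⬝ᵥ x i) ^ 2 ≤ 2 * ∑ i, (θ ⬝ᵥ x i) ^ 2 + 1 := by
    have h1 : ∀ i, (θ' ⬝ᵥ x i) ^ 2 ≤ 2 * (θ ⬝ᵥ x i) ^ 2 + 8 * q ^ 2 * γ := fun i => by
      have h2 : ((θ - θ') ⬝ᵥ x i) ^ 2 ≤ (q * (γ * 2)) ^ 2 :=
        sq_le_sq' (abs_le.1 (hdot i)).1 (abs_le.1 (hdot i)).2
      have h3 : θ' ⬝ᵥ x i = θ ⬝ᵥ x i - (θ - θ') ⬝ᵥ x i := by rw [sub_dotProduct]; ring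
      have h4 : (q : ℝ) ^ 2 * γ ^ 2 ≤ q ^ 2 * γ := by
        gcongr
        nlinarith
      rw [h3]
      nlinarith [sq_nonneg (θ ⬝ᵥ x i + (θ - θ') ⬝ᵥ x i)]
    calc _ ≤ ∑ i, (2 * (θ ⬝ᵥ x i) ^ 2 + 8 * q ^ 2 * γ) := Finset.sum_le_sum fun i _ => h1 i
      _ = 2 * ∑ i, (θ ⬝ᵥ x i) ^ 2 + k * (8 * q ^ 2 * γ) := by
          rw [Finset.sum_add_distrib, Finset.mul_sum]
          simp
      _ ≤ _ := by
        have : 0 ≤ k * (8 * q ^ 2 * γ) := by positivity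
        linarith
  have hround : ‖∑ i, ((θ - θ') ⬝ᵥ x i) • ∑ j, x i j • e j‖ ≤ 1 := by
    refine (norm_sum_smul_le (by positivity) hdot fun i =>
      norm_sum_smul_le zero_le_two (hx i) he).trans ?_
    calc _ = 16 * k * q ^ 2 * γ := by ring
      _ ≤ 1 := hγ
  -- At the rounded direction the bound is at most `2L + 1 + 16(2L + 1) ≤ 51L`; rounding adds 1. The
  -- regularizer below adds `4L`, for a total of `56L`.
  have hmain : ‖∑ i, (θ ⬝ᵥ x i) • ∑ j, x i j • e j‖ ≤ 52 * L := by
    have h1 : ∑ i, (θ ⬝ᵥ x i) • ∑ j, x i j • e j = ∑ i, (θ' ⬝ᵥ x i) • ∑ j, x i j • e j +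
        ∑ i, ((θ - θ') ⬝ᵥ x i) • ∑ j, x i j • e j := by
      rw [← Finset.sum_add_distrib]
      refine Finset.sum_congr rfl fun i _ => ?_
      rw [← add_smul, ← add_dotProduct]
      congr 2
      abel
    rw [h1]
    refine (norm_add_le _ _).trans ?_
    have := hbd θ' hθ'
    linarith
  have hreg : ‖∑ j, θ j • e j‖ ≤ 4 * L := by
    calc _ ≤ ∑ j, ‖θ j • e j‖ := norm_sum_le _ _
      _ ≤ ∑ j, |θ j| * 4 := Finset.sum_le_sum fun j _ => by
          rw [norm_smul, Real.norm_eq_abs]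
          exact mul_le_mul_of_nonneg_left (he j) (abs_nonneg _)
      _ = 4 * ∑ j, |θ j| := by rw [← Finset.sum_mul, mul_comm]
      _ ≤ 4 * L := by
        gcongr
        refine abs_le_of_sq_le_sq' ?_ hLpos.le |>.2
        have h1 := sq_sum_le_card_mul_sum_sq (s := Finset.univ) (f := fun j => |θ j|)
        have h2 : ∑ j, |θ j| ^ 2 = θ ⬝ᵥ θ := by simp [dotProduct, sq]
        rw [h2] at h1
        simp only [Finset.card_univ, Fintype.card_fin] at h1
        calc _ ≤ _ := h1
          _ ≤ L * L := mul_le_mul hLq (by linarith) hθθ0 hLpos.le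
          _ = L ^ 2 := by ring
  have hsy : s • ∑ j, y j • e j = ∑ j, θ j • e j + ∑ i, (θ ⬝ᵥ x i) • ∑ j, x i j • e j := by
    have h1 : s • y = θ + ∑ i, (θ ⬝ᵥ x i) • x i := by
      rw [← regGram_mulVec, hθ, mulVec_smul, hΛ]
    have h2 : ∀ j, s * y j = θ j + ∑ i, (θ ⬝ᵥ x i) * x i j := fun j => by
      simpa using congrFun h1 j
    simp only [Finset.smul_sum, smul_smul, h2, add_smul, Finset.sum_add_distrib, Finset.sum_smul]
    rw [Finset.sum_comm]
  have hfin : s * ‖∑ j, y j • e j‖ ≤ 56 * L := by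
    calc _ = ‖s • ∑ j, y j • e j‖ := by rw [norm_smul, Real.norm_of_nonneg hs.le]
      _ ≤ _ := by
        rw [hsy]
        refine (norm_add_le _ _).trans ?_
        linarith
  have h5 : (s * ‖∑ j, y j • e j‖) ^ 2 ≤ (56 * L) ^ 2 := by gcongr
  rw [mul_pow] at h5
  have h6 : L * ‖∑ j, y j • e j‖ ^ 2 ≤ L * (56 ^ 2 * L * ν) := by
    calc _ = ν * (s ^ 2 * ‖∑ j, y j • e j‖ ^ 2) := by rw [← hs2]; ring
      _ ≤ ν * (56 * L) ^ 2 := by gcongr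
      _ = _ := by ring
  exact le_of_mul_le_mul_left h6 hLpos

end Gram

/-! ### Spanners and measurable greedy rules -/

section Anchors

open Module

/-- Approximate barycentric spanners: finitely many feature vectors such that every feature vector
is a combination of them with coefficients in `[-2, 2]`, depending linearly on the vector. -/
theorem exists_anchors {X : Type*} {p : ℕ} (φ : X → Vec p) (hφ : ∀ z, ‖φ z‖ ≤ 1) :
    ∃ q ≤ p, ∃ (x : Fin q → X) (T : Vec p →L[ℝ] (Fin q → ℝ)), ∀ z,
      (∀ i, |T (φ z) i| ≤ 2) ∧ φ z = ∑ i, T (φ z) i • φ (x i) := by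
  set V := Submodule.span ℝ (Set.range φ) with hV
  obtain ⟨f, hf, hspan, hli⟩ := Submodule.exists_fun_fin_finrank_span_eq ℝ (Set.range φ)
  choose x₀ hx₀ using hf
  let φ' : X → V := fun z => ⟨φ z, Submodule.subset_span ⟨z, rfl⟩⟩
  let e : Basis (Fin (finrank ℝ V)) ℝ V := (Basis.span hli).map (LinearEquiv.ofEq _ _ hspan)
  have he : ∀ i, e i = φ' (x₀ i) := fun i => by
    ext1
    simp [e, φ', hx₀, Basis.span_apply]
  let D : (Fin (finrank ℝ V) → X) → ℝ := fun x => |e.det (φ' ∘ x)|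
  have hbdd : BddAbove (Set.range D) := by
    suffices h : ∃ C, ∀ x, D x ≤ C from h.imp fun C hC => Set.forall_mem_range.2 hC
    have h1 : ∀ (x : Fin (finrank ℝ V) → X) i j, |e.toMatrix (φ' ∘ x) i j| ≤ ‖(e.equivFunL : V →L[ℝ] (Fin (finrank ℝ V) → ℝ))‖ := fun x i j => by
      have h2 := (e.equivFunL : V →L[ℝ] (Fin (finrank ℝ V) → ℝ)).le_opNorm (φ' (x j))
      have h3 : ‖φ' (x j)‖ ≤ 1 := hφ _
      have h4 := norm_le_pi_norm ((e.equivFunL : V →L[ℝ] (Fin (finrank ℝ V) → ℝ)) (φ' (x j))) i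
      calc _ ≤ _ := h4
        _ ≤ _ := h2
        _ ≤ _ := mul_le_of_le_one_right (ContinuousLinearMap.opNorm_nonneg _) h3
    exact ⟨_, fun x => Matrix.det_le (abv := AbsoluteValue.abs) (h1 x)⟩
  have hD0 : D x₀ = 1 := by
    have : φ' ∘ x₀ = e := funext fun i => (he i).symm
    simp only [D, this, e.det_self, abs_one]
  set s := sSup (Set.range D)
  have hs : 1 ≤ s := hD0 ▸ le_csSup hbdd ⟨x₀, rfl⟩
  -- The maximal determinant need not be attained, so half of the supremum is used. By Cramer's rule
  -- a coordinate is a ratio of two determinants, hence at most 2.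
  obtain ⟨_, ⟨x, rfl⟩, hx⟩ := exists_lt_of_lt_csSup (Set.range_nonempty_iff_nonempty.2 ⟨x₀⟩)
    (by linarith : s / 2 < sSup (Set.range D))
  have hDx : 0 < D x := by linarith
  have hu : IsUnit (e.det (φ' ∘ x)) := (abs_pos.1 hDx).isUnit
  obtain ⟨hli', hsp'⟩ := e.is_basis_iff_det.2 hu
  let b := Basis.mk hli' hsp'.ge
  obtain ⟨T, hT⟩ := LinearMap.exists_extend (b.equivFun : V →ₗ[ℝ] Fin (finrank ℝ V) → ℝ)
  have hTφ : ∀ z, T (φ z) = b.equivFun (φ' z) := fun z => LinearMap.congr_fun hT (φ' z)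
  refine ⟨finrank ℝ V, (Submodule.finrank_le V).trans (by simp), x,
    LinearMap.toContinuousLinearMap T, fun z => ⟨fun i => ?_, ?_⟩⟩
  · rw [LinearMap.coe_toContinuousLinearMap', hTφ]
    have h1 := LinearMap.congr_fun (e.det_smul_mk_coord_eq_det_update hli' hsp'.ge i) (φ' z)
    have h2 : e.det (φ' ∘ x) * b.equivFun (φ' z) i = e.det (φ' ∘ Function.update x i z) := by
      rw [Function.comp_update]
      exact h1
    have h3 : D (Function.update x i z) ≤ s := le_csSup hbdd ⟨_, rfl⟩
    have h4 : D x * |b.equivFun (φ' z) i| = D (Function.update x i z) := by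
      simp only [D, ← h2, abs_mul]
    have h5 : 0 ≤ |b.equivFun (φ' z) i| := abs_nonneg _
    by_contra! h6
    nlinarith
  · rw [LinearMap.coe_toContinuousLinearMap', hTφ]
    have h1 := congrArg (Subtype.val) (b.sum_equivFun (φ' z))
    have h2 : ∀ i, b i = φ' (x i) := fun i => by simp [b]
    simp only [h2] at h1
    rw [AddSubmonoidClass.coe_finsetSum] at h1
    exact h1.symm

/-- Nearly greedy measurable action rules for a linear functional of the features. -/
theorem IsFeatureMap.exists_greedy {S A : Type*} [MeasurableSpace S] [MeasurableSpace A] {p : ℕ}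
    {φ : S × A → Vec p} (hφ : IsFeatureMap φ) (u : Vec p →L[ℝ] ℝ) {ρ : ℝ} (hρ : 0 < ρ) :
    ∃ g : S → A, Measurable g ∧ ∀ s a, u (φ (s, a)) ≤ u (φ (s, g s)) + ρ := by
  classical
  obtain ⟨g, hg, hdense⟩ := hφ.selectors
  have hmeas : ∀ n, Measurable fun s => u (φ (s, g n s)) := fun n =>
    u.continuous.measurable.comp (hφ.measurable.comp (measurable_id.prodMk (hg n)))
  have hbd : ∀ s, BddAbove (Set.range fun n => u (φ (s, g n s))) := fun s =>
    ⟨‖u‖, Set.forall_mem_range.2 fun n => (le_abs_self _).trans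
      ((u.le_opNorm _).trans (mul_le_of_le_one_right (norm_nonneg _) (hφ.norm_le _)))⟩
  let v : S → ℝ := fun s => ⨆ n, u (φ (s, g n s))
  have hv : Measurable v := Measurable.iSup hmeas
  have hex : ∀ s, ∃ n, v s - ρ < u (φ (s, g n s)) := fun s =>
    exists_lt_of_lt_ciSup (by simp [v, hρ])
  -- Taking the first index within ρ of the supremum keeps the selection measurable.
  refine ⟨fun s => g (Nat.find (hex s)) s, ?_, fun s a => ?_⟩
  · exact Measurable.find hg (fun n => measurableSet_lt (hv.sub_const ρ) (hmeas n)) hex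
  · have h1 : u (φ (s, a)) ≤ v s := by
      refine closure_minimal (t := {w | u w ≤ v s}) ?_ (isClosed_le u.continuous continuous_const)
        (hdense s a)
      rintro _ ⟨n, rfl⟩
      exact le_ciSup (hbd s) n
    have h2 := Nat.find_spec (hex s)
    linarith

end Anchors

/-! ### Finite families of rules, and the simulation lemma -/

section Planning

/-- The point with index `c` of the grid with mesh `1/N` in the cube `[-1, 1]^q`. -/
def gridPt {q : ℕ} (N : ℕ) (c : Fin q → Fin (2 * N + 1)) (j : Fin q) : ℝ := (c j : ℝ) / N - 1

theorem exists_gridPt_close {q N : ℕ} (hN : 0 < N) {u : Fin q → ℝ} (hu : ∀ j, |u j| ≤ 1) :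
    ∃ c, ∀ j, |u j - gridPt N c j| ≤ 1 / N := by
  have hN' : (0 : ℝ) < N := by exact_mod_cast hN
  have h0 : ∀ j, 0 ≤ (u j + 1) * N := fun j =>
    mul_nonneg (by linarith [(abs_le.1 (hu j)).1]) hN'.le
  refine ⟨fun j => ⟨⌊(u j + 1) * N⌋₊, ?_⟩, fun j => ?_⟩
  · rw [Nat.lt_succ_iff]
    refine Nat.floor_le_of_le ?_
    push_cast
    gcongr
    linarith [(abs_le.1 (hu j)).2]
  · have h1 := Nat.floor_le (h0 j)
    have h2 := Nat.lt_floor_add_one ((u j + 1) * N)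
    simp only [gridPt]
    rw [show u j - ((⌊(u j + 1) * N⌋₊ : ℝ) / N - 1) = ((u j + 1) * N - ⌊(u j + 1) * N⌋₊) / N by
      field_simp; ring, abs_div, abs_of_pos hN']
    gcongr
    rw [abs_le]
    constructor <;> linarith

/-- Features that are bounded by `2`, with anchor points, and nearly greedy action rules for the
directions of a grid. -/
structure FeatureModel (S A : Type*) [MeasurableSpace S] [MeasurableSpace A] (q N : ℕ) where
  feat : S × A → Fin q → ℝ
  measurable_feat : Measurable feat
  abs_feat_le : ∀ z j, |feat z j| ≤ 2
  anchor : Fin q → S × A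
  rule : (Fin q → Fin (2 * N + 1)) → S → A
  measurable_rule : ∀ c, Measurable (rule c)
  greedy : ∀ c s a, gridPt N c ⬝ᵥ feat (s, a) ≤ gridPt N c ⬝ᵥ feat (s, rule c s) + 1 / N
  pos : 0 < N

namespace FeatureModel

variable {S A Y : Type*} [MeasurableSpace S] [MeasurableSpace A] [MeasurableSpace Y] {q N : ℕ}
  (F : FeatureModel S A q N)

/-- The deterministic action kernels of a sequence of rules. -/
def det {n : ℕ} (g : Fin n → Fin q → Fin (2 * N + 1)) (i : Fin n) : Kernel S A :=
  Kernel.deterministic (F.rule (g i)) (F.measurable_rule _)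

/-- The policy of a sequence of rules. -/
def pol {H : ℕ} (g : Fin H → Fin q → Fin (2 * N + 1)) : Policy S A H where
  act := F.det g
  isMarkov _ := by unfold det; infer_instance

/-- Expectations of functions of the next state are linear in the features, with the expectations
at the anchors as coefficients. -/
def LinTrans (P : Kernel (S × A) (Y × S)) : Prop :=
  ∀ s a (v : S → ℝ), Measurable v → (∃ C, ∀ s, |v s| ≤ C) →
    ∫ z, v z.2 ∂(P (s, a)) = F.feat (s, a) ⬝ᵥ fun j => ∫ z, v z.2 ∂(P (F.anchor j))

/-- A function of state and action is the combination of its values at the anchors. -/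
def LinFun (r : S → A → ℝ) : Prop :=
  ∀ s a, r s a = F.feat (s, a) ⬝ᵥ fun j => r (F.anchor j).1 (F.anchor j).2

theorem abs_dotProduct_feat_le {v : Fin q → ℝ} {a : ℝ} (ha : 0 ≤ a) (hv : ∀ j, |v j| ≤ a)
    (z : S × A) : |v ⬝ᵥ F.feat z| ≤ 2 * q * a :=
  (abs_dotProduct_le ha hv (F.abs_feat_le z)).trans (by linarith)

theorem exists_grid_close {w : Fin q → ℝ} {R : ℝ} (hR : 0 < R) (hw : ∀ j, |w j| ≤ R) :
    ∃ c, ∀ z, |w ⬝ᵥ F.feat z - R * (gridPt N c ⬝ᵥ F.feat z)| ≤ R * (2 * q / N) := by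
  obtain ⟨c, hc⟩ := exists_gridPt_close F.pos (u := fun j => w j / R) (fun j => by
    rw [abs_div, abs_of_pos hR]; exact div_le_one_of_le₀ (hw j) hR.le)
  refine ⟨c, fun z => ?_⟩
  have h1 := F.abs_dotProduct_feat_le (v := fun j => w j / R - gridPt N c j) (by positivity) hc z
  have h2 : w ⬝ᵥ F.feat z - R * (gridPt N c ⬝ᵥ F.feat z) =
      R * ((fun j => w j / R - gridPt N c j) ⬝ᵥ F.feat z) := by
    simp only [dotProduct, Finset.mul_sum, ← Finset.sum_sub_distrib]
    refine Finset.sum_congr rfl fun j _ => ?_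
    field_simp
  rw [h2, abs_mul, abs_of_pos hR]
  gcongr
  exact h1.trans (le_of_eq (by ring))

/-- Scale `w` into the cube and round it to the grid. The rounding error is paid twice, for the
action compared and for the action chosen, and the greedy slack once. -/
theorem exists_rule_ge {w : Fin q → ℝ} {R : ℝ} (hR : 0 < R) (hw : ∀ j, |w j| ≤ R) :
    ∃ c, ∀ s a, w ⬝ᵥ F.feat (s, a) ≤ w ⬝ᵥ F.feat (s, F.rule c s) + R * (1 + 4 * q) / N := by
  obtain ⟨c, hc⟩ := F.exists_grid_close hR hw
  refine ⟨c, fun s a => ?_⟩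
  have h1 := (abs_le.1 (hc (s, a))).2
  have h2 := (abs_le.1 (hc (s, F.rule c s))).1
  have h3 := mul_le_mul_of_nonneg_left (F.greedy c s a) hR.le
  have h4 : R * (1 + 4 * q) / N = R * (1 / N) + 2 * (R * (2 * q / N)) := by ring
  linarith

theorem measurable_dotProduct_rule (w : Fin q → ℝ) (c : Fin q → Fin (2 * N + 1)) :
    Measurable fun s => w ⬝ᵥ F.feat (s, F.rule c s) :=
  (measurable_dotProduct_feat F.measurable_feat w).comp
    (measurable_id.prodMk (F.measurable_rule c))

section Val

variable {n : ℕ} {P : Fin n → Kernel (S × A) (Y × S)} {r : Fin n → S → A → ℝ}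

theorem isMarkov_det (g : Fin n → Fin q → Fin (2 * N + 1)) (i : Fin n) :
    IsMarkovKernel (F.det g i) := by unfold det; infer_instance

theorem measurable_val_det (g : Fin n → Fin q → Fin (2 * N + 1)) (hP : ∀ i, IsMarkovKernel (P i))
    (hr : ∀ h, Measurable (Function.uncurry (r h))) {C : ℝ} (hC : ∀ h s a, ‖r h s a‖ ≤ C) :
    Measurable (val n (fun i s => F.det g i s) P r) :=
  (stronglyMeasurable_val n (F.det g) P (F.isMarkov_det g) hP hr hC).measurable

theorem abs_val_det_le (g : Fin n → Fin q → Fin (2 * N + 1)) (hP : ∀ i, IsMarkovKernel (P i))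
    (hr : ∀ h, Measurable (Function.uncurry (r h))) {C : ℝ} (hC : ∀ h s a, ‖r h s a‖ ≤ C) (s : S) :
    |val n (fun i s => F.det g i s) P r s| ≤ n * C :=
  norm_val_le n (F.det g) P (F.isMarkov_det g) hP hr hC s

theorem measurable_qfun {r₀ : S → A → ℝ} (hr₀ : Measurable (Function.uncurry r₀))
    {P₀ : Kernel (S × A) (Y × S)} [IsMarkovKernel P₀] {v : S → ℝ} (hv : Measurable v) (s : S) :
    Measurable fun a => r₀ s a + ∫ z, v z.2 ∂(P₀ (s, a)) := by
  have h1 : Measurable fun a => ∫ z, v z.2 ∂(P₀ (s, a)) :=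
    ((StronglyMeasurable.integral_kernel (κ := P₀) (f := fun z : Y × S => v z.2)
      (hv.comp measurable_snd).stronglyMeasurable).comp_measurable
      measurable_prodMk_left).measurable
  exact (hr₀.comp measurable_prodMk_left).add h1

theorem val_det_succ {P : Fin (n + 1) → Kernel (S × A) (Y × S)} {r : Fin (n + 1) → S → A → ℝ}
    (g : Fin (n + 1) → Fin q → Fin (2 * N + 1)) (hP : ∀ i, IsMarkovKernel (P i))
    (hr : ∀ h, Measurable (Function.uncurry (r h))) {C : ℝ} (hC : ∀ h s a, ‖r h s a‖ ≤ C) (s : S) :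
    val (n + 1) (fun i s => F.det g i s) P r s = r 0 s (F.rule (g 0) s) +
      ∫ z, val n (fun i s => F.det (fun j => g j.succ) i s) (fun i => P i.succ)
        (fun i => r i.succ) z.2 ∂(P 0 (s, F.rule (g 0) s)) := by
  have := hP 0
  have hm := F.measurable_val_det (fun j => g j.succ) (fun i => hP i.succ) (fun h => hr h.succ)
    (fun h => hC h.succ)
  have h1 := measurable_qfun (hr 0) (P₀ := P 0) hm s
  rw [val]
  conv_lhs => rw [det, Kernel.deterministic_apply]
  exact integral_dirac' _ _ h1.stronglyMeasurable

/-- The coefficients of the action value function of the first step. -/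
def qcoef {P : Fin (n + 1) → Kernel (S × A) (Y × S)} {r : Fin (n + 1) → S → A → ℝ} (v : S → ℝ)
    (j : Fin q) : ℝ :=
  r 0 (F.anchor j).1 (F.anchor j).2 + ∫ z, v z.2 ∂(P 0 (F.anchor j))

theorem qfun_eq {P : Fin (n + 1) → Kernel (S × A) (Y × S)} {r : Fin (n + 1) → S → A → ℝ}
    (hlin : F.LinTrans (P 0)) (hrlin : F.LinFun (r 0)) {v : S → ℝ} (hv : Measurable v)
    {C : ℝ} (hC : ∀ s, |v s| ≤ C) (s : S) (a : A) :
    r 0 s a + ∫ z, v z.2 ∂(P 0 (s, a)) = F.qcoef (P := P) (r := r) v ⬝ᵥ F.feat (s, a) := by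
  rw [hlin s a v hv ⟨C, hC⟩, hrlin s a, ← dotProduct_add, dotProduct_comm]
  rfl

theorem abs_qcoef_le {P : Fin (n + 1) → Kernel (S × A) (Y × S)} {r : Fin (n + 1) → S → A → ℝ}
    (hP : ∀ i, IsMarkovKernel (P i)) {C C' : ℝ} (hr : ∀ h s a, ‖r h s a‖ ≤ C') {v : S → ℝ}
    (hC : ∀ s, |v s| ≤ C) (j : Fin q) : |F.qcoef (P := P) (r := r) v j| ≤ C' + C := by
  have := hP 0
  refine (abs_add_le _ _).trans (add_le_add (hr _ _ _) ?_)
  have h : ∀ z : Y × S, ‖v z.2‖ ≤ C := fun z => hC z.2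
  exact (norm_integral_le_of_norm_le_const (.of_forall h)).trans (by simp)

/-- Only the first rule and a bounded coefficient vector are visible in a value function, because
the future enters through its means at the anchors. This is why finitely many regression targets
suffice for all sequences of rules and all models. -/
theorem exists_val_det_eq (g : Fin n → Fin q → Fin (2 * N + 1)) (hP : ∀ i, IsMarkovKernel (P i))
    (hlin : ∀ i, F.LinTrans (P i)) (hr : ∀ h, Measurable (Function.uncurry (r h)))
    (hrlin : ∀ i, F.LinFun (r i)) (hr2 : ∀ h s a, ‖r h s a‖ ≤ 2) :
    ∃ (c : Fin q → Fin (2 * N + 1)) (w : Fin q → ℝ), (∀ j, |w j| ≤ n * 2) ∧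
      ∀ s, val n (fun i s => F.det g i s) P r s = w ⬝ᵥ F.feat (s, F.rule c s) := by
  cases n with
  | zero => exact ⟨0, 0, fun j => by simp, fun s => by simp [val]⟩
  | succ n =>
    have hub := F.abs_val_det_le (fun i => g i.succ) (fun i => hP i.succ)
      (fun i => hr i.succ) (fun i => hr2 i.succ)
    refine ⟨g 0, F.qcoef (P := P) (r := r) (val n (fun i s => F.det (fun j => g j.succ) i s)
      (fun i => P i.succ) (fun i => r i.succ)), fun j => ?_, fun s => ?_⟩
    · refine (F.abs_qcoef_le hP hr2 hub j).trans ?_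
      push_cast
      linarith
    · rw [F.val_det_succ g hP hr hr2]
      exact F.qfun_eq (hlin _) (hrlin _) (F.measurable_val_det _
        (fun i => hP i.succ) (fun i => hr i.succ) (fun i => hr2 i.succ)) hub s _

end Val

/-- The sequences of rules contain nearly optimal policies. -/
theorem exists_rules_val_ge {H : ℕ} (hH : 1 ≤ H) : ∀ (n : ℕ) (_ : n ≤ H)
    (P : Fin n → Kernel (S × A) (Y × S)) (r : Fin n → S → A → ℝ), (∀ i, IsMarkovKernel (P i)) →
    (∀ i, F.LinTrans (P i)) → (∀ i, Measurable (Function.uncurry (r i))) →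
    (∀ i, F.LinFun (r i)) → (∀ i s a, ‖r i s a‖ ≤ 2) →
    ∃ g : Fin n → Fin q → Fin (2 * N + 1), ∀ κ : Fin n → Kernel S A, (∀ i, IsMarkovKernel (κ i)) →
      ∀ s, val n (fun i s => κ i s) P r s ≤ val n (fun i s => F.det g i s) P r s +
        n * (2 * H * (1 + 4 * q) / N)
  | 0, _, _, _, _, _, _, _, _ => ⟨Fin.elim0, fun _ _ _ => by simp [val]⟩
  | n + 1, hn, P, r, hP, hlin, hr, hrlin, hr2 => by
      obtain ⟨g', hg'⟩ := exists_rules_val_ge hH n (by omega) (fun i => P i.succ)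
        (fun i => r i.succ) (fun i => hP i.succ) (fun i => hlin i.succ) (fun i => hr i.succ)
        (fun i => hrlin i.succ) (fun i => hr2 i.succ)
      set v := val n (fun i s => F.det g' i s) (fun i => P i.succ) (fun i => r i.succ) with hvdef
      have hv : Measurable v := F.measurable_val_det g' (fun i => hP i.succ)
        (fun i => hr i.succ) (fun i => hr2 i.succ)
      have hvb : ∀ s, |v s| ≤ n * 2 := F.abs_val_det_le g' (fun i => hP i.succ)
        (fun i => hr i.succ) (fun i => hr2 i.succ)
      have hn' : (n : ℝ) + 1 ≤ H := by exact_mod_cast hn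
      have hH' : (0 : ℝ) < 2 * H := by
        have : (1 : ℝ) ≤ H := by exact_mod_cast hH
        linarith
      -- The rule is greedy for the action values of the continuation `g'`, whose coefficients are
      -- bounded by `2 + 2n ≤ 2H`. It depends neither on the state nor on the competitor κ.
      obtain ⟨c, hc⟩ := F.exists_rule_ge (w := F.qcoef (P := P) (r := r) v) hH' (fun j =>
        (F.abs_qcoef_le hP hr2 hvb j).trans (by linarith))
      refine ⟨Fin.cons c g', fun κ hκ s => ?_⟩
      set ζ := 2 * (H : ℝ) * (1 + 4 * q) / N with hζ
      have := hκ 0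
      have := hP 0
      have hκm := (stronglyMeasurable_val n (fun i => κ i.succ) (fun i => P i.succ)
        (fun i => hκ i.succ) (fun i => hP i.succ) (fun i => hr i.succ)
        (fun i => hr2 i.succ)).measurable
      have hκb := norm_val_le n (fun i => κ i.succ) (fun i => P i.succ)
        (fun i => hκ i.succ) (fun i => hP i.succ) (fun i => hr i.succ) (fun i => hr2 i.succ)
      have hint : ∀ (u : S → ℝ), Measurable u → (∀ s, ‖u s‖ ≤ n * 2) → ∀ a,
          Integrable (fun z : Y × S => u z.2) (P 0 (s, a)) := fun u hu hb a =>
        .of_bound (hu.comp measurable_snd).aestronglyMeasurable _ (.of_forall fun z => hb z.2)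
      have hVg : val (n + 1) (fun i s => F.det (Fin.cons c g' : Fin (n + 1) → _) i s) P r s =
          F.qcoef (P := P) (r := r) v ⬝ᵥ F.feat (s, F.rule c s) := by
        rw [F.val_det_succ _ hP hr hr2]
        simp only [Fin.cons_zero, Fin.cons_succ]
        exact F.qfun_eq (hlin 0) (hrlin 0) hv hvb s _
      rw [hVg, val]
      have hpt : ∀ a, r 0 s a + ∫ z, val n (fun i s => κ i.succ s) (fun i => P i.succ)
          (fun i => r i.succ) z.2 ∂(P 0 (s, a)) ≤
          F.qcoef (P := P) (r := r) v ⬝ᵥ F.feat (s, F.rule c s) + (n + 1) * ζ := fun a => by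
        have h1 : ∫ z, val n (fun i s => κ i.succ s) (fun i => P i.succ)
            (fun i => r i.succ) z.2 ∂(P 0 (s, a)) ≤ ∫ z, (v z.2 + n * ζ) ∂(P 0 (s, a)) :=
          integral_mono (hint _ hκm hκb a) ((hint _ hv hvb a).add (integrable_const _))
            fun z => hg' (fun i => κ i.succ) (fun i => hκ i.succ) z.2
        rw [integral_add (hint _ hv hvb a) (integrable_const _)] at h1
        simp only [integral_const, probReal_univ, one_smul] at h1
        have h2 := F.qfun_eq (hlin 0) (hrlin 0) hv hvb s a
        have h3 := hc s a
        linarith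
      calc _ ≤ ∫ _a, (F.qcoef (P := P) (r := r) v ⬝ᵥ F.feat (s, F.rule c s) + (n + 1) * ζ)
            ∂(κ 0 s) := by
            refine integral_mono ?_ (integrable_const _) hpt
            refine .of_bound (measurable_qfun (hr 0) (P₀ := P 0) hκm s).aestronglyMeasurable
              (2 + n * 2) (.of_forall fun a => ?_)
            refine (norm_add_le _ _).trans (add_le_add (hr2 _ _ _) ?_)
            exact (norm_integral_le_of_norm_le_const (.of_forall fun z : Y × S => hκb z.2)).trans (by simp)
        _ = _ := by simp

/-- Simulation lemma: the values of a sequence of rules in two linear models differ by at most the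
expected cumulative one-step prediction errors. -/
theorem abs_val_sub_val_le {H : ℕ} : ∀ (n : ℕ) (_ : n ≤ H)
    (P P' : Fin n → Kernel (S × A) (Y × S)) (r r' b : Fin n → S → A → ℝ)
    (A₀ B₀ C : ℝ), (∀ i, IsMarkovKernel (P i)) → (∀ i, IsMarkovKernel (P' i)) →
    (∀ i, F.LinTrans (P' i)) →
    (∀ i, Measurable (Function.uncurry (r i))) → (∀ i, Measurable (Function.uncurry (r' i))) →
    (∀ i, Measurable (Function.uncurry (b i))) →
    (∀ i, F.LinFun (r' i)) → (∀ i s a, ‖r i s a‖ ≤ 2) → (∀ i s a, ‖r' i s a‖ ≤ 2) →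
    (∀ i s a, ‖b i s a‖ ≤ C) →
    (∀ i (c : Fin q → Fin (2 * N + 1)) (w : Fin q → ℝ), (∀ j, |w j| ≤ 2 * H) →
      (∀ s, |w ⬝ᵥ F.feat (s, F.rule c s)| ≤ 2 * H) → ∀ s a,
      |r' i s a - r i s a + (∫ z, w ⬝ᵥ F.feat (z.2, F.rule c z.2) ∂(P' i (s, a)) -
        ∫ z, w ⬝ᵥ F.feat (z.2, F.rule c z.2) ∂(P i (s, a)))| ≤ A₀ + B₀ * b i s a) →
    ∀ (g : Fin n → Fin q → Fin (2 * N + 1)) (s : S),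
      |val n (fun i s => F.det g i s) P' r' s - val n (fun i s => F.det g i s) P r s| ≤
        n * A₀ + B₀ * val n (fun i s => F.det g i s) P b s
  | 0, _, _, _, _, _, _, _, _, _, _, _, _, _, _, _, _, _, _, _, _, _, _ => by simp [val]
  | n + 1, hn, P, P', r, r', b, A₀, B₀, C, hP, hP', hlin', hr, hr', hb, hrlin', hr2, hr2', hbC,
      herr, g, s => by
      have ih := abs_val_sub_val_le n (by omega) (fun i => P i.succ) (fun i => P' i.succ)
        (fun i => r i.succ) (fun i => r' i.succ) (fun i => b i.succ) A₀ B₀ C (fun i => hP i.succ)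
        (fun i => hP' i.succ) (fun i => hlin' i.succ) (fun i => hr i.succ) (fun i => hr' i.succ)
        (fun i => hb i.succ) (fun i => hrlin' i.succ) (fun i => hr2 i.succ) (fun i => hr2' i.succ)
        (fun i => hbC i.succ) (fun i => herr i.succ) (fun i => g i.succ)
      rw [F.val_det_succ g hP hr hr2, F.val_det_succ g hP' hr' hr2', F.val_det_succ g hP hb hbC]
      set a := F.rule (g 0) s
      set v := val n (fun i s => F.det (fun j => g j.succ) i s) (fun i => P i.succ)
        (fun i => r i.succ)
      set v' := val n (fun i s => F.det (fun j => g j.succ) i s) (fun i => P' i.succ)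
        (fun i => r' i.succ) with hv'def
      set vb := val n (fun i s => F.det (fun j => g j.succ) i s) (fun i => P i.succ)
        (fun i => b i.succ)
      have hv : Measurable v := F.measurable_val_det _ (fun i => hP i.succ)
        (fun i => hr i.succ) (fun i => hr2 i.succ)
      have hvb : ∀ s, |v s| ≤ n * 2 := F.abs_val_det_le _ (fun i => hP i.succ)
        (fun i => hr i.succ) (fun i => hr2 i.succ)
      have hv' : Measurable v' := F.measurable_val_det _ (fun i => hP' i.succ)
        (fun i => hr' i.succ) (fun i => hr2' i.succ)
      have hvb' : ∀ s, |v' s| ≤ n * 2 := F.abs_val_det_le _ (fun i => hP' i.succ)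
        (fun i => hr' i.succ) (fun i => hr2' i.succ)
      have hvbm : Measurable vb := F.measurable_val_det _ (fun i => hP i.succ)
        (fun i => hb i.succ) (fun i => hbC i.succ)
      have hvbb : ∀ s, |vb s| ≤ n * C := F.abs_val_det_le _ (fun i => hP i.succ)
        (fun i => hb i.succ) (fun i => hbC i.succ)
      have hn' : (n : ℝ) + 1 ≤ H := by exact_mod_cast hn
      -- The error splits into the one-step error tested on `v'`, which has the form covered by
      -- `herr`, and the mean of `v' - v` under the true kernel `P`. All bonuses therefore
      -- accumulate under `P`.
      obtain ⟨c, w, hw1, hw2⟩ := F.exists_val_det_eq (fun i => g i.succ) (fun i => hP' i.succ)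
        (fun i => hlin' i.succ) (fun i => hr' i.succ) (fun i => hrlin' i.succ)
        (fun i => hr2' i.succ)
      replace hw1 : ∀ j, |w j| ≤ 2 * H := fun j => (hw1 j).trans (by linarith)
      have h1 := herr 0 c w hw1 (fun s => by rw [← hw2 s]; exact (hvb' s).trans (by linarith)) s a
      simp only [← hw2] at h1
      have := hP 0
      have hint : ∀ (u : S → ℝ) (K : ℝ), Measurable u → (∀ s, ‖u s‖ ≤ K) →
          Integrable (fun z : Y × S => u z.2) (P 0 (s, a)) := fun u K hu hb =>
        .of_bound (hu.comp measurable_snd).aestronglyMeasurable _ (.of_forall fun z => hb z.2)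
      have hi := hint v _ hv hvb
      have hi' := hint v' _ hv' hvb'
      have hib := hint vb _ hvbm hvbb
      have h2 : |∫ z, v' z.2 ∂(P 0 (s, a)) - ∫ z, v z.2 ∂(P 0 (s, a))| ≤
          n * A₀ + B₀ * ∫ z, vb z.2 ∂(P 0 (s, a)) := by
        rw [← integral_sub hi' hi]
        calc _ ≤ ∫ z, |v' z.2 - v z.2| ∂(P 0 (s, a)) := abs_integral_le_integral_abs
          _ ≤ ∫ z, (n * A₀ + B₀ * vb z.2) ∂(P 0 (s, a)) :=
              integral_mono (hi'.sub hi).abs ((integrable_const _).add (hib.const_mul _))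
                fun z => ih z.2
          _ = _ := by
            rw [integral_add (integrable_const _) (hib.const_mul _), integral_const_mul B₀]
            simp
      have h3 := (abs_add_le _ _).trans (add_le_add h1 h2)
      have e1 : ∀ x y : ℝ, x = y → ∀ B, |x| ≤ B → |y| ≤ B := by rintro x _ rfl B h; exact h
      refine e1 _ _ ?_ _ (h3.trans (le_of_eq ?_))
      · ring
      · push_cast; ring

end FeatureModel

end Planning

/-! ### Regression targets, confidence conditions and bonuses -/

section Learning

variable {S A Y : Type*} [MeasurableSpace S] [MeasurableSpace A] [MeasurableSpace Y] {q N H : ℕ}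
  {E : Type*} [NormedAddCommGroup E] [InnerProductSpace ℝ E]
  [MeasurableSpace E] [BorelSpace E] [SecondCountableTopology E] [CompleteSpace E]

/-- The mean of the reading `f` of the feedback, given state and action. -/
def Env.meanRet (M : Env S A Y H) (f : Y → E) (h : Fin H) (s : S) (a : A) : E :=
  ∫ z, f z.1 ∂(M.step h (s, a))

/-- Transitions and mean readings are linear in the features, with their values at the anchors as
coefficients. -/
structure Env.Fits (M : Env S A Y H) (F : FeatureModel S A q N) (f : Y → E) : Prop where
  trans : ∀ h, F.LinTrans (M.step h)
  ret : ∀ h s a, M.meanRet f h s a =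
    ∑ j, F.feat (s, a) j • M.meanRet f h (F.anchor j).1 (F.anchor j).2

/-- A bounded measurable reading of the feedback. -/
structure IsReading (f : Y → E) : Prop where
  measurable : Measurable f
  norm_le : ∀ y, ‖f y‖ ≤ 2

namespace Env

variable (M : Env S A Y H) {f : Y → E} (hf : IsReading f)
include hf

theorem measurable_meanRet (h : Fin H) : Measurable (Function.uncurry (M.meanRet f h)) := by
  have := M.isMarkov h
  exact (StronglyMeasurable.integral_kernel (κ := M.step h) (f := fun z : Y × S => f z.1)
      (hf.measurable.comp measurable_fst).stronglyMeasurable).measurable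

theorem norm_meanRet_le (h : Fin H) (s : S) (a : A) : ‖M.meanRet f h s a‖ ≤ 2 := by
  have := M.isMarkov h
  have hb : ∀ z : Y × S, ‖f z.1‖ ≤ 2 := fun z => hf.norm_le z.1
  exact (norm_integral_le_of_norm_le_const (.of_forall hb)).trans (by simp)

theorem norm_total_meanRet_le (π : Policy S A H) : ‖M.total (M.meanRet f) π‖ ≤ H * 2 :=
  M.norm_total_le (M.norm_meanRet_le hf) π

end Env

namespace FeatureModel

variable (F : FeatureModel S A q N)

/-- A grid direction applied to the features under a rule, clipped to `[-1, 1]`. -/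
def clipVal (c c' : Fin q → Fin (2 * N + 1)) (s : S) : ℝ :=
  max (-1) (min 1 (gridPt N c ⬝ᵥ F.feat (s, F.rule c' s)))

theorem measurable_clipVal (c c' : Fin q → Fin (2 * N + 1)) : Measurable (F.clipVal c c') :=
  measurable_const.max (measurable_const.min (F.measurable_dotProduct_rule _ _))

theorem abs_clipVal_le (c c' : Fin q → Fin (2 * N + 1)) (s : S) : |F.clipVal c c' s| ≤ 1 :=
  abs_le.2 ⟨le_max_left _ _, max_le (by norm_num) (min_le_left _ _)⟩

/-- The regression targets: the reading of the feedback and the clipped values of the next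
state. -/
def target (e₀ : E) (f : Y → E) :
    Option ((Fin q → Fin (2 * N + 1)) × (Fin q → Fin (2 * N + 1))) → Y × S → E
  | none, z => f z.1
  | some c, z => F.clipVal c.1 c.2 z.2 • e₀

variable {e₀ : E} {f : Y → E}

theorem measurable_target (hf : IsReading f)
    (t : Option ((Fin q → Fin (2 * N + 1)) × (Fin q → Fin (2 * N + 1)))) :
    Measurable (F.target e₀ f t) := by
  cases t with
  | none => exact hf.measurable.comp measurable_fst
  | some c => exact ((F.measurable_clipVal c.1 c.2).comp measurable_snd).smul_const _

theorem norm_target_le (he₀ : ‖e₀‖ = 1) (hf : IsReading f)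
    (t : Option ((Fin q → Fin (2 * N + 1)) × (Fin q → Fin (2 * N + 1)))) (z : Y × S) :
    ‖F.target e₀ f t z‖ ≤ 2 := by
  cases t with
  | none => exact hf.norm_le _
  | some c =>
    simp only [target, norm_smul, he₀, mul_one, Real.norm_eq_abs]
    exact (F.abs_clipVal_le _ _ _).trans one_le_two

/-- The mean targets of an environment at the anchors. -/
def testMean (e₀ : E) (f : Y → E) (M : Env S A Y H)
    (t : Fin H × Option ((Fin q → Fin (2 * N + 1)) × (Fin q → Fin (2 * N + 1)))) (j : Fin q) : E :=
  ∫ z, F.target e₀ f t.2 z ∂(M.step t.1 (F.anchor j))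

theorem norm_testMean_le (he₀ : ‖e₀‖ = 1) (hf : IsReading f) (M : Env S A Y H)
    (t : Fin H × Option ((Fin q → Fin (2 * N + 1)) × (Fin q → Fin (2 * N + 1)))) (j : Fin q) :
    ‖F.testMean e₀ f M t j‖ ≤ 2 := by
  have := M.isMarkov t.1
  exact (norm_integral_le_of_norm_le_const (.of_forall (F.norm_target_le he₀ hf t.2))).trans
    (by simp)

/-- Multiplying scalar targets by the unit vector `e₀` puts them in `E`, so one regression statement
covers feedback and transitions. -/
theorem integral_target {M : Env S A Y H} (hM : M.Fits F f)
    (t : Fin H × Option ((Fin q → Fin (2 * N + 1)) × (Fin q → Fin (2 * N + 1)))) (s : S) (a : A) :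
    ∫ z, F.target e₀ f t.2 z ∂(M.step t.1 (s, a)) =
      ∑ j, F.feat (s, a) j • F.testMean e₀ f M t j := by
  obtain ⟨h, t⟩ := t
  cases t with
  | none => exact hM.ret h s a
  | some c =>
    simp only [testMean, target]
    simp only [integral_smul_const]
    rw [hM.trans h s a _ (F.measurable_clipVal c.1 c.2) ⟨1, F.abs_clipVal_le c.1 c.2⟩]
    simp [dotProduct, Finset.sum_smul, smul_smul]

/-- The features of step `h` in the data. -/
def dataFeat (h : Fin H) {k : ℕ} (D : Data S A Y H k) (i : Fin k) : Fin q → ℝ :=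
  F.feat ((D i h).1, (D i h).2.1)

/-- The data are consistent with the environment `M`, up to the confidence level `L`. -/
def ConfCond (e₀ : E) (f : Y → E) (h₀ : Fin H) (N' : ℕ) (R L η : ℝ) (M : Env S A Y H) {k : ℕ}
    (D : Data S A Y H k) : Prop :=
  (∀ (t : Fin H × Option ((Fin q → Fin (2 * N + 1)) × (Fin q → Fin (2 * N + 1))))
    (c : Fin q → Fin (2 * N' + 1)),
    ‖residSum F.feat t.1 (F.target e₀ f t.2) (F.testMean e₀ f M t) (R • gridPt N' c) D‖ ≤
      L + 8 * featSq F.feat t.1 (R • gridPt N' c) D) ∧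
  ∀ i c j, |F.feat ((D i h₀).1, F.rule c (D i h₀).1) j - F.feat (M.init, F.rule c M.init) j| ≤ η

theorem measurableSet_confCond (hf : IsReading f) (h₀ : Fin H) (N' : ℕ) (R L η : ℝ)
    (M : Env S A Y H) (k : ℕ) :
    MeasurableSet {D : Data S A Y H k | F.ConfCond e₀ f h₀ N' R L η M D} := by
  refine MeasurableSet.inter ?_ ?_
  · have : {D : Data S A Y H k | ∀ (t : Fin H × Option ((Fin q → Fin (2 * N + 1)) ×
        (Fin q → Fin (2 * N + 1)))) (c : Fin q → Fin (2 * N' + 1)),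
        ‖residSum F.feat t.1 (F.target e₀ f t.2) (F.testMean e₀ f M t) (R • gridPt N' c) D‖ ≤
        L + 8 * featSq F.feat t.1 (R • gridPt N' c) D} = ⋂ t : Fin H × Option
          ((Fin q → Fin (2 * N + 1)) × (Fin q → Fin (2 * N + 1))),
        ⋂ c : Fin q → Fin (2 * N' + 1), {D |
        ‖residSum F.feat t.1 (F.target e₀ f t.2) (F.testMean e₀ f M t) (R • gridPt N' c) D‖ ≤
        L + 8 * featSq F.feat t.1 (R • gridPt N' c) D} := by
      ext D; simp
    change MeasurableSet {D : Data S A Y H k | ∀ t c, _}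
    rw [this]
    refine MeasurableSet.iInter fun t => MeasurableSet.iInter fun c => ?_
    exact measurableSet_le (measurable_residSum F.measurable_feat t.1
      (F.measurable_target hf t.2) _ _ k).norm
      ((measurable_featSq F.measurable_feat _ _ k).const_mul 8 |>.const_add L)
  · change MeasurableSet {D : Data S A Y H k | ∀ i c j, _}
    simp only [Set.ofPred_forall]
    refine MeasurableSet.iInter fun i => MeasurableSet.iInter fun c =>
      MeasurableSet.iInter fun j => ?_
    refine measurableSet_le ?_ measurable_const
    have h1 : Measurable fun D : Data S A Y H k => (D i h₀).1 := by fun_prop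
    have h2 : Measurable fun s => F.feat (s, F.rule c s) j := (measurable_pi_iff.1
      F.measurable_feat j).comp (measurable_id.prodMk (F.measurable_rule c))
    exact (((h2.comp h1).sub_const _).norm)

/-- The exploration bonus of a state-action pair. -/
def bonus (B : ℝ) {k : ℕ} (D : Data S A Y H k) (h : Fin H) (s : S) (a : A) : ℝ :=
  min 1 (2 * B * (Real.log (regGram (F.dataFeat h D) +
    Matrix.vecMulVec (F.feat (s, a)) (F.feat (s, a))).det -
    Real.log (regGram (F.dataFeat h D)).det))

theorem measurable_bonus (B : ℝ) {k : ℕ} (D : Data S A Y H k) (h : Fin H) :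
    Measurable (Function.uncurry (F.bonus B D h)) := by
  have h1 : Measurable fun z : S × A => (regGram (F.dataFeat h D) +
      Matrix.vecMulVec (F.feat z) (F.feat z)).det := by
    have hc : Continuous fun y : Fin q → ℝ =>
        (regGram (F.dataFeat h D) + Matrix.vecMulVec y y).det := by
      refine Continuous.matrix_det ?_
      exact continuous_const.add (continuous_id.matrix_vecMulVec continuous_id)
    exact hc.measurable.comp F.measurable_feat
  exact measurable_const.min (((Real.measurable_log.comp h1).sub_const _).const_mul _)

theorem log_det_sub (h : Fin H) {k : ℕ} (D : Data S A Y H k) (s : S) (a : A) :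
    Real.log (regGram (F.dataFeat h D) +
      Matrix.vecMulVec (F.feat (s, a)) (F.feat (s, a))).det -
      Real.log (regGram (F.dataFeat h D)).det =
    Real.log (1 + F.feat (s, a) ⬝ᵥ ((regGram (F.dataFeat h D))⁻¹.mulVec (F.feat (s, a)))) := by
  have h1 := (posDef_regGram (F.dataFeat h D)).det_pos
  have h2 := dotProduct_inv_regGram_nonneg (F.dataFeat h D) (F.feat (s, a))
  rw [det_regGram_add, Real.log_mul h1.ne' (by linarith)]
  ring

theorem bonus_nonneg {B : ℝ} (hB : 0 ≤ B) {k : ℕ} (D : Data S A Y H k) (h : Fin H) (s : S)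
    (a : A) : 0 ≤ F.bonus B D h s a := by
  rw [bonus, log_det_sub]
  have h2 := dotProduct_inv_regGram_nonneg (F.dataFeat h D) (F.feat (s, a))
  have := Real.log_nonneg (le_add_of_nonneg_right h2 : (1 : ℝ) ≤ 1 + _)
  exact le_min zero_le_one (by positivity)

theorem bonus_le_one (B : ℝ) {k : ℕ} (D : Data S A Y H k) (h : Fin H) (s : S)
    (a : A) : F.bonus B D h s a ≤ 1 := min_le_left _ _

/-- Defining the bonus by a log-determinant makes its sum along the data telescope; this bound shows
that it still dominates the truncated elliptical norm. -/
theorem min_le_bonus {B : ℝ} (hB : 1 ≤ B) {k : ℕ} (D : Data S A Y H k) (h : Fin H) (s : S)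
    (a : A) : min 1 (B * (F.feat (s, a) ⬝ᵥ
      ((regGram (F.dataFeat h D))⁻¹.mulVec (F.feat (s, a))))) ≤ F.bonus B D h s a := by
  rw [bonus, log_det_sub]
  exact le_min (min_le_left _ _)
    (min_one_le_log hB (dotProduct_inv_regGram_nonneg (F.dataFeat h D) (F.feat (s, a))))

/-- The prediction error of a consistent environment, for one target. -/
theorem norm_target_diff_sq_le (he₀ : ‖e₀‖ = 1) (hf : IsReading f) {h₀ : Fin H} {N' : ℕ}
    {R L η η' : ℝ} {M M' : Env S A Y H} (hM : M.Fits F f) (hM' : M'.Fits F f) {k : ℕ}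
    {D : Data S A Y H k} (hc : F.ConfCond e₀ f h₀ N' R L η M D)
    (hc' : F.ConfCond e₀ f h₀ N' R (L + 1) η' M' D) (hN' : 0 < N') (hL1 : 1 ≤ L)
    (hLq : (q : ℝ) ≤ L) (hLR : √L ≤ R) (hRN : R ≤ N')
    (hk : 16 * k * (q : ℝ) ^ 2 * (R / N') ≤ 1)
    (t : Fin H × Option ((Fin q → Fin (2 * N + 1)) × (Fin q → Fin (2 * N + 1)))) (s : S) (a : A) :
    ‖∫ z, F.target e₀ f t.2 z ∂(M'.step t.1 (s, a)) -
      ∫ z, F.target e₀ f t.2 z ∂(M.step t.1 (s, a))‖ ^ 2 ≤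
      56 ^ 2 * L * (F.feat (s, a) ⬝ᵥ
        ((regGram (F.dataFeat t.1 D))⁻¹.mulVec (F.feat (s, a)))) := by
  have hN'' : (0 : ℝ) < N' := by exact_mod_cast hN'
  have hR : 0 < R := lt_of_lt_of_le (Real.sqrt_pos.2 (by linarith)) hLR
  rw [F.integral_target hM', F.integral_target hM, ← Finset.sum_sub_distrib]
  simp only [← smul_sub]
  refine norm_sum_smul_sq_le (Θ := Set.range fun c => R • gridPt N' c) (γ := R / N')
    (fun i j => F.abs_feat_le _ j) (fun j => ?_) hL1 hLq (by positivity)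
    (div_le_one_of_le₀ hRN hN''.le) hk (fun θ hθ => ?_) ?_ _
  · refine (norm_sub_le _ _).trans ?_
    have := F.norm_testMean_le he₀ hf M' t j
    have := F.norm_testMean_le he₀ hf M t j
    linarith
  · obtain ⟨c, hc⟩ := exists_gridPt_close hN' (u := fun j => θ j / R) (fun j => by
      rw [abs_div, abs_of_pos hR]
      exact div_le_one_of_le₀ ((hθ j).trans hLR) hR.le)
    refine ⟨_, ⟨c, rfl⟩, fun j => ?_⟩
    have h1 : θ j - (R • gridPt N' c) j = R * (θ j / R - gridPt N' c j) := by
      simp only [Pi.smul_apply, smul_eq_mul]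
      field_simp
    rw [h1, abs_mul, abs_of_pos hR, div_eq_mul_one_div R]
    exact mul_le_mul_of_nonneg_left (hc j) hR.le
  · rintro _ ⟨c, rfl⟩
    have h1 := hc.1 t c
    have h2 := hc'.1 t c
    -- The observed targets cancel in the difference of the two residuals, leaving only the
    -- difference of the predictions.
    have h3 : ∑ i, (R • gridPt N' c ⬝ᵥ F.dataFeat t.1 D i) • ∑ j, F.dataFeat t.1 D i j •
        (F.testMean e₀ f M' t j - F.testMean e₀ f M t j) =
        residSum F.feat t.1 (F.target e₀ f t.2) (F.testMean e₀ f M t) (R • gridPt N' c) D -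
        residSum F.feat t.1 (F.target e₀ f t.2) (F.testMean e₀ f M' t) (R • gridPt N' c) D := by
      simp only [residSum, dataFeat]
      rw [← Finset.sum_sub_distrib]
      refine Finset.sum_congr rfl fun i _ => ?_
      rw [← smul_sub]
      simp only [smul_sub, Finset.sum_sub_distrib]
      abel
    change ‖∑ i, (R • gridPt N' c ⬝ᵥ F.dataFeat t.1 D i) • ∑ j, F.dataFeat t.1 D i j •
        (F.testMean e₀ f M' t j - F.testMean e₀ f M t j)‖ ≤ _
    rw [h3]
    refine (norm_sub_le _ _).trans ?_
    change _ ≤ 2 * L + 1 + 16 * featSq F.feat t.1 (R • gridPt N' c) D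
    linarith

end FeatureModel

end Learning

/-! ### Errors of consistent candidates -/

section Exploration

variable {S A Y : Type*} [MeasurableSpace S] [MeasurableSpace A] [MeasurableSpace Y] {q N H : ℕ}
  {E : Type*} [NormedAddCommGroup E] [InnerProductSpace ℝ E]
  [MeasurableSpace E] [BorelSpace E] [SecondCountableTopology E] [CompleteSpace E]

/-- Clipping does not hurt: a rescaled value function already lies in `[-1, 1]`. -/
theorem abs_max_min_sub_le {u v : ℝ} (hu : |u| ≤ 1) : |u - max (-1) (min 1 v)| ≤ |u - v| := by
  have := abs_le.1 hu
  rcases le_total v 1 with h1 | h1 <;> rcases le_total (-1) (min 1 v) with h2 | h2 <;>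
  rcases abs_cases (u - v) with h3 | h3 <;>
  simp_all only [min_eq_left, min_eq_right, max_eq_left, max_eq_right] <;>
  first | linarith | (rw [abs_le]; constructor <;> linarith)

theorem norm_le_of_forall_inner_le {v : E} {K : ℝ} (hK : 0 ≤ K)
    (h : ∀ θ : E, ‖θ‖ ≤ 1 → inner ℝ θ v ≤ K) : ‖v‖ ≤ K := by
  rcases eq_or_ne v 0 with rfl | hv
  · simpa using hK
  have hv' : 0 < ‖v‖ := norm_pos_iff.2 hv
  have h1 := h (‖v‖⁻¹ • v) (by rw [norm_smul, norm_inv, norm_norm, inv_mul_cancel₀ hv'.ne'])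
  rwa [real_inner_smul_left, real_inner_self_eq_norm_sq, sq, inv_mul_cancel_left₀ hv'.ne'] at h1

/-- Errors scale like the root of the bonus, while the potential controls its sum. This inequality
linearizes the root at the price α. -/
theorem sqrt_le_add_div {b α : ℝ} (hb : 0 ≤ b) (hα : 0 < α) : √b ≤ α + b / (4 * α) := by
  have h := sq_nonneg (√b - 2 * α)
  have h2 := Real.sq_sqrt hb
  have : √b * (4 * α) ≤ (α + b / (4 * α)) * (4 * α) := by
    rw [add_mul, div_mul_cancel₀ _ (by positivity)]
    nlinarith
  exact le_of_mul_le_mul_right this (by positivity)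

namespace FeatureModel

variable (F : FeatureModel S A q N) {e₀ : E} {f : Y → E}

/-- The integrals of linear functions of the next features in two environments. -/
theorem abs_integral_sub_le (he₀ : ‖e₀‖ = 1) {M M' : Env S A Y H} (hH : 1 ≤ H) (h : Fin H)
    {c : Fin q → Fin (2 * N + 1)} {w : Fin q → ℝ} (hw : ∀ j, |w j| ≤ 2 * H)
    (hwb : ∀ s, |w ⬝ᵥ F.feat (s, F.rule c s)| ≤ 2 * H) (s : S) (a : A) :
    ∃ t, |∫ z, w ⬝ᵥ F.feat (z.2, F.rule c z.2) ∂(M'.step h (s, a)) -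
        ∫ z, w ⬝ᵥ F.feat (z.2, F.rule c z.2) ∂(M.step h (s, a))| ≤
      2 * H * ‖∫ z, F.target e₀ f t z ∂(M'.step h (s, a)) -
        ∫ z, F.target e₀ f t z ∂(M.step h (s, a))‖ + 8 * H * q / N := by
  have hH' : (0 : ℝ) < 2 * H := by
    have : (1 : ℝ) ≤ H := by exact_mod_cast hH
    linarith
  obtain ⟨c₀, hc₀⟩ := F.exists_grid_close hH' hw
  have hclip : ∀ s, |w ⬝ᵥ F.feat (s, F.rule c s) - 2 * H * F.clipVal c₀ c s| ≤
      2 * H * (2 * q / N) := fun s => by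
    have h1 := abs_max_min_sub_le (u := w ⬝ᵥ F.feat (s, F.rule c s) / (2 * H))
      (v := gridPt N c₀ ⬝ᵥ F.feat (s, F.rule c s)) (by
        rw [abs_div, abs_of_pos hH']; exact div_le_one_of_le₀ (hwb s) hH'.le)
    have h2 := mul_le_mul_of_nonneg_left h1 hH'.le
    have h3 : ∀ x y : ℝ, 2 * H * |x / (2 * H) - y| = |x - 2 * H * y| := fun x y => by
      rw [← abs_of_pos hH', ← abs_mul, abs_of_pos hH', mul_sub, mul_div_cancel₀ _ hH'.ne']
    rw [h3, h3] at h2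
    exact h2.trans (hc₀ _)
  have hwm : Measurable fun z : Y × S => w ⬝ᵥ F.feat (z.2, F.rule c z.2) :=
    (F.measurable_dotProduct_rule w c).comp measurable_snd
  have hcm : Measurable fun z : Y × S => F.clipVal c₀ c z.2 :=
    (F.measurable_clipVal c₀ c).comp measurable_snd
  have hint : ∀ M₁ : Env S A Y H, |∫ z, w ⬝ᵥ F.feat (z.2, F.rule c z.2) ∂(M₁.step h (s, a)) -
      2 * H * ∫ z, F.clipVal c₀ c z.2 ∂(M₁.step h (s, a))| ≤ 2 * H * (2 * q / N) := fun M₁ => by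
    have := M₁.isMarkov h
    have hi : Integrable (fun z : Y × S => F.clipVal c₀ c z.2) (M₁.step h (s, a)) :=
      .of_bound hcm.aestronglyMeasurable 1 (.of_forall fun z => F.abs_clipVal_le _ _ z.2)
    have hi' : Integrable (fun z : Y × S => w ⬝ᵥ F.feat (z.2, F.rule c z.2)) (M₁.step h (s, a)) :=
      .of_bound hwm.aestronglyMeasurable (2 * H) (.of_forall fun z => hwb z.2)
    rw [← integral_const_mul, ← integral_sub hi' (hi.const_mul _)]
    have hb : ∀ z : Y × S, ‖w ⬝ᵥ F.feat (z.2, F.rule c z.2) - 2 * H * F.clipVal c₀ c z.2‖ ≤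
      2 * H * (2 * q / N) := fun z => hclip z.2
    exact (norm_integral_le_of_norm_le_const (.of_forall hb)).trans (by simp)
  refine ⟨some (c₀, c), ?_⟩
  simp only [target, integral_smul_const]
  rw [← sub_smul, norm_smul, he₀, mul_one, Real.norm_eq_abs]
  set I' := ∫ z, F.clipVal c₀ c z.2 ∂(M'.step h (s, a))
  set I := ∫ z, F.clipVal c₀ c z.2 ∂(M.step h (s, a))
  have h1 := abs_le.1 (hint M')
  have h2 := abs_le.1 (hint M)
  have h3 : 2 * (H : ℝ) * |I' - I| = |2 * H * I' - 2 * H * I| := by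
    rw [← mul_sub, abs_mul, abs_of_pos hH']
  have h4 : 8 * H * q / N = 2 * (2 * H * (2 * q / N) : ℝ) := by ring
  rw [h3, h4]
  have h5 := abs_le.1 (le_refl |2 * H * I' - 2 * H * I|)
  rw [abs_le]
  constructor <;> linarith

/-- The one-step prediction error of a consistent environment is controlled by the bonus. -/
theorem abs_step_error_le (he₀ : ‖e₀‖ = 1) (hf : IsReading f) {h₀ : Fin H} {N' : ℕ}
    {R L η η' : ℝ} {M M' : Env S A Y H} (hM : M.Fits F f) (hM' : M'.Fits F f) {k : ℕ}
    {D : Data S A Y H k} (hc : F.ConfCond e₀ f h₀ N' R L η M D)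
    (hc' : F.ConfCond e₀ f h₀ N' R (L + 1) η' M' D) (hN' : 0 < N') (hL1 : 1 ≤ L)
    (hLq : (q : ℝ) ≤ L) (hLR : √L ≤ R) (hRN : R ≤ N')
    (hk : 16 * k * (q : ℝ) ^ 2 * (R / N') ≤ 1) {α : ℝ} (hα : 0 < α) {θ : E} (hθ : ‖θ‖ ≤ 1)
    (h : Fin H) (c : Fin q → Fin (2 * N + 1)) (w : Fin q → ℝ) (hw : ∀ j, |w j| ≤ 2 * H)
    (hwb : ∀ s, |w ⬝ᵥ F.feat (s, F.rule c s)| ≤ 2 * H) (s : S) (a : A) :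
    |inner ℝ θ (M'.meanRet f h s a) - inner ℝ θ (M.meanRet f h s a) +
      (∫ z, w ⬝ᵥ F.feat (z.2, F.rule c z.2) ∂(M'.step h (s, a)) -
        ∫ z, w ⬝ᵥ F.feat (z.2, F.rule c z.2) ∂(M.step h (s, a)))| ≤
      12 * H * α + 8 * H * q / N + 3 * H / α * F.bonus (441 * L) D h s a := by
  have hH : 1 ≤ H := by have := h.isLt; omega
  have hH' : (1 : ℝ) ≤ H := by exact_mod_cast hH
  set ν := F.feat (s, a) ⬝ᵥ ((regGram (F.dataFeat h D))⁻¹.mulVec (F.feat (s, a))) with hν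
  have hν0 : 0 ≤ ν := dotProduct_inv_regGram_nonneg _ _
  have hd : ∀ t, ‖∫ z, F.target e₀ f t z ∂(M'.step h (s, a)) -
      ∫ z, F.target e₀ f t z ∂(M.step h (s, a))‖ ≤ min 4 (56 * √(L * ν)) := fun t => by
    refine le_min ?_ ?_
    · have := M.isMarkov h
      have := M'.isMarkov h
      have h1 := (norm_integral_le_of_norm_le_const (μ := M.step h (s, a))
        (.of_forall (F.norm_target_le he₀ hf t)))
      have h2 := (norm_integral_le_of_norm_le_const (μ := M'.step h (s, a))
        (.of_forall (F.norm_target_le he₀ hf t)))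
      simp only [probReal_univ, mul_one] at h1 h2
      exact (norm_sub_le _ _).trans (by linarith)
    · have h1 := F.norm_target_diff_sq_le he₀ hf hM hM' hc hc' hN' hL1 hLq hLR hRN hk (h, t) s a
      refine abs_le_of_sq_le_sq' ?_ (by positivity) |>.2
      rw [mul_pow, Real.sq_sqrt (by positivity), ← mul_assoc]
      exact h1
  set A₁ := min 4 (56 * √(L * ν)) with hA₁
  have hA0 : 0 ≤ A₁ := le_min (by norm_num) (by positivity)
  have h1 : |inner ℝ θ (M'.meanRet f h s a) - inner ℝ θ (M.meanRet f h s a)| ≤ A₁ := by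
    rw [← inner_sub_right]
    refine (abs_real_inner_le_norm _ _).trans ?_
    refine (mul_le_of_le_one_left (norm_nonneg _) hθ).trans (hd none)
  obtain ⟨t, ht⟩ := F.abs_integral_sub_le (f := f) he₀ (M := M) (M' := M') hH h hw hwb s a
  have h2 := mul_le_mul_of_nonneg_left (hd t) (by linarith : (0 : ℝ) ≤ 2 * H)
  have hb := F.min_le_bonus (B := 441 * L) (by linarith) D h s a
  have hb0 := F.bonus_nonneg (B := 441 * L) (by linarith) D h s a
  -- Return error plus `2H` times transition error, with `1 + 2H ≤ 3H`. Dividing `A₁` by 4 brings it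
  -- below 1, and `56²/16 = 196 ≤ 441`.
  have hA : (1 + 2 * H) * A₁ ≤ 12 * H * √(F.bonus (441 * L) D h s a) := by
    have h3 : A₁ / 4 ≤ √(F.bonus (441 * L) D h s a) := by
      refine Real.le_sqrt_of_sq_le (le_trans ?_ hb)
      have h4 : A₁ ≤ 56 * √(L * ν) := min_le_right _ _
      have h5 : A₁ ^ 2 ≤ 56 ^ 2 * (L * ν) := by
        calc A₁ ^ 2 ≤ (56 * √(L * ν)) ^ 2 := by gcongr
          _ = _ := by rw [mul_pow, Real.sq_sqrt (by positivity)]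
      have h6 : A₁ ≤ 4 := min_le_left _ _
      rw [div_pow]
      refine le_min ?_ ?_
      · rw [div_le_one (by norm_num)]
        gcongr
      · rw [div_le_iff₀ (by norm_num)]
        have : 0 ≤ L * ν := by positivity
        linarith
    nlinarith
  have h3 := sqrt_le_add_div hb0 hα
  have h4 := mul_le_mul_of_nonneg_left h3 (by linarith : (0 : ℝ) ≤ 12 * H)
  have h5 : 12 * (H : ℝ) * (α + F.bonus (441 * L) D h s a / (4 * α)) =
      12 * H * α + 3 * H / α * F.bonus (441 * L) D h s a := by
    field_simp
    ring
  refine (abs_add_le _ _).trans ?_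
  linarith

/-- The value of a sequence of rules in a consistent environment, compared with the true value. -/
theorem norm_total_sub_le (he₀ : ‖e₀‖ = 1) (hf : IsReading f) {h₀ : Fin H}
    {N' : ℕ} {R L η : ℝ} {M M' : Env S A Y H} (hM : M.Fits F f) (hM' : M'.Fits F f) {k : ℕ}
    (hk0 : 0 < k) {D : Data S A Y H k} (hc : F.ConfCond e₀ f h₀ N' R L 0 M D)
    (hc' : F.ConfCond e₀ f h₀ N' R (L + 1) η M' D) (hN' : 0 < N') (hL1 : 1 ≤ L)
    (hLq : (q : ℝ) ≤ L) (hLR : √L ≤ R) (hRN : R ≤ N')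
    (hk : 16 * k * (q : ℝ) ^ 2 * (R / N') ≤ 1) {α : ℝ} (hα : 0 < α)
    (g : Fin H → Fin q → Fin (2 * N + 1)) :
    ‖M'.total (M'.meanRet f) (F.pol g) - M.total (M.meanRet f) (F.pol g)‖ ≤
      2 * H * q * η + H * (12 * H * α + 8 * H * q / N) +
        3 * H / α * M.total (F.bonus (441 * L) D) (F.pol g) := by
  have hH : 1 ≤ H := by have := h₀.isLt; omega
  have hbm := fun h => F.measurable_bonus (441 * L) D h
  have hb0 : ∀ h s a, 0 ≤ F.bonus (441 * L) D h s a := fun h s a =>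
    F.bonus_nonneg (by linarith) D h s a
  have hb1 : ∀ h s a, ‖F.bonus (441 * L) D h s a‖ ≤ 1 := fun h s a => by
    rw [Real.norm_eq_abs, abs_of_nonneg (hb0 h s a)]
    exact F.bonus_le_one _ _ _ _ _
  have hinit : ∀ c j, |F.feat (M'.init, F.rule c M'.init) j - F.feat (M.init, F.rule c M.init) j| ≤
      η := fun c j => by
    -- The true environment satisfies the condition with tolerance 0, so the first record reveals
    -- its initial features exactly; this is where `0 < k` matters.
    have h1 := hc.2 ⟨0, hk0⟩ c j
    have h2 := hc'.2 ⟨0, hk0⟩ c j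
    have h3 := abs_nonpos_iff.1 h1
    rw [sub_eq_zero] at h3
    rwa [← h3, abs_sub_comm]
  have hη : 0 ≤ q * η := by
    rcases q.eq_zero_or_pos with h | h
    · simp [h]
    · exact mul_nonneg (Nat.cast_nonneg _) ((abs_nonneg _).trans (hinit 0 ⟨0, h⟩))
  have hb_tot : 0 ≤ M.total (F.bonus (441 * L) D) (F.pol g) :=
    integral_nonneg fun τ => Finset.sum_nonneg fun h _ => hb0 _ _ _
  have hK : 0 ≤ 2 * H * q * η + H * (12 * H * α + 8 * H * q / N) +
      3 * H / α * M.total (F.bonus (441 * L) D) (F.pol g) := by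
    have : 2 * H * q * η = 2 * H * (q * η) := by ring
    rw [this]
    positivity
  -- Vector values are compared one direction at a time; the confidence condition does not involve
  -- θ, so the bound holds for all directions at once.
  refine norm_le_of_forall_inner_le hK fun θ hθ => ?_
  have hrm : ∀ (M₁ : Env S A Y H) h, Measurable (Function.uncurry
      fun s a => inner ℝ θ (M₁.meanRet f h s a)) := fun M₁ h =>
    (M₁.measurable_meanRet hf h).const_inner
  have hr2 : ∀ (M₁ : Env S A Y H) h s a, ‖(inner ℝ θ (M₁.meanRet f h s a) : ℝ)‖ ≤ 2 :=
    fun M₁ h s a => (abs_real_inner_le_norm _ _).trans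
      ((mul_le_of_le_one_left (norm_nonneg _) hθ).trans (M₁.norm_meanRet_le hf h s a))
  have hrlin : ∀ h, F.LinFun fun s a => inner ℝ θ (M'.meanRet f h s a) := fun h s a => by
    change inner ℝ θ (M'.meanRet f h s a) = _
    rw [hM'.ret h s a, inner_sum]
    simp [dotProduct, inner_smul_right]
  have hin : ∀ M₁ : Env S A Y H, inner ℝ θ (M₁.total (M₁.meanRet f) (F.pol g)) =
      val H (fun i s => F.det g i s) M₁.step (fun h s a => inner ℝ θ (M₁.meanRet f h s a))
        M₁.init := fun M₁ => by
    rw [← innerSL_apply_apply ℝ θ, ← M₁.total_clm (M₁.measurable_meanRet hf) (M₁.norm_meanRet_le hf)]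
    exact M₁.total_eq_val (hrm M₁) (hr2 M₁) _
  rw [inner_sub_right, hin, hin, M.total_eq_val hbm hb1]
  obtain ⟨c, w, hw, hrep⟩ := F.exists_val_det_eq g M'.isMarkov hM'.trans (hrm M') hrlin (hr2 M')
  -- The initial states may differ, but the value depends on the state only through its features
  -- under the rule `c`.
  have h1 : |val H (fun i s => F.det g i s) M'.step
      (fun h s a => inner ℝ θ (M'.meanRet f h s a)) M'.init - val H (fun i s => F.det g i s) M'.step
      (fun h s a => inner ℝ θ (M'.meanRet f h s a)) M.init| ≤ 2 * H * q * η := by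
    rw [hrep, hrep, ← dotProduct_sub]
    refine (abs_dotProduct_le (by positivity) hw (hinit c)).trans (le_of_eq ?_)
    ring
  have h2 := F.abs_val_sub_val_le H le_rfl M.step M'.step
    (fun h s a => inner ℝ θ (M.meanRet f h s a)) (fun h s a => inner ℝ θ (M'.meanRet f h s a))
    (F.bonus (441 * L) D) (12 * H * α + 8 * H * q / N) (3 * H / α) 1 M.isMarkov M'.isMarkov
    hM'.trans (hrm M) (hrm M') hbm hrlin (hr2 M) (hr2 M') hb1
    (fun h c w hw hwb s a => F.abs_step_error_le he₀ hf hM hM' hc hc' hN' hL1 hLq hLR hRN hk hα hθ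
      h c w hw hwb s a) g M.init
  have h3 := (abs_le.1 h1).2
  have h4 := (abs_le.1 h2).2
  change _ ≤ _ + 3 * H / α * val H (fun i s => F.det g i s) M.step _ M.init
  linarith

end FeatureModel

end Exploration

/-! ### The exploration algorithm and its potential argument -/

section Explorer

/-- The parameters of the exploration algorithm, with a finite family of candidate environments. -/
structure Explorer (S A Y : Type*) [MeasurableSpace S] [MeasurableSpace A] [MeasurableSpace Y]
    (q N H : ℕ) (E : Type*) [NormedAddCommGroup E] [InnerProductSpace ℝ E] [MeasurableSpace E]
    (ι : Type*) where
  F : FeatureModel S A q N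
  e₀ : E
  norm_e₀ : ‖e₀‖ = 1
  f : Y → E
  reading : IsReading f
  h₀ : Fin H
  h₀_eq : (h₀ : ℕ) = 0
  mod : ι → Env S A Y H
  fits : ∀ i, (mod i).Fits F f
  (N' m : ℕ)
  (R L η ε α : ℝ)
  N'_pos : 0 < N'
  one_le_L : 1 ≤ L
  q_le_L : (q : ℝ) ≤ L
  L_le_R : √L ≤ R
  R_le : R ≤ N'
  mesh_le : 16 * m * (q : ℝ) ^ 2 * (R / N') ≤ 1
  α_pos : 0 < α
  gap : 2 * (2 * H * q * η + H * (12 * H * α + 8 * H * q / N)) ≤ ε / 8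

namespace Explorer

variable {S A Y : Type*} [MeasurableSpace S] [MeasurableSpace A] [MeasurableSpace Y] {q N H : ℕ}
  {E : Type*} [NormedAddCommGroup E] [InnerProductSpace ℝ E]
  [MeasurableSpace E] [BorelSpace E] [SecondCountableTopology E] [CompleteSpace E]
  {ι : Type*} [Finite ι] (X : Explorer S A Y q N H E ι)

/-- The value vector of a sequence of rules in an environment. -/
def value (M : Env S A Y H) (g : Fin H → Fin q → Fin (2 * N + 1)) : E :=
  M.total (M.meanRet X.f) (X.F.pol g)

/-- The candidates that were consistent with the data after each episode. -/
def confSet : (k : ℕ) → Data S A Y H k → Set ι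
  | 0, _ => Set.univ
  | k + 1, D => {i | i ∈ confSet k (Fin.init D) ∧
      X.F.ConfCond X.e₀ X.f X.h₀ X.N' X.R (X.L + 1) X.η (X.mod i) D}

/-- The true environment was consistent with the data after each episode. -/
def GoodHist (M : Env S A Y H) : (k : ℕ) → Data S A Y H k → Prop
  | 0, _ => True
  | k + 1, D => GoodHist M k (Fin.init D) ∧
      X.F.ConfCond X.e₀ X.f X.h₀ X.N' X.R X.L 0 M D

/-- Some sequence of rules has clearly different values in two candidates. -/
def Wide (K : Set ι) : Prop :=
  ∃ g, ∃ i ∈ K, ∃ j ∈ K, X.ε / 4 < ‖X.value (X.mod i) g - X.value (X.mod j) g‖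

open Classical in
/-- A sequence of rules that distinguishes two candidates, if there is one. -/
def wideRule (K : Set ι) : Fin H → Fin q → Fin (2 * N + 1) :=
  if h : X.Wide K then h.choose else 0

/-- After each episode but the first, the remaining candidates could be distinguished. -/
def AllWide : (k : ℕ) → Data S A Y H k → Prop
  | 0, _ => True
  | k + 1, D => AllWide k (Fin.init D) ∧ (k = 0 ∨ X.Wide (X.confSet k (Fin.init D)))

theorem measurable_confSet : ∀ k, Measurable (X.confSet k)
  | 0 => measurable_const
  | k + 1 => by
      rw [measurable_set_iff]
      intro i
      have h1 := (measurable_set_iff.1 (measurable_confSet k) i).comp (measurable_finInit k)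
      have h2 := X.F.measurableSet_confCond (e₀ := X.e₀) X.reading X.h₀ X.N' X.R (X.L + 1) X.η
        (X.mod i) (k + 1)
      exact h1.and (measurableSet_setOfPred.1 h2)

theorem measurableSet_goodHist (M : Env S A Y H) : ∀ k, MeasurableSet {D | X.GoodHist M k D}
  | 0 => by simp [GoodHist]
  | k + 1 => (measurable_finInit k (measurableSet_goodHist M k)).inter
      (X.F.measurableSet_confCond X.reading X.h₀ X.N' X.R X.L 0 M (k + 1))

theorem measurableSet_allWide : ∀ k, MeasurableSet {D | X.AllWide k D}
  | 0 => by simp [AllWide]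
  | k + 1 => by
      refine (measurable_finInit k (measurableSet_allWide k)).inter (.union (.const _) ?_)
      have h : MeasurableSet {K : Set ι | X.Wide K} := Set.Finite.measurableSet (Set.toFinite _)
      exact ((X.measurable_confSet k).comp (measurable_finInit k)) h

/-- The policies of the exploration. -/
def play (k : ℕ) : Policy (Data S A Y H k × S) A H :=
  Policy.select (X.confSet k) (X.measurable_confSet k) fun K => X.F.pol (X.wideRule K)

variable {X}

theorem GoodHist.confCond {M : Env S A Y H} {k : ℕ} (hk : 0 < k) {D : Data S A Y H k}
    (h : X.GoodHist M k D) : X.F.ConfCond X.e₀ X.f X.h₀ X.N' X.R X.L 0 M D := by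
  cases k with
  | zero => omega
  | succ k => exact h.2

theorem confCond_of_mem_confSet {k : ℕ} (hk : 0 < k) {D : Data S A Y H k} {i : ι}
    (h : i ∈ X.confSet k D) :
    X.F.ConfCond X.e₀ X.f X.h₀ X.N' X.R (X.L + 1) X.η (X.mod i) D := by
  cases k with
  | zero => omega
  | succ k => exact h.2

/-- If two candidates differ by more than `ε/4`, their errors relative to the truth add up to at
least that. The terms without bonus account for at most `ε/8` by `gap`, so bonuses supply the rest.
-/
theorem total_bonus_ge {M : Env S A Y H} (hM : M.Fits X.F X.f) {k : ℕ} (hk0 : 0 < k)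
    (hkm : k ≤ X.m) {D : Data S A Y H k} (hgood : X.GoodHist M k D)
    (hwide : X.Wide (X.confSet k D)) :
    X.ε * X.α / (48 * H) ≤
      M.total (X.F.bonus (441 * X.L) D) (X.F.pol (X.wideRule (X.confSet k D))) := by
  have hH : (0 : ℝ) < H := by exact_mod_cast X.h₀.pos
  have hm : 16 * k * (q : ℝ) ^ 2 * (X.R / X.N') ≤ 1 := by
    refine le_trans ?_ X.mesh_le
    have : 0 ≤ X.R / X.N' := div_nonneg ((Real.sqrt_nonneg _).trans X.L_le_R) (Nat.cast_nonneg _)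
    gcongr
  set g := X.wideRule (X.confSet k D) with hg
  have hspec : ∃ i ∈ X.confSet k D, ∃ j ∈ X.confSet k D,
      X.ε / 4 < ‖X.value (X.mod i) g - X.value (X.mod j) g‖ := by
    rw [hg, wideRule, dif_pos hwide]
    exact hwide.choose_spec
  obtain ⟨i, hi, j, hj, hij⟩ := hspec
  have key : ∀ i ∈ X.confSet k D, _ := fun i hi =>
    X.F.norm_total_sub_le X.norm_e₀ X.reading hM (X.fits i) hk0 (hgood.confCond hk0)
      (confCond_of_mem_confSet hk0 hi) X.N'_pos X.one_le_L X.q_le_L X.L_le_R X.R_le hm X.α_pos g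
  have h1 := key i hi
  have h2 := key j hj
  have h3 : ‖X.value (X.mod i) g - X.value (X.mod j) g‖ ≤
      ‖X.value (X.mod i) g - X.value M g‖ + ‖X.value (X.mod j) g - X.value M g‖ := by
    rw [norm_sub_rev (X.value (X.mod j) g)]
    exact norm_sub_le_norm_sub_add_norm_sub _ _ _
  have h4 := X.gap
  set T := M.total (X.F.bonus (441 * X.L) D) (X.F.pol g)
  have h5 : X.ε / 8 ≤ 6 * H / X.α * T := by
    simp only [value] at h3 hij
    have : 6 * H / X.α * T = 2 * (3 * H / X.α * T) := by ring
    linarith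
  rw [div_le_iff₀ (by positivity)]
  rw [div_mul_eq_mul_div, le_div_iff₀ X.α_pos] at h5
  linarith

/-- The logarithms of the determinants of the Gram matrices of all steps. -/
def potential (X : Explorer S A Y q N H E ι) {k : ℕ} (D : Data S A Y H k) : ℝ :=
  2 * (441 * X.L) / H * ∑ h, Real.log (regGram (X.F.dataFeat h D)).det

theorem measurable_potential (k : ℕ) :
    Measurable fun D : Data S A Y H k => X.potential D := by
  refine (Finset.measurable_sum _ fun h _ => Real.measurable_log.comp ?_).const_mul _
  have hc : Continuous fun x : Fin k → Fin q → ℝ => (regGram x).det := by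
    refine Continuous.matrix_det ?_
    refine continuous_const.add (continuous_finsetSum _ fun i _ => ?_)
    exact (continuous_apply i).matrix_vecMulVec (continuous_apply i)
  refine hc.measurable.comp (measurable_pi_lambda _ fun i => X.F.measurable_feat.comp ?_)
  fun_prop

/-- Dropping the truncation in the bonus leaves exactly the growth of the log-determinants. Division
by `H` normalizes the bonus sum of an episode to `[0, 1]`. -/
theorem sum_bonus_le_potential_sub {k : ℕ} (D : Data S A Y H k) (τ : Episode S A Y H) :
    (∑ h, X.F.bonus (441 * X.L) D h (τ h).1 (τ h).2.1) / H ≤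
      X.potential (Fin.snoc D τ : Data S A Y H (k + 1)) - X.potential D := by
  have hgram : ∀ h, regGram (X.F.dataFeat h (Fin.snoc D τ : Data S A Y H (k + 1))) =
      regGram (X.F.dataFeat h D) + Matrix.vecMulVec (X.F.feat ((τ h).1, (τ h).2.1))
        (X.F.feat ((τ h).1, (τ h).2.1)) := fun h => by
    simp [regGram, FeatureModel.dataFeat, Fin.sum_univ_castSucc, add_assoc]
  simp only [potential, hgram]
  rw [← mul_sub, ← Finset.sum_sub_distrib, div_mul_eq_mul_div, Finset.mul_sum]
  refine div_le_div_of_nonneg_right ?_ (Nat.cast_nonneg _)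
  exact Finset.sum_le_sum fun h _ => min_le_right _ _

theorem potential_nonneg {k : ℕ} (D : Data S A Y H k) : 0 ≤ X.potential D := by
  have := X.one_le_L
  refine mul_nonneg (by positivity) (Finset.sum_nonneg fun h _ => ?_)
  exact Real.log_nonneg (one_le_det_regGram _)

theorem potential_le {k : ℕ} (D : Data S A Y H k) :
    X.potential D ≤ 882 * X.L * (q * Real.log (q + 4 * q * k)) := by
  have hH : (0 : ℝ) < H := by exact_mod_cast X.h₀.pos
  have := X.one_le_L
  have h1 : ∀ h, Real.log (regGram (X.F.dataFeat h D)).det ≤ q * Real.log (q + 4 * q * k) :=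
    fun h => by
      rw [← Real.log_pow]
      refine Real.log_le_log (by linarith [one_le_det_regGram (X.F.dataFeat h D)]) ?_
      refine (det_regGram_le _ fun i j => X.F.abs_feat_le _ j).trans (le_of_eq ?_)
      ring
  calc _ ≤ 2 * (441 * X.L) / H * ∑ _h : Fin H, (q * Real.log (q + 4 * q * k)) := by
        unfold potential
        gcongr
        exact h1 _
    _ = _ := by
        rw [Finset.sum_const, Finset.card_univ, Fintype.card_fin, nsmul_eq_mul]
        field_simp
        ring

/-- The chord of the convex exponential over `[-1, 0]`, with `e⁻¹ < 1/2`. -/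
theorem exp_neg_le_one_sub_half {b : ℝ} (h0 : 0 ≤ b) (h1 : b ≤ 1) : Real.exp (-b) ≤ 1 - b / 2 := by
  have hc := convexOn_exp.2 (Set.mem_univ (-1)) (Set.mem_univ 0) h0 (sub_nonneg.2 h1) (by ring)
  simp only [smul_eq_mul, mul_neg, mul_one, mul_zero, add_zero, Real.exp_zero] at hc
  have h2 := Real.exp_neg_one_lt_half
  nlinarith

/-- The potential grows by at least a `[0, 1]`-valued variable with mean at least `εα/(48H²)`.
Passing to exponentials halves this drift but yields a high-probability bound directly. -/
theorem lintegral_exp_bonus_le {M : Env S A Y H} (hM : M.Fits X.F X.f) {k : ℕ} (hk0 : 0 < k)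
    (hkm : k ≤ X.m) {D : Data S A Y H k} (hgood : X.GoodHist M k D)
    (hwide : X.Wide (X.confSet k D)) :
    ∫⁻ τ, ENNReal.ofReal (Real.exp (-(X.potential (Fin.snoc D τ : Data S A Y H (k + 1)) -
      X.potential D))) ∂(M.episode (X.play k) D) ≤
      ENNReal.ofReal (Real.exp (-(X.ε * X.α / (96 * H ^ 2)))) := by
  have hH : (0 : ℝ) < H := by exact_mod_cast X.h₀.pos
  have hL : (0 : ℝ) ≤ 441 * X.L := by linarith [X.one_le_L]
  set b : Episode S A Y H → ℝ := fun τ => ∑ h, X.F.bonus (441 * X.L) D h (τ h).1 (τ h).2.1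
    with hb
  have hbm : Measurable b := measurable_rewardSum fun h => X.F.measurable_bonus _ D h
  have hb0 : ∀ τ, 0 ≤ b τ / H := fun τ => div_nonneg
    (Finset.sum_nonneg fun h _ => X.F.bonus_nonneg hL D h _ _) hH.le
  have hb1 : ∀ τ, b τ / H ≤ 1 := fun τ => by
    rw [div_le_one hH]
    exact (Finset.sum_le_sum fun h _ => X.F.bonus_le_one _ D h _ _).trans (by simp)
  have hi : Integrable b (M.episode (X.play k) D) := by
    refine .of_bound hbm.aestronglyMeasurable H (.of_forall fun τ => ?_)
    rw [Real.norm_eq_abs, abs_le]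
    have h0 := (le_div_iff₀ hH).1 (hb0 τ)
    have h1 := (div_le_one hH).1 (hb1 τ)
    constructor <;> linarith
  have htot : ∫ τ, b τ ∂(M.episode (X.play k) D) =
      M.total (X.F.bonus (441 * X.L) D) (X.F.pol (X.wideRule (X.confSet k D))) := by
    rw [hb, M.integral_episode (fun h => X.F.measurable_bonus _ D h) (C := 1)
      (fun h s a => ?_), play, Policy.at_select]
    rw [Real.norm_eq_abs, abs_of_nonneg (X.F.bonus_nonneg hL D h s a)]
    exact X.F.bonus_le_one _ D h s a
  calc _ ≤ ∫⁻ τ, ENNReal.ofReal (1 - b τ / H / 2) ∂(M.episode (X.play k) D) := by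
        refine lintegral_mono fun τ => ENNReal.ofReal_le_ofReal ?_
        refine le_trans (Real.exp_le_exp.2 (neg_le_neg ?_))
          (exp_neg_le_one_sub_half (hb0 τ) (hb1 τ))
        exact sum_bonus_le_potential_sub D τ
    _ = ENNReal.ofReal (∫ τ, (1 - b τ / H / 2) ∂(M.episode (X.play k) D)) := by
        refine (ofReal_integral_eq_lintegral_ofReal ((integrable_const _).sub
          ((hi.div_const _).div_const _)) (.of_forall fun τ => ?_)).symm
        have := hb1 τ
        change 0 ≤ 1 - b τ / H / 2
        linarith
    _ ≤ _ := by
        refine ENNReal.ofReal_le_ofReal ?_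
        rw [integral_sub (integrable_const _) ((hi.div_const _).div_const _), integral_div,
          integral_div, htot]
        have h1 := total_bonus_ge hM hk0 hkm hgood hwide
        have h2 := Real.add_one_le_exp (-(X.ε * X.α / (96 * H ^ 2)))
        refine le_trans ?_ h2
        have h3 : X.ε * X.α / (96 * H ^ 2) = X.ε * X.α / (48 * H) / H / 2 := by
          field_simp
          ring
        rw [h3]
        have h4 := div_le_div_of_nonneg_right (div_le_div_of_nonneg_right h1 hH.le) zero_le_two
        simp only [integral_const, probReal_univ, one_smul]
        linarith

/-- With many episodes, it is unlikely that the candidates can be distinguished all the time. -/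
theorem law_goodHist_allWide_le {M : Env S A Y H} (hM : M.Fits X.F X.f)
    (L : Learner S A Y H X.m) (hL : ∀ k, L.play k = X.play k) :
    L.law M X.m {D | X.GoodHist M X.m D ∧ X.AllWide X.m D} ≤
      ENNReal.ofReal (Real.exp (882 * X.L * (q * Real.log (q + 4 * q * X.m)) -
        ((X.m - 1 : ℕ) : ℝ) * (X.ε * X.α / (96 * H ^ 2)))) := by
  set c₀ := X.ε * X.α / (96 * H ^ 2)
  -- Truncated subtraction in `k - 1` gives no credit to the first episode, which starts without
  -- data. Beyond `m` the process is set to 0, since the mesh condition covers only `m` records.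
  let G : (k : ℕ) → Data S A Y H k → ENNReal := fun k =>
    if k ≤ X.m then {D | X.GoodHist M k D ∧ X.AllWide k D}.indicator
      fun D => ENNReal.ofReal (Real.exp (((k - 1 : ℕ) : ℝ) * c₀ - X.potential D)) else 0
  have hset : ∀ k, MeasurableSet {D | X.GoodHist M k D ∧ X.AllWide k D} := fun k =>
    (X.measurableSet_goodHist M k).inter (X.measurableSet_allWide k)
  have hG : ∀ k, Measurable (G k) := fun k => by
    have := X.measurable_potential k
    dsimp only [G]
    split_ifs
    · refine Measurable.indicator ?_ (hset k)
      fun_prop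
    · exact measurable_const
  have hstep : ∀ k D, ∫⁻ τ, G (k + 1) (Fin.snoc D τ) ∂(M.episode (L.play k) D) ≤ G k D := by
    intro k D
    rw [hL]
    by_cases hkm : k + 1 ≤ X.m
    swap
    · simp [G, hkm]
    have hkm' : k ≤ X.m := by omega
    simp only [G, hkm, hkm', if_true]
    -- Whether candidates can be distinguished in the next episode is known from the past data; if
    -- they cannot, the indicator is 0 from here on.
    by_cases hD : (X.GoodHist M k D ∧ X.AllWide k D) ∧ (k = 0 ∨ X.Wide (X.confSet k D))
    swap
    · have h0 : ∀ τ : Episode S A Y H, {D | X.GoodHist M (k + 1) D ∧ X.AllWide (k + 1) D}.indicator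
          (fun D => ENNReal.ofReal (Real.exp (((k + 1 - 1 : ℕ) : ℝ) * c₀ - X.potential D)))
          (Fin.snoc D τ : Data S A Y H (k + 1)) = 0 := fun τ => by
        refine Set.indicator_of_notMem (fun h => hD ?_) _
        obtain ⟨⟨h1, -⟩, h2, h3⟩ := h
        rw [Fin.init_snoc] at h1 h2 h3
        exact ⟨⟨h1, h2⟩, h3⟩
      rw [lintegral_congr h0]
      simp
    obtain ⟨hD1, hD2⟩ := hD
    rw [Set.indicator_of_mem (show D ∈ {D | X.GoodHist M k D ∧ X.AllWide k D} from hD1)]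
    calc _ ≤ ∫⁻ τ, ENNReal.ofReal (Real.exp ((k : ℝ) * c₀ - X.potential D)) * ENNReal.ofReal
          (Real.exp (-(X.potential (Fin.snoc D τ : Data S A Y H (k + 1)) - X.potential D)))
          ∂(M.episode (X.play k) D) := by
          refine lintegral_mono fun τ => (Set.indicator_le_self _ _ _).trans (le_of_eq ?_)
          rw [← ENNReal.ofReal_mul (Real.exp_pos _).le, ← Real.exp_add]
          congr 2
          simp only [Nat.add_sub_cancel]
          ring
      _ = ENNReal.ofReal (Real.exp ((k : ℝ) * c₀ - X.potential D)) * ∫⁻ τ, ENNReal.ofReal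
          (Real.exp (-(X.potential (Fin.snoc D τ : Data S A Y H (k + 1)) - X.potential D)))
          ∂(M.episode (X.play k) D) := lintegral_const_mul' _ _ ENNReal.ofReal_ne_top
      _ ≤ _ := by
          rcases k.eq_zero_or_pos with rfl | hk0
          · refine le_trans (mul_le_of_le_one_right zero_le ?_) (le_of_eq (by simp))
            calc _ ≤ ∫⁻ _τ, 1 ∂(M.episode (X.play 0) D) := by
                  gcongr with τ
                  rw [← ENNReal.ofReal_one]
                  refine ENNReal.ofReal_le_ofReal (Real.exp_le_one_iff.2 (neg_nonpos.2 ?_))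
                  refine le_trans ?_ (sum_bonus_le_potential_sub D τ)
                  exact div_nonneg (Finset.sum_nonneg fun h _ => X.F.bonus_nonneg
                    (by linarith [X.one_le_L]) D h _ _) (Nat.cast_nonneg _)
              _ = 1 := by simp
          · refine (mul_le_mul_right (lintegral_exp_bonus_le hM hk0 hkm' hD1.1
              (hD2.resolve_left hk0.ne')) _).trans ?_
            rw [← ENNReal.ofReal_mul (Real.exp_pos _).le, ← Real.exp_add]
            refine ENNReal.ofReal_le_ofReal (Real.exp_le_exp.2 (le_of_eq ?_))
            rw [Nat.cast_sub hk0]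
            push_cast
            ring
  have hle := L.lintegral_law_le M G hG hstep X.m
  have h0 : G 0 Fin.elim0 ≤ 1 := by
    simp only [G, zero_le, if_true]
    refine (Set.indicator_le_self _ _ _).trans ?_
    rw [← ENNReal.ofReal_one]
    refine ENNReal.ofReal_le_ofReal (Real.exp_le_one_iff.2 ?_)
    simp [potential_nonneg]
  set u := ((X.m - 1 : ℕ) : ℝ) * c₀ - 882 * X.L * (q * Real.log (q + 4 * q * X.m)) with hu
  calc _ ≤ L.law M X.m {D | ENNReal.ofReal (Real.exp u) ≤ G X.m D} := by
        refine measure_mono fun D hD => ?_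
        simp only [Set.mem_ofPred_eq, G, le_refl, if_true]
        rw [Set.indicator_of_mem hD]
        refine ENNReal.ofReal_le_ofReal (Real.exp_le_exp.2 ?_)
        have := X.potential_le D
        linarith
    _ ≤ (∫⁻ D, G X.m D ∂(L.law M X.m)) / ENNReal.ofReal (Real.exp u) :=
        meas_ge_le_lintegral_div (hG _).aemeasurable
          (by rw [Ne, ENNReal.ofReal_eq_zero, not_le]; positivity) ENNReal.ofReal_ne_top
    _ ≤ 1 / ENNReal.ofReal (Real.exp u) := by
        gcongr
        exact hle.trans h0
    _ = _ := by
        rw [one_div, ← ENNReal.ofReal_inv_of_pos (by positivity), ← Real.exp_neg]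
        congr 2
        ring

end Explorer

end Explorer

/-! ### Failure probabilities and accuracy of the survivors -/

section ExplorerGuarantee

/-- The indicator of the bad event is itself a supermartingale that starts at 0, because each
episode avoids the event almost surely. -/
theorem Learner.law_exists_init_notMem {S A Y : Type*} [MeasurableSpace S] [MeasurableSpace A]
    [MeasurableSpace Y] {H m : ℕ} (L : Learner S A Y H m) (M : Env S A Y H) {h₀ : Fin H}
    (h₀_eq : (h₀ : ℕ) = 0) {B : Set S} (hB : MeasurableSet B) (hs : M.init ∈ B) (k : ℕ) :
    L.law M k {D | ∃ i, (D i h₀).1 ∉ B} = 0 := by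
  have hset : ∀ k, MeasurableSet {D : Data S A Y H k | ∃ i, (D i h₀).1 ∉ B} := fun k => by
    simp only [Set.ofPred_exists]
    refine .iUnion fun i => ?_
    have h1 : Measurable fun D : Data S A Y H k => (D i h₀).1 := by fun_prop
    exact (h1 hB).compl
  have h := L.lintegral_law_le M (fun k => {D | ∃ i, (D i h₀).1 ∉ B}.indicator 1)
    (fun k => measurable_one.indicator (hset k)) (fun k D => ?_) k
  · rw [lintegral_indicator_one (hset k)] at h
    simpa [Set.indicator] using h
  by_cases hD : ∃ i, (D i h₀).1 ∉ B
  · rw [Set.indicator_of_mem (show D ∈ {D : Data S A Y H k | ∃ i, (D i h₀).1 ∉ B} from hD)]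
    calc _ ≤ ∫⁻ _τ, 1 ∂(M.episode (L.play k) D) :=
          lintegral_mono fun τ => by
            change _ ≤ (1 : Data S A Y H (k + 1) → ENNReal) (Fin.snoc D τ)
            exact Set.indicator_le_self _ _ _
      _ = 1 := by simp
  · have hmE : MeasurableSet {τ : Episode S A Y H | (τ h₀).1 ∉ B} := by
      have h1 : Measurable fun τ : Episode S A Y H => (τ h₀).1 := by fun_prop
      exact (h1 hB).compl
    have h0 : M.episode (L.play k) D {τ | (τ h₀).1 ∉ B} = 0 := by
      cases H with
      | zero => exact h₀.elim0
      | succ n =>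
        obtain rfl : h₀ = 0 := Fin.ext h₀_eq
        exact ae_rollout_init n (L.play k).act M.step (L.play k).isMarkov M.isMarkov D M.init hB hs
    rw [← lintegral_indicator_one hmE] at h0
    refine le_trans (lintegral_mono fun τ => ?_) (h0.le.trans zero_le)
    by_cases hτ : (τ h₀).1 ∉ B
    · rw [Set.indicator_of_mem (show τ ∈ {τ : Episode S A Y H | (τ h₀).1 ∉ B} from hτ)]
      exact Set.indicator_le_self _ _ _
    · rw [Set.indicator_of_notMem]
      · exact zero_le
      · rintro ⟨i, hi⟩
        refine i.lastCases (fun hi => ?_) (fun i hi => ?_) hi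
        · rw [Fin.snoc_last] at hi; exact hτ hi
        · rw [Fin.snoc_castSucc] at hi; exact hD ⟨i, hi⟩

namespace Explorer

variable {S A Y : Type*} [MeasurableSpace S] [MeasurableSpace A] [MeasurableSpace Y] {q N H : ℕ}
  {E : Type*} [NormedAddCommGroup E] [InnerProductSpace ℝ E]
  [MeasurableSpace E] [BorelSpace E] [SecondCountableTopology E] [CompleteSpace E]
  {ι : Type*} [Finite ι] (X : Explorer S A Y q N H E ι)

/-- Union bound over steps, targets and grid directions. The condition on initial features fails
with probability zero, through the measurable set of states with the same features as the initial
one under all rules. -/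
theorem law_not_confCond_le {M : Env S A Y H} (hM : M.Fits X.F X.f) {m : ℕ}
    (L : Learner S A Y H m) (k : ℕ) :
    L.law M k {D | ¬ X.F.ConfCond X.e₀ X.f X.h₀ X.N' X.R X.L 0 M D} ≤
      (H * ((2 * N + 1) ^ q * (2 * N + 1) ^ q + 1) * (2 * X.N' + 1) ^ q : ℕ) *
        ENNReal.ofReal (2 * Real.exp (-X.L)) := by
  set B : Set S := {s | ∀ c j, X.F.feat (s, X.F.rule c s) j =
    X.F.feat (M.init, X.F.rule c M.init) j} with hBdef
  have hB : MeasurableSet B := by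
    simp only [hBdef, Set.ofPred_forall]
    refine .iInter fun c => .iInter fun j => measurableSet_eq_fun ?_ measurable_const
    exact (measurable_pi_iff.1 X.F.measurable_feat j).comp
      (measurable_id.prodMk (X.F.measurable_rule c))
  have h0 := L.law_exists_init_notMem M X.h₀_eq hB (fun _ _ => rfl) k
  calc _ ≤ L.law M k ((⋃ t : (Fin H × Option ((Fin q → Fin (2 * N + 1)) ×
          (Fin q → Fin (2 * N + 1)))) × (Fin q → Fin (2 * X.N' + 1)),
          {D | X.L + 8 * featSq X.F.feat t.1.1 (X.R • gridPt X.N' t.2) D <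
            ‖residSum X.F.feat t.1.1 (X.F.target X.e₀ X.f t.1.2) (X.F.testMean X.e₀ X.f M t.1)
              (X.R • gridPt X.N' t.2) D‖}) ∪ {D | ∃ i, (D i X.h₀).1 ∉ B}) := by
        refine measure_mono fun D hD => ?_
        by_contra hcon
        rw [Set.mem_union, not_or] at hcon
        refine hD ⟨fun t c => ?_, fun i c j => ?_⟩
        · by_contra h
          exact hcon.1 (Set.mem_iUnion.2 ⟨(t, c), not_le.1 h⟩)
        · have h := hcon.2
          simp only [Set.mem_ofPred_eq, not_exists, not_not] at h
          have h2 : (D i X.h₀).1 ∈ B := h i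
          rw [h2 c j]
          simp
    _ ≤ _ := by
        refine (measure_union_le _ _).trans ?_
        rw [h0, add_zero]
        refine (measure_iUnion_fintype_le _ _).trans ?_
        calc _ ≤ ∑ _t : (Fin H × Option ((Fin q → Fin (2 * N + 1)) ×
              (Fin q → Fin (2 * N + 1)))) × (Fin q → Fin (2 * X.N' + 1)),
              ENNReal.ofReal (2 * Real.exp (-X.L)) := by
              refine Finset.sum_le_sum fun t _ => ?_
              exact L.law_residSum_le M X.F.measurable_feat t.1.1
                (X.F.measurable_target X.reading t.1.2)
                (X.F.norm_target_le X.norm_e₀ X.reading t.1.2) _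
                (X.F.integral_target hM t.1) _ _ k
          _ = _ := by
              rw [Finset.sum_const, Finset.card_univ, nsmul_eq_mul]
              simp [Fintype.card_prod, Fintype.card_option]

theorem law_not_goodHist_le {M : Env S A Y H} (hM : M.Fits X.F X.f) {m : ℕ}
    (L : Learner S A Y H m) : ∀ k,
    L.law M k {D | ¬ X.GoodHist M k D} ≤
      k * ((H * ((2 * N + 1) ^ q * (2 * N + 1) ^ q + 1) * (2 * X.N' + 1) ^ q : ℕ) *
        ENNReal.ofReal (2 * Real.exp (-X.L)))
  | 0 => by simp [GoodHist]
  | k + 1 => by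
      have ih := law_not_goodHist_le hM L k
      have h1 := L.law_init_preimage M k (B := {D | ¬ X.GoodHist M k D})
        (X.measurableSet_goodHist M k).compl
      calc _ ≤ L.law M (k + 1) ({D | Fin.init D ∈ {D | ¬ X.GoodHist M k D}} ∪
            {D | ¬ X.F.ConfCond X.e₀ X.f X.h₀ X.N' X.R X.L 0 M D}) := by
            refine measure_mono fun D hD => ?_
            by_contra hcon
            rw [Set.mem_union, not_or] at hcon
            exact hD ⟨not_not.1 hcon.1, not_not.1 hcon.2⟩
        _ ≤ _ := by
            refine (measure_union_le _ _).trans ?_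
            rw [h1]
            refine (add_le_add ih (X.law_not_confCond_le hM L (k + 1))).trans (le_of_eq ?_)
            push_cast
            ring

variable {X}

theorem Wide.mono {K K' : Set ι} (h : K ⊆ K') (hK : X.Wide K) : X.Wide K' := by
  obtain ⟨g, i, hi, j, hj, hij⟩ := hK
  exact ⟨g, i, h hi, j, h hj, hij⟩

/-- Confidence sets are nested, so a disagreement that remains now was present at every earlier
time. -/
theorem Wide.allWide : ∀ {k : ℕ} {D : Data S A Y H k}, X.Wide (X.confSet k D) → X.AllWide k D
  | 0, _, _ => trivial
  | k + 1, D, h => by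
      have h1 : X.Wide (X.confSet k (Fin.init D)) := h.mono fun _ hi => hi.1
      exact ⟨h1.allWide, .inr h1⟩

/-- The candidate `i` is close to the environment `M`. -/
structure Close (X : Explorer S A Y q N H E ι) (M : Env S A Y H) (η₂ : ℝ) (i : ι) : Prop where
  value : ∀ g, ‖X.value (X.mod i) g - X.value M g‖ ≤ X.ε / 4
  testMean : ∀ t j, ‖X.F.testMean X.e₀ X.f (X.mod i) t j - X.F.testMean X.e₀ X.f M t j‖ ≤ η₂
  init : ∀ c j, |X.F.feat (M.init, X.F.rule c M.init) j -
    X.F.feat ((X.mod i).init, X.F.rule c (X.mod i).init) j| ≤ X.η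

theorem abs_gridPt_le {q N : ℕ} (hN : 0 < N) (c : Fin q → Fin (2 * N + 1)) (j : Fin q) :
    |gridPt N c j| ≤ 1 := by
  have hN' : (0 : ℝ) < N := by exact_mod_cast hN
  have h : ((c j : ℕ) : ℝ) ≤ 2 * N := by exact_mod_cast Nat.lt_succ_iff.1 (c j).2
  have h1 : ((c j : ℕ) : ℝ) / N ≤ 2 := by rw [div_le_iff₀ hN']; exact h
  have h2 : 0 ≤ ((c j : ℕ) : ℝ) / N := by positivity
  rw [gridPt, abs_le]
  constructor <;> linarith

/-- Replacing the true means by those of a close candidate moves each residual by at most 1. This is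
why candidates are tested at level `L + 1`, and the truth at level `L`. -/
theorem Close.confCond {M : Env S A Y H} {η₂ : ℝ} {i : ι} (hi : X.Close M η₂ i) (hη₂ : 0 ≤ η₂)
    (hm : 4 * X.m * (q : ℝ) ^ 2 * X.R * η₂ ≤ 1) {k : ℕ} (hk : k ≤ X.m) {D : Data S A Y H k}
    (h : X.F.ConfCond X.e₀ X.f X.h₀ X.N' X.R X.L 0 M D) :
    X.F.ConfCond X.e₀ X.f X.h₀ X.N' X.R (X.L + 1) X.η (X.mod i) D := by
  have hR : 0 ≤ X.R := (Real.sqrt_nonneg _).trans X.L_le_R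
  refine ⟨fun t c => ?_, fun n c j => ?_⟩
  · have h1 := h.1 t c
    set θ := X.R • gridPt X.N' c with hθ
    have hθb : ∀ j, |θ j| ≤ X.R := fun j => by
      rw [hθ, Pi.smul_apply, smul_eq_mul, abs_mul, abs_of_nonneg hR]
      exact mul_le_of_le_one_right hR (abs_gridPt_le X.N'_pos c j)
    have h2 : residSum X.F.feat t.1 (X.F.target X.e₀ X.f t.2)
        (X.F.testMean X.e₀ X.f (X.mod i) t) θ D = residSum X.F.feat t.1
        (X.F.target X.e₀ X.f t.2) (X.F.testMean X.e₀ X.f M t) θ D -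
        ∑ n, (θ ⬝ᵥ X.F.feat ((D n t.1).1, (D n t.1).2.1)) • ∑ j,
          X.F.feat ((D n t.1).1, (D n t.1).2.1) j •
            (X.F.testMean X.e₀ X.f (X.mod i) t j - X.F.testMean X.e₀ X.f M t j) := by
      simp only [residSum]
      rw [← Finset.sum_sub_distrib]
      refine Finset.sum_congr rfl fun n _ => ?_
      rw [← smul_sub]
      simp only [smul_sub, Finset.sum_sub_distrib]
      abel_nf
    have h3 : ‖∑ n, (θ ⬝ᵥ X.F.feat ((D n t.1).1, (D n t.1).2.1)) • ∑ j,
          X.F.feat ((D n t.1).1, (D n t.1).2.1) j •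
            (X.F.testMean X.e₀ X.f (X.mod i) t j - X.F.testMean X.e₀ X.f M t j)‖ ≤ 1 := by
      refine (norm_sum_le_of_le _ (f := fun n => _) (n := fun _ =>
        (2 * q * X.R) * (q * (2 * η₂))) fun n _ => ?_).trans ?_
      · rw [norm_smul, Real.norm_eq_abs]
        exact mul_le_mul (X.F.abs_dotProduct_feat_le hR hθb _)
          (norm_sum_smul_le (by norm_num) (X.F.abs_feat_le _) (hi.testMean t)) (norm_nonneg _)
          (by positivity)
      · rw [Finset.sum_const, Finset.card_univ, Fintype.card_fin, nsmul_eq_mul]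
        refine le_trans ?_ hm
        have : (k : ℝ) ≤ X.m := by exact_mod_cast hk
        calc _ = 4 * k * (q : ℝ) ^ 2 * X.R * η₂ := by ring
          _ ≤ _ := by gcongr
    rw [h2]
    refine (norm_sub_le _ _).trans ?_
    linarith
  · have h1 := h.2 n c j
    have h2 := abs_sub_le (X.F.feat ((D n X.h₀).1, X.F.rule c (D n X.h₀).1) j)
      (X.F.feat (M.init, X.F.rule c M.init) j)
      (X.F.feat ((X.mod i).init, X.F.rule c (X.mod i).init) j)
    have h3 := hi.init c j
    linarith

theorem Close.mem_confSet {M : Env S A Y H} {η₂ : ℝ} {i : ι} (hi : X.Close M η₂ i) (hη₂ : 0 ≤ η₂)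
    (hm : 4 * X.m * (q : ℝ) ^ 2 * X.R * η₂ ≤ 1) : ∀ {k : ℕ} (_ : k ≤ X.m) {D : Data S A Y H k}
    (_ : X.GoodHist M k D), i ∈ X.confSet k D
  | 0, _, _, _ => trivial
  | _ + 1, hk, _, h => ⟨hi.mem_confSet hη₂ hm (by omega) h.1, hi.confCond hη₂ hm hk h.2⟩

/-- All candidates that remain after the exploration estimate the values accurately. -/
theorem law_exists_inaccurate_le {M : Env S A Y H} (hM : M.Fits X.F X.f)
    (L : Learner S A Y H X.m) (hL : ∀ k, L.play k = X.play k) {η₂ : ℝ} {i₀ : ι}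
    (hi₀ : X.Close M η₂ i₀) (hη₂ : 0 ≤ η₂) (hm : 4 * X.m * (q : ℝ) ^ 2 * X.R * η₂ ≤ 1) :
    L.law M X.m {D | ¬ ((X.confSet X.m D).Nonempty ∧ ∀ i ∈ X.confSet X.m D, ∀ g,
      ‖X.value (X.mod i) g - X.value M g‖ ≤ X.ε / 2)} ≤
      X.m * ((H * ((2 * N + 1) ^ q * (2 * N + 1) ^ q + 1) * (2 * X.N' + 1) ^ q : ℕ) *
        ENNReal.ofReal (2 * Real.exp (-X.L))) +
      ENNReal.ofReal (Real.exp (882 * X.L * (q * Real.log (q + 4 * q * X.m)) -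
        ((X.m - 1 : ℕ) : ℝ) * (X.ε * X.α / (96 * H ^ 2)))) := by
  refine le_trans (measure_mono fun D hD => ?_) ((measure_union_le _ _).trans
    (add_le_add (X.law_not_goodHist_le hM L X.m) (law_goodHist_allWide_le hM L hL)))
  by_cases hg : X.GoodHist M X.m D
  · refine .inr ⟨hg, ?_⟩
    by_contra hw
    -- The close candidate survives. If the survivors agree up to `ε/4`, each is within `ε/4 + ε/4`
    -- of the truth.
    have hmem := hi₀.mem_confSet hη₂ hm le_rfl hg
    refine hD ⟨⟨i₀, hmem⟩, fun i hi g => ?_⟩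
    have h1 : ‖X.value (X.mod i) g - X.value (X.mod i₀) g‖ ≤ X.ε / 4 := by
      by_contra h
      exact hw (Wide.allWide ⟨g, i, hi, i₀, hmem, not_le.1 h⟩)
    have h2 := hi₀.value g
    have h3 := norm_sub_le_norm_sub_add_norm_sub (X.value (X.mod i) g) (X.value (X.mod i₀) g)
      (X.value M g)
    linarith
  · exact .inl hg

end Explorer

end ExplorerGuarantee

/-! ### Choice of parameters and number of episodes -/

section Parameters

/-- The analysis produces a logarithm with an extra factor `H` inside, which ι need not dominate
when ε is near `H`. Using `log H ≤ H` and `ι ≥ log 2` turns it into a factor `H` outside, which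
accounts for `H⁶` instead of `H⁴`. -/
theorem log_le_mul_log {p H ε δ : ℝ} (hp : 2 ≤ p) (hH : 1 ≤ H)
    (hε : 0 < ε) (hεH : ε ≤ H) (hδ : 0 < δ) (hδ1 : δ ≤ 1) :
    Real.log (2 ^ 20 * H * (p * H / (ε * δ))) ≤ 24 * (H * Real.log (p * H / (ε * δ))) := by
  have hpos : 0 < p * H / (ε * δ) := by positivity
  have h3 : Real.log 2 ≤ Real.log (p * H / (ε * δ)) := by
    refine Real.log_le_log two_pos ?_
    rw [le_div_iff₀ (by positivity)]
    exact mul_le_mul hp ((mul_le_of_le_one_right hε.le hδ1).trans hεH) (by positivity)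
      (by linarith)
  have h4 : Real.log H ≤ H := (Real.log_le_sub_one_of_pos (by linarith)).trans (by linarith)
  have h5 := Real.log_two_gt_d9
  rw [Real.log_mul (by positivity) hpos.ne', Real.log_mul (by positivity) (by positivity),
    Real.log_pow]
  set ι := Real.log (p * H / (ε * δ))
  have h6 : ι ≤ H * ι := le_mul_of_one_le_left (by linarith) hH
  have h7 : H * 0.69 ≤ H * ι := by gcongr; linarith
  push_cast
  linarith

set_option maxHeartbeats 1000000 in
/-- Parameters of the exploration, and the number of episodes that they lead to. -/
theorem exists_exploration_params {p q H : ℕ} (hp : 2 ≤ p) (hq : q ≤ p) (hH : 1 ≤ H) {ε δ : ℝ}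
    (hε : 0 < ε) (hεH : ε ≤ H) (hδ : 0 < δ) (hδ1 : δ ≤ 1) :
    ∃ (N N' m : ℕ) (R L η α : ℝ), 0 < N ∧ 0 < N' ∧ 1 ≤ L ∧ (q : ℝ) ≤ L ∧ √L ≤ R ∧ R ≤ N' ∧
      16 * m * (q : ℝ) ^ 2 * (R / N') ≤ 1 ∧ 0 < α ∧ 0 < η ∧
      2 * (2 * H * q * η + H * (12 * H * α + 8 * H * q / N)) ≤ ε / 8 ∧
      H * (2 * H * (1 + 4 * q) / N) ≤ ε ∧
      m * ((H * ((2 * N + 1) ^ q * (2 * N + 1) ^ q + 1) * (2 * N' + 1) ^ q) *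
        (2 * Real.exp (-L))) + Real.exp (882 * L * (q * Real.log (q + 4 * q * m)) -
          ((m - 1 : ℕ) : ℝ) * (ε * α / (96 * H ^ 2))) ≤ δ ∧
      (m : ℝ) ≤ 2 ^ 34 * 24 ^ 2 *
        (p ^ 2 * H ^ 6 * Real.log (p * H / (ε * δ)) ^ 2 / ε ^ 2) := by
  have hp' : (2 : ℝ) ≤ p := by exact_mod_cast hp
  have hq' : (q : ℝ) ≤ p := by exact_mod_cast hq
  have hH' : (1 : ℝ) ≤ H := by exact_mod_cast hH
  have hq0 : (0 : ℝ) ≤ q := Nat.cast_nonneg q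
  -- the basic quantity and its logarithm
  set Z : ℝ := p * H ^ 2 / ε with hZ
  have hZp : (p : ℝ) * H ≤ Z := by
    rw [hZ, le_div_iff₀ hε]
    calc (p : ℝ) * H * ε ≤ p * H * H := by gcongr
      _ = _ := by ring
  have hpZ : (p : ℝ) ≤ Z := (le_mul_of_one_le_right (by linarith) hH').trans hZp
  have hHZ : (H : ℝ) ≤ Z := (le_mul_of_one_le_left (by linarith) (by linarith)).trans hZp
  have hZ2 : 2 ≤ Z := hp'.trans hpZ
  -- One large quantity: every size below is bounded by a power of `X`, the factor `2 ^ 20` absorbs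
  -- numerical constants, and `1 / X ≤ δ / 2`.
  set X : ℝ := 2 ^ 20 * (Z / δ) with hX
  have hZX : 2 ^ 20 * Z ≤ X := by
    rw [hX]
    gcongr
    rw [le_div_iff₀ hδ]
    exact mul_le_of_le_one_right (by linarith) hδ1
  have hX21 : 2 ^ 21 ≤ X := by linarith
  have hX0 : 0 < X := by linarith
  have hpX : 2 ^ 20 * (p : ℝ) ≤ X := by linarith
  have hHX : 2 ^ 20 * (H : ℝ) ≤ X := by linarith
  have hδX : 1 / X ≤ δ / 2 := by
    rw [div_le_iff₀ hX0, hX]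
    field_simp
    linarith
  set ℓ := Real.log X with hℓ
  have hexp : Real.exp ℓ = X := Real.exp_log hX0
  have hℓX : ℓ ≤ X := (Real.log_le_sub_one_of_pos hX0).trans (by linarith)
  have hℓ1 : 1 ≤ ℓ := by
    rw [hℓ, Real.le_log_iff_exp_le hX0]
    linarith [Real.exp_one_lt_d9]
  have hℓι : ℓ ≤ 24 * (H * Real.log (p * H / (ε * δ))) := by
    rw [hℓ, show X = 2 ^ 20 * H * (p * H / (ε * δ)) by rw [hX, hZ]; field_simp]
    exact log_le_mul_log hp' hH' hε hεH hδ hδ1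
  -- the sizes of the grids and the number of episodes
  obtain ⟨N, hNX, hN1⟩ : ∃ N : ℕ, X ≤ N ∧ (N : ℝ) ≤ X + 1 :=
    ⟨⌈X⌉₊, Nat.le_ceil _, (Nat.ceil_lt_add_one hX0.le).le⟩
  obtain ⟨N', hNX', hN1'⟩ : ∃ N' : ℕ, X ^ 8 ≤ N' ∧ (N' : ℝ) ≤ X ^ 8 + 1 :=
    ⟨⌈X ^ 8⌉₊, Nat.le_ceil _, (Nat.ceil_lt_add_one (by positivity)).le⟩
  set Q : ℝ := p ^ 2 * H ^ 4 * ℓ ^ 2 / ε ^ 2 with hQ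
  have hQZ : Q = Z ^ 2 * ℓ ^ 2 := by rw [hQ, hZ]; field_simp
  have hQ1 : 1 ≤ Q := by
    rw [hQZ]
    exact one_le_mul_of_one_le_of_one_le (one_le_pow₀ (by linarith)) (one_le_pow₀ hℓ1)
  obtain ⟨m', hm', hm1⟩ : ∃ m' : ℕ, 2 ^ 33 * Q ≤ m' ∧ (m' : ℝ) ≤ 2 ^ 33 * Q + 1 :=
    ⟨⌈2 ^ 33 * Q⌉₊, Nat.le_ceil _, (Nat.ceil_lt_add_one (by positivity)).le⟩
  have hmX : ((m' + 1 : ℕ) : ℝ) ≤ X ^ 4 := by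
    push_cast
    have h1 : (2 ^ 20 * Z) ^ 2 * ℓ ^ 2 ≤ X ^ 2 * X ^ 2 := by gcongr
    have h2 : 2 ^ 40 * Q ≤ X ^ 4 := by rw [hQZ]; linarith
    have h3 : (2 : ℝ) ^ 40 ≤ X ^ 4 := by linarith
    linarith
  have hN0 : (0 : ℝ) < N := by linarith
  have hN0' : (0 : ℝ) < N' := lt_of_lt_of_le (by positivity) hNX'
  have hX8 : X ≤ X ^ 8 := le_self_pow₀ (by linarith) (by norm_num)
  have hNZ : 2 ^ 20 * (p * H ^ 2) ≤ ε * N := by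
    have : Z * ε = p * H ^ 2 := by rw [hZ]; field_simp
    calc (2 : ℝ) ^ 20 * (p * H ^ 2) = ε * (2 ^ 20 * Z) := by rw [← this]; ring
      _ ≤ ε * N := by gcongr; linarith
  have hqH : (q : ℝ) * H ^ 2 ≤ p * H ^ 2 := by gcongr
  have hpH0 : 0 ≤ (p : ℝ) * H ^ 2 := by positivity
  have hpℓ : (p : ℝ) ≤ p * ℓ := le_mul_of_one_le_right (by linarith) hℓ1
  have hXX : 2 ^ 21 * X ≤ X ^ 2 := by rw [sq]; gcongr
  -- η, α and `N` keep each of the three terms of the gap below `ε/48`. `L = 20pℓ` makes `exp (-L) =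
  -- X^(-20p)`, which beats the union bound. The extra episode is the one without credit.
  refine ⟨N, N', m' + 1, X, 20 * p * ℓ, ε / (96 * H * p), ε / (576 * H ^ 2), by exact_mod_cast hN0,
    by exact_mod_cast hN0', by linarith, by linarith, ?_, hX8.trans hNX', ?_, by positivity,
    by positivity, ?_, ?_, ?_, ?_⟩
  · rw [Real.sqrt_le_left hX0.le]
    have : (p : ℝ) * ℓ ≤ X / 2 ^ 20 * X := by
      refine mul_le_mul (by linarith) hℓX (by linarith) (by positivity)
    rw [sq]
    linarith [mul_pos hX0 hX0]
  · rw [mul_div_assoc', div_le_one hN0']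
    refine le_trans ?_ hNX'
    have h1 : (2 ^ 20 * (q : ℝ)) ^ 2 ≤ X ^ 2 := by gcongr; linarith
    have h2 : 16 * (q : ℝ) ^ 2 ≤ X ^ 2 := by linarith [sq_nonneg (q : ℝ)]
    calc 16 * ((m' + 1 : ℕ) : ℝ) * (q : ℝ) ^ 2 * X = ((m' + 1 : ℕ) : ℝ) * (16 * (q : ℝ) ^ 2) * X := by
          ring
      _ ≤ X ^ 4 * X ^ 2 * X := by gcongr
      _ = X ^ 7 := by ring
      _ ≤ X ^ 8 := pow_le_pow_right₀ (by linarith) (by norm_num)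
  · have h1 : 2 * (H : ℝ) * q * (ε / (96 * H * p)) ≤ ε / 48 := by
      rw [mul_div_assoc', div_le_div_iff₀ (by positivity) (by norm_num)]
      have : (H : ℝ) * ε * q ≤ H * ε * p := by gcongr
      linarith
    have h2 : (H : ℝ) * (12 * H * (ε / (576 * H ^ 2))) = ε / 48 := by field_simp; norm_num
    have h3 : (H : ℝ) * (8 * H * q / N) ≤ ε / 48 := by
      rw [mul_div_assoc', div_le_div_iff₀ hN0 (by norm_num)]
      linarith
    linarith
  · rw [mul_div_assoc', div_le_iff₀ hN0]
    have : (H : ℝ) ^ 2 ≤ p * H ^ 2 := le_mul_of_one_le_left (by positivity) (by linarith)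
    linarith
  · have hL : Real.exp (-(20 * p * ℓ)) = (X ^ (20 * p))⁻¹ := by
      rw [Real.exp_neg, ← hexp, ← Real.exp_nat_mul]
      push_cast
      rfl
    have h1 : (2 * (N : ℝ) + 1) ^ q ≤ X ^ (2 * p) := by
      rw [pow_mul]
      calc _ ≤ (X ^ 2) ^ q := by gcongr; linarith
        _ ≤ _ := pow_le_pow_right₀ (one_le_pow₀ (by linarith)) hq
    have h2 : (2 * (N' : ℝ) + 1) ^ q ≤ X ^ (9 * p) := by
      rw [pow_mul]
      have hX8' : 2 ^ 21 * X ^ 8 ≤ X ^ 9 := by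
        rw [show X ^ 9 = X * X ^ 8 by ring]
        gcongr
      calc _ ≤ (X ^ 9) ^ q := by gcongr; linarith
        _ ≤ _ := pow_le_pow_right₀ (one_le_pow₀ (by linarith)) hq
    have h3 : (2 * (N : ℝ) + 1) ^ q * (2 * N + 1) ^ q + 1 ≤ X ^ (4 * p + 1) := by
      calc _ ≤ X ^ (2 * p) * X ^ (2 * p) + X ^ (4 * p) := by
            gcongr
            exact one_le_pow₀ (by linarith)
        _ = 2 * X ^ (4 * p) := by ring
        _ ≤ X * X ^ (4 * p) := by gcongr; linarith
        _ = _ := by ring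
    have h4 : ((m' + 1 : ℕ) : ℝ) * ((H * ((2 * N + 1) ^ q * (2 * N + 1) ^ q + 1) *
        (2 * N' + 1) ^ q) * (2 * Real.exp (-(20 * p * ℓ)))) ≤ δ / 2 := by
      rw [hL]
      calc _ ≤ X ^ 4 * ((X * X ^ (4 * p + 1) * X ^ (9 * p)) * (X * (X ^ (20 * p))⁻¹)) := by
            gcongr
            · linarith
            · linarith
        _ = X ^ (13 * p + 7) * (X ^ (20 * p))⁻¹ := by ring
        _ ≤ X⁻¹ := by
          rw [← div_eq_mul_inv, div_le_iff₀ (by positivity), inv_mul_eq_div, le_div_iff₀ hX0,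
            ← pow_succ]
          -- The exponents satisfy `13p + 8 ≤ 20p`, which needs `p ≥ 2`.
          exact pow_le_pow_right₀ (by linarith) (by omega)
        _ ≤ _ := by rw [← one_div]; exact hδX
    have h5 : Real.exp (882 * (20 * p * ℓ) * (q * Real.log (q + 4 * q * ((m' + 1 : ℕ) : ℝ))) -
        ((m' + 1 - 1 : ℕ) : ℝ) * (ε * (ε / (576 * H ^ 2)) / (96 * H ^ 2))) ≤ δ / 2 := by
      have hlog : (q : ℝ) * Real.log (q + 4 * q * ((m' + 1 : ℕ) : ℝ)) ≤ p * (5 * ℓ) := by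
        rcases Nat.eq_zero_or_pos q with rfl | hq1
        · simp only [Nat.cast_zero, zero_mul]
          positivity
        have hq1' : (1 : ℝ) ≤ q := by exact_mod_cast hq1
        have hm1' : (1 : ℝ) ≤ ((m' + 1 : ℕ) : ℝ) := by push_cast; linarith [Nat.cast_nonneg (α := ℝ) m']
        have hqm : (q : ℝ) ≤ q * ((m' + 1 : ℕ) : ℝ) := le_mul_of_one_le_right hq0 hm1'
        have harg : (q : ℝ) + 4 * q * ((m' + 1 : ℕ) : ℝ) ≤ X ^ 5 := by
          calc _ ≤ (5 * q) * ((m' + 1 : ℕ) : ℝ) := by linarith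
            _ ≤ X * X ^ 4 := by gcongr; linarith
            _ = _ := by ring
        have h6 : Real.log (q + 4 * q * ((m' + 1 : ℕ) : ℝ)) ≤ 5 * ℓ := by
          rw [hℓ, show (5 : ℝ) * Real.log X = Real.log (X ^ 5) by rw [Real.log_pow]; norm_num]
          exact Real.log_le_log (by positivity) harg
        exact mul_le_mul hq' h6 (Real.log_nonneg (by linarith)) (by linarith)
      have h7 : 882 * (20 * p * ℓ) * (q * Real.log (q + 4 * q * ((m' + 1 : ℕ) : ℝ))) ≤
          88200 * (p ^ 2 * ℓ ^ 2) := by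
        calc _ ≤ 882 * (20 * p * ℓ) * (p * (5 * ℓ)) := by gcongr
          _ = _ := by ring
      -- `2^33 / (576 · 96)` exceeds 155344, well above `88200 = 882 · 20 · 5`; the surplus leaves
      -- at least ℓ in the exponent.
      have h8 : 155344 * (p ^ 2 * ℓ ^ 2) ≤
          ((m' + 1 - 1 : ℕ) : ℝ) * (ε * (ε / (576 * H ^ 2)) / (96 * H ^ 2)) := by
        rw [Nat.add_sub_cancel]
        calc 155344 * (p ^ 2 * ℓ ^ 2) ≤ 2 ^ 33 / 55296 * (p ^ 2 * ℓ ^ 2) := by gcongr; norm_num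
          _ = 2 ^ 33 * Q * (ε * (ε / (576 * H ^ 2)) / (96 * H ^ 2)) := by
            rw [hQ]; field_simp; norm_num
          _ ≤ _ := by gcongr
      have h9 : ℓ ≤ p ^ 2 * ℓ ^ 2 := by
        calc ℓ = 1 * (ℓ * 1) := by ring
          _ ≤ p ^ 2 * (ℓ * ℓ) := by gcongr; exact one_le_pow₀ (by linarith)
          _ = _ := by ring
      calc _ ≤ Real.exp (-ℓ) := Real.exp_le_exp.2 (by linarith)
        _ = 1 / X := by rw [Real.exp_neg, hexp, one_div]
        _ ≤ _ := hδX
    linarith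
  · calc ((m' + 1 : ℕ) : ℝ) ≤ 2 ^ 34 * Q := by push_cast; linarith
      _ = 2 ^ 34 * (p ^ 2 * H ^ 4 * ℓ ^ 2 / ε ^ 2) := rfl
      _ ≤ 2 ^ 34 * (p ^ 2 * H ^ 4 * (24 * (H * Real.log (p * H / (ε * δ)))) ^ 2 / ε ^ 2) := by
        gcongr
      _ = _ := by ring

end Parameters

/-! ### A finite net of environments, and the exploration guarantee -/

section Exploration

variable {S A Y : Type*} [MeasurableSpace S] [MeasurableSpace A] [MeasurableSpace Y] {q N H : ℕ}
  {E : Type*} [NormedAddCommGroup E] [InnerProductSpace ℝ E] [FiniteDimensional ℝ E]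
  [MeasurableSpace E] [BorelSpace E]

/-- The environments that fit a feature model have a finite net. -/
theorem FeatureModel.exists_net (F : FeatureModel S A q N) {e₀ : E} (he₀ : ‖e₀‖ = 1) {f : Y → E}
    (hf : IsReading f) {γ : ℝ} (hγ : 0 < γ) :
    ∃ (n : ℕ) (mod : Fin n → Env S A Y H), (∀ i, (mod i).Fits F f) ∧
      ∀ M : Env S A Y H, M.Fits F f → ∃ i,
        (∀ g, ‖(mod i).total ((mod i).meanRet f) (F.pol g) -
          M.total (M.meanRet f) (F.pol g)‖ ≤ γ) ∧
        (∀ t j, ‖F.testMean e₀ f (mod i) t j - F.testMean e₀ f M t j‖ ≤ γ) ∧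
        ∀ c j, |F.feat (M.init, F.rule c M.init) j -
          F.feat ((mod i).init, F.rule c (mod i).init) j| ≤ γ := by
  have : ProperSpace E := FiniteDimensional.proper ℝ E
  -- Environments are compared only through finitely many bounded vectors, so the image is totally
  -- bounded although the environments themselves form no compact family.
  let par : Env S A Y H → ((Fin H → Fin q → Fin (2 * N + 1)) → E) ×
      (Fin H × Option ((Fin q → Fin (2 * N + 1)) × (Fin q → Fin (2 * N + 1))) → Fin q → E) ×
      ((Fin q → Fin (2 * N + 1)) → Fin q → ℝ) := fun M =>
    (fun g => M.total (M.meanRet f) (F.pol g), fun t j => F.testMean e₀ f M t j,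
      fun c j => F.feat (M.init, F.rule c M.init) j)
  have hbdd : Bornology.IsBounded (par '' {M | M.Fits F f}) := by
    refine (Metric.isBounded_closedBall (x := 0) (r := H * 2 + 2)).subset ?_
    rintro _ ⟨M, -, rfl⟩
    have hH : (0 : ℝ) ≤ H := Nat.cast_nonneg H
    rw [mem_closedBall_zero_iff, norm_prod_le_iff, norm_prod_le_iff]
    refine ⟨(pi_norm_le_iff_of_nonneg (by positivity)).2 fun g => ?_,
      (pi_norm_le_iff_of_nonneg (by positivity)).2 fun t =>
        (pi_norm_le_iff_of_nonneg (by positivity)).2 fun j => ?_,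
      (pi_norm_le_iff_of_nonneg (by positivity)).2 fun t =>
        (pi_norm_le_iff_of_nonneg (by positivity)).2 fun j => ?_⟩
    · exact (M.norm_total_meanRet_le hf _).trans (by linarith)
    · exact (F.norm_testMean_le he₀ hf M t j).trans (by linarith)
    · exact (F.abs_feat_le _ j).trans (by linarith)
  -- The net points lie in the image itself, so each comes from an actual environment that fits;
  -- linear identities then hold exactly for candidates.
  obtain ⟨T, hTsub, hTfin, hT⟩ := Metric.finite_approx_of_totallyBounded
    (hbdd.isCompact_closure.totallyBounded.subset subset_closure) γ hγ
  obtain ⟨n, ⟨e⟩⟩ := @Finite.exists_equiv_fin T hTfin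
  choose mod hfit hpar using fun y : T => hTsub y.2
  refine ⟨n, fun i => mod (e.symm i), fun i => hfit _, fun M hM => ?_⟩
  obtain ⟨y, hy, hMy⟩ := Set.mem_iUnion₂.1 (hT ⟨M, hM, rfl⟩)
  refine ⟨e ⟨y, hy⟩, ?_⟩
  simp only [Equiv.symm_apply_apply]
  rw [Metric.mem_ball', dist_eq_norm, show y = par (mod ⟨y, hy⟩) from (hpar ⟨y, hy⟩).symm] at hMy
  have hMy' := hMy.le
  rw [norm_prod_le_iff, norm_prod_le_iff] at hMy'
  obtain ⟨h1, h2, h3⟩ := hMy'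
  refine ⟨fun g => (pi_norm_le_iff_of_nonneg hγ.le).1 h1 g, fun t j =>
    (pi_norm_le_iff_of_nonneg hγ.le).1 ((pi_norm_le_iff_of_nonneg hγ.le).1 h2 t) j, fun c j => ?_⟩
  rw [abs_sub_comm]
  exact (pi_norm_le_iff_of_nonneg hγ.le).1 ((pi_norm_le_iff_of_nonneg hγ.le).1 h3 c) j

/-- Exploration: after `m` episodes, a finite code of the data gives estimates of the values of all
sequences of rules. -/
theorem FeatureModel.exists_exploration {N' m : ℕ} {R L η α ε δ : ℝ} (F : FeatureModel S A q N)
    {e₀ : E} (he₀ : ‖e₀‖ = 1) {f : Y → E} (hf : IsReading f) (hH : 1 ≤ H) (hN' : 0 < N')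
    (hL1 : 1 ≤ L) (hqL : (q : ℝ) ≤ L) (hLR : √L ≤ R) (hRN : R ≤ N')
    (hmesh : 16 * m * (q : ℝ) ^ 2 * (R / N') ≤ 1) (hα : 0 < α) (hη : 0 < η) (hε : 0 < ε)
    (hgap : 2 * (2 * H * q * η + H * (12 * H * α + 8 * H * q / N)) ≤ ε / 8)
    (hδ : m * ((H * ((2 * N + 1) ^ q * (2 * N + 1) ^ q + 1) * (2 * N' + 1) ^ q) *
        (2 * Real.exp (-L))) + Real.exp (882 * L * (q * Real.log (q + 4 * q * m)) -
          ((m - 1 : ℕ) : ℝ) * (ε * α / (96 * H ^ 2))) ≤ δ) :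
    ∃ (n : ℕ) (vals : Fin n → (Fin H → Fin q → Fin (2 * N + 1)) → E)
      (play : (k : ℕ) → Policy (Data S A Y H k × S) A H) (code : Data S A Y H m → Set (Fin n)),
      Measurable code ∧ ∀ L : Learner S A Y H m, L.play = play → ∀ M : Env S A Y H, M.Fits F f →
        L.law M m {D | ¬ ((code D).Nonempty ∧ ∀ i ∈ code D, ∀ g,
          ‖vals i g - M.total (M.meanRet f) (F.pol g)‖ ≤ ε / 2)} ≤ ENNReal.ofReal δ := by
  have hR : 0 ≤ R := (Real.sqrt_nonneg _).trans hLR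
  set η₂ : ℝ := 1 / (4 * m * (q : ℝ) ^ 2 * R + 1) with hη₂
  have hη₂0 : 0 < η₂ := by positivity
  have hη₂m : 4 * m * (q : ℝ) ^ 2 * R * η₂ ≤ 1 := by
    rw [hη₂, mul_one_div, div_le_one (by positivity)]
    linarith
  obtain ⟨n, mod, hfits, hnet⟩ := F.exists_net (H := H) he₀ hf (γ := min (ε / 4) (min η η₂))
    (by positivity)
  let X : Explorer S A Y q N H E (Fin n) :=
    { F := F, e₀ := e₀, norm_e₀ := he₀, f := f, reading := hf, h₀ := ⟨0, hH⟩, h₀_eq := rfl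
      mod := mod, fits := hfits, N' := N', m := m, R := R, L := L, η := η, ε := ε, α := α
      N'_pos := hN', one_le_L := hL1, q_le_L := hqL, L_le_R := hLR, R_le := hRN
      mesh_le := hmesh, α_pos := hα, gap := hgap }
  refine ⟨n, fun i g => X.value (mod i) g, X.play, X.confSet m, X.measurable_confSet m,
    fun Lr hLr M hM => ?_⟩
  obtain ⟨i₀, h1, h2, h3⟩ := hnet M hM
  have hclose : X.Close M η₂ i₀ :=
    ⟨fun g => (h1 g).trans (min_le_left _ _),
      fun t j => (h2 t j).trans ((min_le_right _ _).trans (min_le_right _ _)),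
      fun c j => (h3 c j).trans ((min_le_right _ _).trans (min_le_left _ _))⟩
  refine (Explorer.law_exists_inaccurate_le (X := X) hM Lr (fun k => congrFun hLr k) hclose
    hη₂0.le hη₂m).trans ?_
  rw [← ENNReal.ofReal_natCast, ← ENNReal.ofReal_natCast, ← ENNReal.ofReal_mul (by positivity),
    ← ENNReal.ofReal_mul (by positivity), ← ENNReal.ofReal_add (by positivity) (by positivity)]
  refine ENNReal.ofReal_le_ofReal (le_trans (le_of_eq ?_) hδ)
  simp only [X]
  push_cast
  rfl

end Exploration

/-! ### From linear environments to feature models -/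

section LinearModels

/-- Moving the negative coefficients to the left gives an identity between finite positive measures,
which can be integrated. -/
theorem integral_eq_sum_of_real_eq {S : Type*} [MeasurableSpace S] {q : ℕ} {ν : Measure S}
    [IsFiniteMeasure ν] {ν' : Fin q → Measure S} [∀ j, IsFiniteMeasure (ν' j)] {c : Fin q → ℝ}
    (h : ∀ B, MeasurableSet B → ν.real B = ∑ j, c j * (ν' j).real B) {v : S → ℝ}
    (hv : Measurable v) {C : ℝ} (hC : ∀ s, |v s| ≤ C) :
    ∫ s, v s ∂ν = ∑ j, c j * ∫ s, v s ∂(ν' j) := by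
  have hreal : ∀ (a : Fin q → NNReal) (B : Set S),
      (∑ j, a j • ν' j).real B = ∑ j, a j * (ν' j).real B := fun a B => by
    rw [measureReal_def, Measure.finsetSum_apply, ENNReal.toReal_sum fun j _ => measure_ne_top _ _]
    exact Finset.sum_congr rfl fun j _ => measureReal_nnreal_smul_apply _
  have hc : ∀ j (t : ℝ), c j * t + (-c j).toNNReal * t = (c j).toNNReal * t := fun j t => by
    rw [← add_mul, Real.coe_toNNReal', Real.coe_toNNReal']
    nth_rewrite 1 [← max_zero_sub_eq_self (c j)]
    rw [max_comm (-c j), max_comm (c j), sub_add_cancel]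
  have hint : ∀ (ρ : Measure S) [IsFiniteMeasure ρ], Integrable v ρ := fun ρ _ =>
    .of_bound hv.aestronglyMeasurable C (.of_forall hC)
  have heq : ν + ∑ j, (-c j).toNNReal • ν' j = ∑ j, (c j).toNNReal • ν' j := by
    refine Measure.ext fun B hB => ?_
    refine (ENNReal.toReal_eq_toReal_iff' (measure_ne_top _ _) (measure_ne_top _ _)).1 ?_
    rw [← measureReal_def, ← measureReal_def, measureReal_add_apply, hreal, hreal, h B hB,
      ← Finset.sum_add_distrib]
    exact Finset.sum_congr rfl fun j _ => hc j _
  have hi : ∀ a : Fin q → NNReal, ∫ s, v s ∂(∑ j, a j • ν' j) = ∑ j, a j * ∫ s, v s ∂(ν' j) :=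
    fun a => by
      rw [integral_finsetSum_measure fun j _ => hint _]
      exact Finset.sum_congr rfl fun j _ => integral_smul_nnreal_measure _ _
  have h1 := congrArg (fun ρ => ∫ s, v s ∂ρ) heq
  beta_reduce at h1
  rw [integral_add_measure (hint _) (hint _), hi, hi, ← eq_sub_iff_add_eq,
    ← Finset.sum_sub_distrib] at h1
  rw [h1]
  exact Finset.sum_congr rfl fun j _ => sub_eq_iff_eq_add.2 (hc j _).symm

variable {S A Y : Type*} [MeasurableSpace S] [MeasurableSpace A] [MeasurableSpace Y] {p q H : ℕ}
  {φ : S × A → Vec p}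

theorem IsFeatureMap.exists_featureModel (hφ : IsFeatureMap φ) (x : Fin q → S × A)
    (T : Vec p →L[ℝ] Fin q → ℝ) (hT : ∀ z i, |T (φ z) i| ≤ 2) {N : ℕ} (hN : 0 < N) :
    ∃ F : FeatureModel S A q N, F.feat = (fun z => T (φ z)) ∧ F.anchor = x := by
  have hN' : (0 : ℝ) < N := by exact_mod_cast hN
  have h : ∀ c : Fin q → Fin (2 * N + 1), ∃ g : S → A, Measurable g ∧ ∀ s a,
      gridPt N c ⬝ᵥ T (φ (s, a)) ≤ gridPt N c ⬝ᵥ T (φ (s, g s)) + 1 / N := fun c => by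
    have h1 := hφ.exists_greedy (∑ j, gridPt N c j • (ContinuousLinearMap.proj j ∘L T))
      (one_div_pos.2 hN')
    simpa [dotProduct] using h1
  choose rule hrule hgreedy using h
  exact ⟨{ feat := fun z => T (φ z), measurable_feat := T.continuous.measurable.comp hφ.measurable
           abs_feat_le := hT, anchor := x, rule := rule, measurable_rule := hrule
           greedy := hgreedy, pos := hN }, rfl, rfl⟩

/-- Expanding φ at the anchors eliminates `μ` and `W`: a transition law is a signed combination of
the laws at the anchors, so no integral against a signed measure is needed. -/
theorem Env.fits_of_linear {M : Env S A Y H} (hM : M.HasLinearTrans φ) {N : ℕ}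
    {F : FeatureModel S A q N} {T : Vec p →L[ℝ] Fin q → ℝ} (hF : F.feat = fun z => T (φ z))
    (hT : ∀ z, φ z = ∑ i, T (φ z) i • φ (F.anchor i)) {E : Type*} [NormedAddCommGroup E]
    [InnerProductSpace ℝ E] {f : Y → E} {W : Fin H → Vec p →L[ℝ] E}
    (hW : ∀ h s a, M.meanRet f h s a = W h (φ (s, a))) : M.Fits F f where
  trans h s a v hv := by
    rintro ⟨C, hC⟩
    have := M.isMarkov h
    have : IsMarkovKernel (M.trans h) := by unfold Env.trans; infer_instance
    obtain ⟨μ, -, hμ⟩ := hM h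
    have hint : ∀ z, ∫ y, v y.2 ∂(M.step h z) = ∫ s, v s ∂(M.trans h z) := fun z => by
      rw [Env.trans, Kernel.snd_apply, integral_map measurable_snd.aemeasurable
        hv.aestronglyMeasurable]
    simp only [hint]
    refine integral_eq_sum_of_real_eq (fun B hB => ?_) hv hC
    rw [hμ s a B hB]
    have h1 : ∀ j, (M.trans h (F.anchor j)).real B = ∑ i, μ i B * φ (F.anchor j) i :=
      fun j => hμ _ _ B hB
    simp only [h1, Finset.mul_sum]
    rw [Finset.sum_comm]
    refine Finset.sum_congr rfl fun i _ => ?_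
    conv_lhs => rw [hT (s, a)]
    simp only [WithLp.ofLp_sum, WithLp.ofLp_smul, Finset.sum_apply, Pi.smul_apply, smul_eq_mul,
      Finset.mul_sum, hF]
    exact Finset.sum_congr rfl fun j _ => by ring
  ret h s a := by
    rw [hW, hT (s, a), map_sum]
    refine Finset.sum_congr rfl fun j _ => ?_
    rw [map_smul, hW, hF]

end LinearModels

/-! ### Approximate Carathéodory by greedy choice -/

section Mixtures

variable {E : Type*} [NormedAddCommGroup E] [InnerProductSpace ℝ E]

open scoped RealInnerProductSpace

/-- Blackwell's greedy step: add an element whose inner product with the current sum is at most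
`ε‖z‖`. Without the slack the squared norm grows by at most `c²` per step, hence `c√n`; the slack
adds ε per step. -/
theorem exists_norm_sum_le {Γ : Type*} {u : Γ → E} {c ε : ℝ} (hc0 : 0 ≤ c) (hε : 0 ≤ ε)
    (hc : ∀ g, ‖u g‖ ≤ c) (hu : ∀ z, ∃ g, ⟪z, u g⟫ ≤ ε * ‖z‖) :
    ∀ n : ℕ, ∃ w : Fin n → Γ, ‖∑ i, u (w i)‖ ≤ ε * n + c * √n
  | 0 => ⟨Fin.elim0, by simp⟩
  | n + 1 => by
      obtain ⟨w, hw⟩ := exists_norm_sum_le hc0 hε hc hu n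
      obtain ⟨g, hg⟩ := hu (∑ i, u (w i))
      refine ⟨Fin.snoc w g, ?_⟩
      rw [Fin.sum_univ_castSucc]
      simp only [Fin.snoc_castSucc, Fin.snoc_last]
      set z := ∑ i, u (w i)
      refine abs_le_of_sq_le_sq' ?_ (by positivity) |>.2
      rw [norm_add_sq_real]
      push_cast
      have h1 : √(n : ℝ) ≤ √((n : ℝ) + 1) := Real.sqrt_le_sqrt (by linarith)
      have h2 := Real.sq_sqrt (Nat.cast_nonneg (α := ℝ) n)
      have h3 := Real.sq_sqrt (show (0 : ℝ) ≤ n + 1 by positivity)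
      set a := √(n : ℝ) with ha
      set b := √((n : ℝ) + 1)
      have ha0 : 0 ≤ a := Real.sqrt_nonneg _
      have h4 : ‖z‖ ^ 2 ≤ (ε * n + c * a) ^ 2 := by gcongr
      have h5 : ε * ‖z‖ ≤ ε * (ε * n + c * a) := by gcongr
      have h6 : ‖u g‖ ^ 2 ≤ c ^ 2 := by gcongr; exact hc g
      have h7 : 2 * ε * c * (n + 1) * a ≤ 2 * ε * c * (n + 1) * b := by gcongr
      calc ‖z‖ ^ 2 + 2 * ⟪z, u g⟫ + ‖u g‖ ^ 2
          ≤ (ε * n + c * a) ^ 2 + 2 * (ε * (ε * n + c * a)) + c ^ 2 := by linarith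
        _ = ε ^ 2 * (n ^ 2 + 2 * n) + 2 * ε * c * (n + 1) * a + c ^ 2 * (a ^ 2 + 1) := by ring
        _ ≤ ε ^ 2 * (n ^ 2 + 2 * n + 1) + 2 * ε * c * (n + 1) * b + c ^ 2 * (a ^ 2 + 1) := by
          linarith [sq_nonneg ε]
        _ = (ε * (n + 1) + c * b) ^ 2 := by rw [h2]; linear_combination (-c ^ 2) * h3

/-- Uniform mixtures of a fixed size approximate every point that no direction separates from the
pure values. -/
theorem exists_mixture {Γ : Type*} {v : E} {V : Γ → E} {c ε : ℝ} (hc0 : 0 ≤ c) (hε : 0 < ε)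
    (hc : ∀ g, ‖v - V g‖ ≤ c) (hV : ∀ θ : E, ‖θ‖ ≤ 1 → ∃ g, ⟪θ, v⟫ ≤ ⟪θ, V g⟫ + ε) {n : ℕ}
    (hn : (c / ε) ^ 2 ≤ (n : ℝ) + 1) :
    ∃ w : Fin (n + 1) → Γ, ‖v - ((n : ℝ) + 1)⁻¹ • ∑ i, V (w i)‖ ≤ 2 * ε := by
  have hu : ∀ z : E, ∃ g, ⟪z, v - V g⟫ ≤ ε * ‖z‖ := fun z => by
    rcases eq_or_ne z 0 with rfl | hz
    · obtain ⟨g, -⟩ := hV 0 (by simp)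
      exact ⟨g, by simp⟩
    · have hz0 : 0 < ‖z‖ := norm_pos_iff.2 hz
      obtain ⟨g, hg⟩ := hV (‖z‖⁻¹ • z) (by
        rw [norm_smul, norm_inv, norm_norm, inv_mul_cancel₀ hz0.ne'])
      refine ⟨g, ?_⟩
      rw [real_inner_smul_left, real_inner_smul_left] at hg
      rw [inner_sub_right, sub_le_iff_le_add']
      have h1 := mul_le_mul_of_nonneg_left hg hz0.le
      rw [mul_add, mul_inv_cancel_left₀ hz0.ne', mul_inv_cancel_left₀ hz0.ne'] at h1
      linarith
  obtain ⟨w, hw⟩ := exists_norm_sum_le (u := fun g => v - V g) hc0 hε.le hc hu (n + 1)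
  refine ⟨w, ?_⟩
  have hn0 : (0 : ℝ) < n + 1 := by positivity
  have h1 : v - ((n : ℝ) + 1)⁻¹ • ∑ i, V (w i) = ((n : ℝ) + 1)⁻¹ • ∑ i, (v - V (w i)) := by
    rw [Finset.sum_sub_distrib, smul_sub, Finset.sum_const, Finset.card_univ, Fintype.card_fin,
      ← Nat.cast_smul_eq_nsmul ℝ, smul_smul]
    push_cast
    rw [inv_mul_cancel₀ hn0.ne', one_smul]
  rw [h1, norm_smul, Real.norm_eq_abs, abs_of_pos (by positivity), inv_mul_le_iff₀ hn0]
  refine hw.trans ?_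
  push_cast
  have h2 : c / ε ≤ √((n : ℝ) + 1) := Real.le_sqrt_of_sq_le hn
  rw [div_le_iff₀ hε] at h2
  have h3 := Real.mul_self_sqrt hn0.le
  have h4 := mul_le_mul_of_nonneg_right h2 (Real.sqrt_nonneg ((n : ℝ) + 1))
  nlinarith

end Mixtures

/-! ### Estimates for a finite, sufficiently rich family of policies -/

section Core

variable {S A Y : Type*} [MeasurableSpace S] [MeasurableSpace A] [MeasurableSpace Y] {p H : ℕ}
  {E : Type*} [NormedAddCommGroup E] [InnerProductSpace ℝ E] [FiniteDimensional ℝ E]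
  [MeasurableSpace E] [BorelSpace E]

open scoped RealInnerProductSpace

/-- No direction separates the value of a policy from the values of the sequences of rules. -/
theorem FeatureModel.exists_inner_total_le {q N : ℕ} (F : FeatureModel S A q N) {f : Y → E}
    (hf : IsReading f) {M : Env S A Y H} (hM : M.Fits F f) (hH : 1 ≤ H) (π : Policy S A H) {θ : E}
    (hθ : ‖θ‖ ≤ 1) : ∃ g, ⟪θ, M.total (M.meanRet f) π⟫ ≤
      ⟪θ, M.total (M.meanRet f) (F.pol g)⟫ + H * (2 * H * (1 + 4 * q) / N) := by
  have : ProperSpace E := FiniteDimensional.proper ℝ E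
  set r : Fin H → S → A → ℝ := fun h s a => innerSL ℝ θ (M.meanRet f h s a) with hrdef
  have hr : ∀ h, Measurable (Function.uncurry (r h)) := fun h =>
    (innerSL ℝ θ).continuous.measurable.comp (M.measurable_meanRet hf h)
  have hr2 : ∀ h s a, ‖r h s a‖ ≤ 2 := fun h s a => by
    refine (norm_inner_le_norm (𝕜 := ℝ) θ (M.meanRet f h s a)).trans ?_
    calc _ ≤ 1 * 2 := mul_le_mul hθ (M.norm_meanRet_le hf h s a) (norm_nonneg _) zero_le_one
      _ = 2 := one_mul 2
  have hrlin : ∀ h, F.LinFun (r h) := fun h s a => by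
    simp only [hrdef, hM.ret h s a, map_sum, map_smul, dotProduct, smul_eq_mul]
  obtain ⟨g, hg⟩ := F.exists_rules_val_ge hH H le_rfl M.step r M.isMarkov hM.trans hr hrlin hr2
  have h1 : ∀ π : Policy S A H, ⟪θ, M.total (M.meanRet f) π⟫ =
      val H (fun i s => π.act i s) M.step r M.init := fun π => by
    rw [← M.total_eq_val hr hr2, hrdef, M.total_clm (M.measurable_meanRet hf)
      (M.norm_meanRet_le hf) π (innerSL ℝ θ)]
    rfl
  refine ⟨g, ?_⟩
  rw [h1, h1]
  exact hg π.act π.isMarkov M.init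

/-- Exploration in linear environments: a finite family of policies whose uniform mixtures
approximate the value of every policy, and estimates of their values. -/
theorem IsFeatureMap.exists_estimates {φ : S × A → Vec p} (hφ : IsFeatureMap φ) (hp : 2 ≤ p)
    (hH : 1 ≤ H) {ε δ : ℝ} (hε : 0 < ε) (hεH : ε ≤ H) (hδ : 0 < δ) (hδ1 : δ ≤ 1) {e₀ : E}
    (he₀ : ‖e₀‖ = 1) {f : Y → E} (hf : IsReading f) :
    ∃ m : ℕ, (m : ℝ) ≤ 2 ^ 34 * 24 ^ 2 *
        (p ^ 2 * H ^ 6 * Real.log (p * H / (ε * δ)) ^ 2 / ε ^ 2) ∧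
      ∃ (n N₀ : ℕ) (Γ : Type) (_ : Finite Γ) (_ : Nonempty Γ) (pol : Γ → Policy S A H)
        (vals : Fin n → Γ → E) (play : (k : ℕ) → Policy (Data S A Y H k × S) A H)
        (code : Data S A Y H m → Set (Fin n)), Measurable code ∧
        ∀ M : Env S A Y H, M.HasLinearTrans φ → ∀ W : Fin H → Vec p →L[ℝ] E,
          (∀ h s a, M.meanRet f h s a = W h (φ (s, a))) →
          (∀ π : Policy S A H, ∃ w : Fin (N₀ + 1) → Γ, ‖M.total (M.meanRet f) π -
            ((N₀ : ℝ) + 1)⁻¹ • ∑ i, M.total (M.meanRet f) (pol (w i))‖ ≤ 2 * ε) ∧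
          ∀ L : Learner S A Y H m, L.play = play →
            L.law M m {D | ¬ ((code D).Nonempty ∧ ∀ i ∈ code D, ∀ g,
              ‖vals i g - M.total (M.meanRet f) (pol g)‖ ≤ ε)} ≤ ENNReal.ofReal δ := by
  obtain ⟨q, hq, x, T, hT⟩ := exists_anchors φ hφ.norm_le
  obtain ⟨N, N', m, R, L, η, α, hN, hN', hL1, hqL, hLR, hRN, hmesh, hα, hη, hgap, hrich, hfail,
    hm⟩ := exists_exploration_params hp hq hH hε hεH hδ hδ1
  obtain ⟨F, hF, rfl⟩ := hφ.exists_featureModel x T (fun z => (hT z).1) hN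
  obtain ⟨n, vals, play, code, hcode, hlaw⟩ := F.exists_exploration (H := H) he₀ hf hH hN' hL1 hqL
    hLR hRN hmesh hα hη hε hgap hfail
  -- Two values of norm at most `2H` differ by at most `4H`. The mixture size does not depend on the
  -- environment or on the policy approximated.
  obtain ⟨N₀, hN₀⟩ := exists_nat_ge ((4 * H / ε) ^ 2)
  refine ⟨m, hm, n, N₀, Fin H → Fin q → Fin (2 * N + 1), inferInstance, inferInstance, F.pol, vals,
    play, code, hcode, fun M hM W hW => ?_⟩
  have hfit : M.Fits F f := Env.fits_of_linear hM hF (fun z => (hT z).2) hW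
  refine ⟨fun π => ?_, fun L hL => le_trans (measure_mono fun D hD => ?_) (hlaw L hL M hfit)⟩
  swap
  · intro hcon
    exact hD ⟨hcon.1, fun i hi g => (hcon.2 i hi g).trans (by linarith)⟩
  refine exists_mixture (V := fun g => M.total (M.meanRet f) (F.pol g)) (c := 4 * H) (by positivity) hε (fun g => ?_) (fun θ hθ => ?_)
    (hN₀.trans (by linarith))
  · refine (norm_sub_le _ _).trans ?_
    have h1 := M.norm_total_meanRet_le hf π
    have h2 := M.norm_total_meanRet_le hf (F.pol g)
    linarith
  · obtain ⟨g, hg⟩ := F.exists_inner_total_le hf hfit hH π hθ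
    exact ⟨g, hg.trans (by linarith)⟩

end Core

/-! ### Mixtures selected by a code of the data -/

section Output

variable {S A Y : Type*} [MeasurableSpace S] [MeasurableSpace A] [MeasurableSpace Y]
  {E : Type*} [NormedAddCommGroup E] [NormedSpace ℝ E]

/-- The average of a uniform mixture. -/
def mixture {Γ : Type*} {n : ℕ} (V : Γ → E) (w : Fin (n + 1) → Γ) : E :=
  ((n : ℝ) + 1)⁻¹ • ∑ i, V (w i)

theorem norm_mixture_sub_le {Γ : Type*} {n : ℕ} {V V' : Γ → E} {ε : ℝ}
    (h : ∀ g, ‖V g - V' g‖ ≤ ε) (w : Fin (n + 1) → Γ) : ‖mixture V w - mixture V' w‖ ≤ ε := by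
  have hn : (0 : ℝ) < n + 1 := by positivity
  rw [mixture, mixture, ← smul_sub, ← Finset.sum_sub_distrib, norm_smul, Real.norm_eq_abs,
    abs_of_pos (by positivity), inv_mul_le_iff₀ hn]
  refine (norm_sum_le_of_le _ fun i _ => h (w i)).trans ?_
  simp

theorem map_mixture {Γ F : Type*} [NormedAddCommGroup F] [NormedSpace ℝ F] {n : ℕ} (T : E →L[ℝ] F)
    (V : Γ → E) (w : Fin (n + 1) → Γ) : T (mixture V w) = mixture (fun g => T (V g)) w := by
  simp [mixture, map_sum]

/-- The learner whose output is a mixture that is selected by a finite code of the data. -/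
def Learner.ofCode {Γ : Type*} {H m n N₀ : ℕ} (play : (k : ℕ) → Policy (Data S A Y H k × S) A H)
    {code : Data S A Y H m → Set (Fin n)} (hcode : Measurable code) (pol : Γ → Policy S A H)
    (choice : Set (Fin n) → Fin (N₀ + 1) → Γ) : Learner S A Y H m where
  play := play
  size := N₀
  out j := Policy.select code hcode fun K => pol (choice K j)

theorem Learner.outTotal_ofCode {Γ : Type*} {H m n N₀ : ℕ}
    (play : (k : ℕ) → Policy (Data S A Y H k × S) A H)
    {code : Data S A Y H m → Set (Fin n)} (hcode : Measurable code) (pol : Γ → Policy S A H)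
    (choice : Set (Fin n) → Fin (N₀ + 1) → Γ) (M : Env S A Y H) (f : Fin H → S → A → E)
    (D : Data S A Y H m) : (Learner.ofCode play hcode pol choice).outTotal M f D =
      mixture (fun g => M.total f (pol g)) (choice (code D)) := by
  simp only [Learner.outTotal, Learner.ofCode, mixture, Policy.at_select]
  rfl

end Output

/-! ### Approachability -/

section Approachability

variable {S A : Type*} [MeasurableSpace S] [MeasurableSpace A] {H d p : ℕ} {φ : S × A → Vec p}

/-- Samples are bounded only almost surely; resetting the exceptional ones to 0 gives an everywhere
bounded reading with the same mean. -/
theorem VMDP.exists_reading (d : ℕ) : ∃ f : Vec d → Vec d, IsReading f ∧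
    ∀ {S A : Type*} [MeasurableSpace S] [MeasurableSpace A] {H : ℕ} (M : VMDP S A H d),
      M.toEnv.meanRet f = M.ret := by
  classical
  refine ⟨fun y => if ‖y‖ ≤ 1 then y else 0, ⟨?_, fun y => ?_⟩, fun M => ?_⟩
  · exact .ite (measurableSet_le measurable_norm measurable_const) measurable_id measurable_const
  · split_ifs with h
    · linarith
    · simp
  · funext h s a
    refine integral_congr_ae ?_
    filter_upwards [M.ball h s a] with y hy
    exact if_pos hy

/-- The output minimizes the estimated distance over all mixtures. As distance is 1-Lipschitz, the
loss is ε for each of two estimates and `2ε` for approximating a policy by a mixture. -/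
theorem IsFeatureMap.exists_approaches (hφ : IsFeatureMap φ) (hp : 2 ≤ p) (hH : 1 ≤ H) (hd : 1 ≤ d)
    (C : Set (Vec d)) {ε δ : ℝ} (hε : 0 < ε) (hεH : 4 * ε ≤ H) (hδ : 0 < δ) (hδ1 : δ ≤ 1) :
    ∃ m : ℕ, (m : ℝ) ≤ 2 ^ 34 * 24 ^ 2 *
        (p ^ 2 * H ^ 6 * Real.log (p * H / (ε * δ)) ^ 2 / ε ^ 2) ∧
      ∃ L : Learner S A (Vec d) H m, ∀ M : VMDP S A H d, M.IsLinear φ →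
        L.Approaches M C (4 * ε) δ := by
  obtain ⟨f, hf, hfret⟩ := VMDP.exists_reading d
  obtain ⟨m, hm, n, N₀, Γ, _, _, pol, vals, play, code, hcode, hest⟩ :=
    hφ.exists_estimates (E := Vec d) hp hH hε (by linarith) hδ hδ1
      (e₀ := EuclideanSpace.single ⟨0, hd⟩ (1 : ℝ)) (by simp) hf
  have hchoice : ∀ K : Set (Fin n), ∃ w₀ : Fin (N₀ + 1) → Γ, K.Nonempty → ∃ i ∈ K, ∀ w,
      Metric.infDist (mixture (vals i) w₀) C ≤ Metric.infDist (mixture (vals i) w) C := fun K => by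
    by_cases hK : K.Nonempty
    · obtain ⟨i, hi⟩ := hK
      obtain ⟨w₀, hw₀⟩ := Finite.exists_min fun w : Fin (N₀ + 1) → Γ =>
        Metric.infDist (mixture (vals i) w) C
      exact ⟨w₀, fun _ => ⟨i, hi, hw₀⟩⟩
    · exact ⟨fun _ => Classical.arbitrary Γ, fun h => absurd h hK⟩
  choose choice hchoice using hchoice
  refine ⟨m, hm, .ofCode play hcode pol choice, fun M hM => ?_⟩
  choose W hW using hM.2
  obtain ⟨hmix, hlaw⟩ := hest M.toEnv hM.1 W fun h s a => by rw [hfret, (hW h).2]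
  rw [hfret] at hmix hlaw
  refine le_trans (measure_mono fun D hD => ?_) (hlaw (.ofCode play hcode pol choice) rfl)
  rintro ⟨hne, hacc⟩
  refine hD fun π => ?_
  rw [Learner.outTotal_ofCode]
  obtain ⟨i, hi, hmin⟩ := hchoice _ hne
  obtain ⟨w, hw⟩ := hmix π
  set V : Γ → Vec d := fun g => M.total M.ret (pol g)
  change ‖M.total M.ret π - mixture V w‖ ≤ 2 * ε at hw
  have hclose := fun w : Fin (N₀ + 1) → Γ => norm_mixture_sub_le (hacc i hi) w
  have h1 := Metric.infDist_le_infDist_add_dist (s := C) (x := mixture V (choice (code D)))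
    (y := mixture (vals i) (choice (code D)))
  have h2 := Metric.infDist_le_infDist_add_dist (s := C) (x := mixture (vals i) w)
    (y := mixture V w)
  have h3 := Metric.infDist_le_infDist_add_dist (s := C) (x := mixture V w)
    (y := M.total M.ret π)
  rw [dist_comm, dist_eq_norm] at h1 h3
  rw [dist_eq_norm] at h2
  have h4 := hmin w
  have h5 := hclose w
  have h6 := hclose (choice (code D))
  linarith

end Approachability

/-! ### Constrained problems -/

section ConstrainedMDP

variable {S A : Type*} [MeasurableSpace S] [MeasurableSpace A] {H d p : ℕ} {φ : S × A → Vec p}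

/-- The feedback of a constrained MDP, as a bounded reading in the Hilbert sum. -/
theorem CostVMDP.exists_reading (d : ℕ) : ∃ f : Vec d × ℝ → WithLp 2 (Vec d × ℝ), IsReading f ∧
    ∀ {S A : Type*} [MeasurableSpace S] [MeasurableSpace A] {H : ℕ} (M : CostVMDP S A H d),
      ∀ h s a, M.toEnv.meanRet f h s a = WithLp.toLp 2 (M.ret h s a, M.cost h s a) := by
  classical
  refine ⟨fun y => if ‖y.1‖ ≤ 1 ∧ |y.2| ≤ 1 then WithLp.toLp 2 y else 0, ⟨?_, fun y => ?_⟩,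
    fun {S A _ _ H} M h s a => ?_⟩
  · refine .ite (.inter (measurableSet_le measurable_fst.norm measurable_const)
      (measurableSet_le measurable_snd.norm measurable_const)) ?_ measurable_const
    exact WithLp.measurable_toLp 2 _
  · split_ifs with h
    · refine abs_le_of_sq_le_sq' ?_ zero_le_two |>.2
      rw [WithLp.prod_norm_sq_eq_of_L2]
      have h1 : ‖y.1‖ ^ 2 ≤ 1 := pow_le_one₀ (norm_nonneg _) h.1
      have h2 : ‖y.2‖ ^ 2 ≤ 1 := pow_le_one₀ (norm_nonneg _) h.2
      change ‖y.1‖ ^ 2 + ‖y.2‖ ^ 2 ≤ 2 ^ 2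
      linarith
    · simp
  · have := M.isMarkov h
    set T := (WithLp.prodContinuousLinearEquiv 2 ℝ (Vec d) ℝ).symm
    have h1 : Integrable (fun y : (Vec d × ℝ) × S => y.1.1) (M.step h (s, a)) :=
      .of_bound (measurable_fst.fst.aestronglyMeasurable) 1 ((M.ball h s a).mono fun y hy => hy.1)
    have h2 : Integrable (fun y : (Vec d × ℝ) × S => y.1.2) (M.step h (s, a)) :=
      .of_bound (measurable_fst.snd.aestronglyMeasurable) 1 ((M.ball h s a).mono fun y hy => hy.2)
    have h3 : ∫ y, y.1 ∂(M.step h (s, a)) = (M.ret h s a, M.cost h s a) := by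
      have := integral_pair h1 h2
      exact this
    calc _ = ∫ y, T y.1 ∂(M.step h (s, a)) := by
          refine integral_congr_ae ?_
          filter_upwards [M.ball h s a] with y hy
          exact if_pos hy
      _ = T (∫ y, y.1 ∂(M.step h (s, a))) := T.integral_comp_comm _
      _ = _ := by rw [h3]; rfl

/-- Return and cost are estimated jointly in the Hilbert sum, so one mixture approximates both for a
feasible policy. The output minimizes estimated cost under a relaxed estimated constraint. -/
theorem IsFeatureMap.exists_solvesCMDP (hφ : IsFeatureMap φ) (hp : 2 ≤ p) (hH : 1 ≤ H)
    (C : Set (Vec d)) {ε δ : ℝ} (hε : 0 < ε) (hεH : 4 * ε ≤ H) (hδ : 0 < δ) (hδ1 : δ ≤ 1) :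
    ∃ m : ℕ, (m : ℝ) ≤ 2 ^ 34 * 24 ^ 2 *
        (p ^ 2 * H ^ 6 * Real.log (p * H / (ε * δ)) ^ 2 / ε ^ 2) ∧
      ∃ L : Learner S A (Vec d × ℝ) H m, ∀ M : CostVMDP S A H d, M.IsLinear φ →
        M.IsFeasible C → L.SolvesCMDP M C (4 * ε) δ := by
  obtain ⟨f, hf, hfret⟩ := CostVMDP.exists_reading d
  obtain ⟨m, hm, n, N₀, Γ, _, _, pol, vals, play, code, hcode, hest⟩ :=
    hφ.exists_estimates (E := WithLp 2 (Vec d × ℝ)) hp hH hε (by linarith) hδ hδ1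
      (e₀ := WithLp.toLp 2 (0, 1)) (by
        rw [← sq_eq_sq₀ (norm_nonneg _) zero_le_one, WithLp.prod_norm_sq_eq_of_L2]; simp) hf
  set R : WithLp 2 (Vec d × ℝ) →L[ℝ] Vec d := WithLp.fstL 2 ℝ (Vec d) ℝ with hR
  set c : WithLp 2 (Vec d × ℝ) →L[ℝ] ℝ := WithLp.sndL 2 ℝ (Vec d) ℝ with hc
  -- The relaxation `3ε` is `2ε` for the mixture plus ε for the estimate, so mixtures that
  -- approximate feasible policies remain admissible.
  have hchoice : ∀ K : Set (Fin n), ∃ w₀ : Fin (N₀ + 1) → Γ, K.Nonempty → ∃ i ∈ K, ∀ w,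
      Metric.infDist (R (mixture (vals i) w)) C ≤ 3 * ε →
      Metric.infDist (R (mixture (vals i) w₀)) C ≤ 3 * ε ∧
        c (mixture (vals i) w₀) ≤ c (mixture (vals i) w) := fun K => by
    by_cases hK : K.Nonempty
    · obtain ⟨i, hi⟩ := hK
      by_cases hw : ∃ w : Fin (N₀ + 1) → Γ, Metric.infDist (R (mixture (vals i) w)) C ≤ 3 * ε
      · obtain ⟨w₀, hw₀, hmin⟩ := Set.exists_min_image
          {w : Fin (N₀ + 1) → Γ | Metric.infDist (R (mixture (vals i) w)) C ≤ 3 * ε}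
          (fun w => c (mixture (vals i) w)) (Set.toFinite _) hw
        exact ⟨w₀, fun _ => ⟨i, hi, fun w hw => ⟨hw₀, hmin w hw⟩⟩⟩
      · exact ⟨fun _ => Classical.arbitrary Γ, fun _ => ⟨i, hi, fun w h => absurd ⟨w, h⟩ hw⟩⟩
    · exact ⟨fun _ => Classical.arbitrary Γ, fun h => absurd h hK⟩
  choose choice hchoice using hchoice
  refine ⟨m, hm, .ofCode play hcode pol choice, fun M hM hfeas => ?_⟩
  choose W hW using hM.2.1
  choose W' hW' using hM.2.2
  obtain ⟨hmix, hlaw⟩ := hest M.toEnv hM.1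
    (fun h => (WithLp.prodContinuousLinearEquiv 2 ℝ (Vec d) ℝ).symm.toContinuousLinearMap ∘L
      (W h).prod (W' h)) fun h s a => by
        rw [hfret, (hW h).2, (hW' h).2]; rfl
  refine le_trans (measure_mono fun D hD => ?_) (hlaw (.ofCode play hcode pol choice) rfl)
  rintro ⟨hne, hacc⟩
  have hRtot : ∀ π, M.total M.ret π = R (M.total (M.meanRet f) π) := fun π => by
    rw [← M.total_clm (M.measurable_meanRet hf) (M.norm_meanRet_le hf)]
    congr 1
    funext h s a
    rw [hfret]
    rfl
  have hctot : ∀ π, M.total M.cost π = c (M.total (M.meanRet f) π) := fun π => by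
    rw [← M.total_clm (M.measurable_meanRet hf) (M.norm_meanRet_le hf)]
    congr 1
    funext h s a
    rw [hfret]
    rfl
  have hRle : ∀ v, ‖R v‖ ≤ ‖v‖ := fun v => WithLp.norm_fst_le _ v
  have hcle : ∀ v, |c v| ≤ ‖v‖ := fun v => WithLp.norm_snd_le _ v
  obtain ⟨i, hi, hmin⟩ := hchoice _ hne
  set V : Γ → WithLp 2 (Vec d × ℝ) := fun g => M.total (M.meanRet f) (pol g) with hV
  set w₀ := choice (code D) with hw₀
  have hclose := fun w : Fin (N₀ + 1) → Γ => norm_mixture_sub_le (hacc i hi) w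
  have key : ∀ π : Policy S A H, M.total M.ret π ∈ C →
      Metric.infDist (R (mixture (vals i) w₀)) C ≤ 3 * ε ∧
        c (mixture (vals i) w₀) ≤ M.total M.cost π + 3 * ε := fun π hπ => by
    obtain ⟨w, hw⟩ := hmix π
    change ‖M.total (M.meanRet f) π - mixture V w‖ ≤ 2 * ε at hw
    have h0 : ‖mixture (vals i) w - M.total (M.meanRet f) π‖ ≤ 3 * ε := by
      rw [norm_sub_rev] at hw
      have h1 := hclose w
      have h2 := norm_sub_le_norm_sub_add_norm_sub (mixture (vals i) w) (mixture V w)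
        (M.total (M.meanRet f) π)
      linarith
    obtain ⟨h1, h2⟩ := hmin w (by
      refine (Metric.infDist_le_dist_of_mem hπ).trans ?_
      rw [hRtot, dist_eq_norm, ← map_sub]
      exact (hRle _).trans h0)
    refine ⟨h1, ?_⟩
    have h3 := (le_abs_self _).trans ((hcle (mixture (vals i) w -
      M.total (M.meanRet f) π)).trans h0)
    rw [map_sub, ← hctot] at h3
    linarith
  refine hD ⟨fun π hπ => ?_, ?_⟩
  · rw [Learner.outTotal_ofCode]
    simp only [hctot]
    rw [← map_mixture, ← hctot]
    have h1 := (neg_le_abs _).trans ((hcle (mixture (vals i) w₀ - mixture V w₀)).trans (hclose w₀))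
    rw [map_sub] at h1
    have h2 := (key π hπ).2
    linarith
  · obtain ⟨π, hπ⟩ := hfeas
    rw [Learner.outTotal_ofCode]
    simp only [hRtot]
    rw [← map_mixture]
    have h1 := Metric.infDist_le_infDist_add_dist (s := C) (x := R (mixture V w₀))
      (y := R (mixture (vals i) w₀))
    rw [dist_comm, dist_eq_norm, ← map_sub] at h1
    have h2 := (hRle (mixture (vals i) w₀ - mixture V w₀)).trans (hclose w₀)
    have h3 := (key π hπ).1
    linarith

end ConstrainedMDP

/-! ### At most one feature, and the final episode count -/

section Degenerate

variable {S A Y : Type*} [MeasurableSpace S] [MeasurableSpace A] [MeasurableSpace Y] {H p : ℕ}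
  {φ : S × A → Vec p}

/-- With at most one feature, linear transitions force the feature map to be constant. -/
theorem Env.HasLinearTrans.feature_eq {M : Env S A Y H} (hM : M.HasLinearTrans φ) (hp : p ≤ 1)
    (hH : 1 ≤ H) (x y : S × A) : φ x = φ y := by
  have hmk := M.isMarkov ⟨0, hH⟩
  have : IsMarkovKernel (M.trans ⟨0, hH⟩) := by unfold Env.trans; infer_instance
  obtain ⟨μ, -, hμ⟩ := hM ⟨0, hH⟩
  have h : ∀ z, 1 = ∑ i, μ i Set.univ * φ z i := fun z => by
    rw [← hμ z.1 z.2 _ .univ, probReal_univ]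
  interval_cases p
  · simpa using h x
  · have hx := h x
    have hy := h y
    rw [Fin.sum_univ_one] at hx hy
    have h0 : μ 0 Set.univ ≠ 0 := by
      intro h0
      rw [h0, zero_mul] at hx
      exact one_ne_zero hx
    ext i
    rw [Subsingleton.elim i 0]
    exact mul_left_cancel₀ h0 (hx.symm.trans hy)

/-- A constant feature map makes `f` constant at each step, so every trajectory has the same total.
-/
theorem Env.total_eq_of_linear {E : Type*} [NormedAddCommGroup E] [NormedSpace ℝ E]
    [CompleteSpace E]
    {M : Env S A Y H} (hM : M.HasLinearTrans φ) (hp : p ≤ 1) (hH : 1 ≤ H)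
    {f : Fin H → S → A → E} (hf : IsLinearIn φ f) (π π' : Policy S A H) :
    M.total f π = M.total f π' := by
  choose W hW using hf
  have h : ∀ (τ τ' : Episode S A Y H), ∑ h, f h (τ h).1 (τ h).2.1 =
      ∑ h, f h (τ' h).1 (τ' h).2.1 := fun τ τ' => Finset.sum_congr rfl fun h _ => by
    rw [(hW h).2, (hW h).2, hM.feature_eq hp hH _ ((τ' h).1, (τ' h).2.1)]
  obtain ⟨τ₀⟩ := nonempty_of_isProbabilityMeasure (M.episode π.lift ())
  have h1 : ∀ π : Policy S A H, M.total f π = ∑ h, f h (τ₀ h).1 (τ₀ h).2.1 := fun π => by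
    rw [Env.total, integral_congr_ae (.of_forall fun τ => h τ τ₀)]
    simp
  rw [h1, h1]

/-- A learner that always plays the same policy. -/
def Learner.const (m : ℕ) (π : Policy S A H) : Learner S A Y H m where
  play _ := Policy.select (fun _ => ()) measurable_const fun _ => π
  size := 0
  out _ := Policy.select (fun _ => ()) measurable_const fun _ => π

theorem Learner.outTotal_const {E : Type*} [NormedAddCommGroup E] [NormedSpace ℝ E] {m : ℕ}
    (π : Policy S A H) (M : Env S A Y H) (f : Fin H → S → A → E) (D : Data S A Y H m) :
    (Learner.const m π).outTotal M f D = M.total f π := by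
  simp only [Learner.outTotal, Learner.const, Policy.at_select]
  change (((0 : ℕ) : ℝ) + 1)⁻¹ • ∑ _i : Fin 1, M.total f π = _
  simp

/-- The number of episodes of the exploration with accuracy `ε / 4`, in terms of `ε`. -/
theorem episodes_le {p d H : ℕ} (hp : 2 ≤ p) (hd : 1 ≤ d) (hH : 1 ≤ H) {ε δ : ℝ} (hε : 0 < ε)
    (hεH : ε ≤ H) (hδ : 0 < δ) (hδ1 : δ ≤ 1) :
    2 ^ 34 * 24 ^ 2 * (p ^ 2 * H ^ 6 * Real.log (p * H / (ε / 4 * δ)) ^ 2 / (ε / 4) ^ 2) ≤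
      2 ^ 51 * (p ^ 3 * H ^ 6 * Real.log (p * d * H / (ε * δ)) ^ 2 / ε ^ 2) ∧
    2 ^ 34 * 24 ^ 2 * (p ^ 2 * H ^ 6 * Real.log (p * H / (ε / 4 * δ)) ^ 2 / (ε / 4) ^ 2) ≤
      2 ^ 52 * (p ^ 3 * H ^ 6 * Real.log (p * d * H / (ε * δ)) ^ 3 / ε ^ 2) := by
  have hp' : (2 : ℝ) ≤ p := by exact_mod_cast hp
  have hd' : (1 : ℝ) ≤ d := by exact_mod_cast hd
  have hH' : (1 : ℝ) ≤ H := by exact_mod_cast hH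
  have hpos : (0 : ℝ) < p * H / (ε * δ) := by positivity
  have h1 : Real.log (p * H / (ε * δ)) ≤ Real.log (p * d * H / (ε * δ)) := by
    refine Real.log_le_log hpos ?_
    gcongr
    exact le_mul_of_one_le_right (by linarith) hd'
  have h2 : Real.log 2 ≤ Real.log (p * H / (ε * δ)) := by
    refine Real.log_le_log two_pos ?_
    rw [le_div_iff₀ (by positivity)]
    exact mul_le_mul hp' ((mul_le_of_le_one_right hε.le hδ1).trans hεH) (by positivity)
      (by linarith)
  have h3 : Real.log (p * H / (ε / 4 * δ)) = 2 * Real.log 2 + Real.log (p * H / (ε * δ)) := by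
    rw [show (p : ℝ) * H / (ε / 4 * δ) = 2 ^ 2 * (p * H / (ε * δ)) by field_simp; norm_num,
      Real.log_mul (by norm_num) hpos.ne', Real.log_pow]
    norm_num
  have h4 := Real.log_two_gt_d9
  rw [h3]
  set ι := Real.log (p * d * H / (ε * δ))
  set κ := Real.log (p * H / (ε * δ))
  have key : 2 ^ 34 * 24 ^ 2 * (p ^ 2 * H ^ 6 * (2 * Real.log 2 + κ) ^ 2 / (ε / 4) ^ 2) ≤
      2 ^ 51 * (p ^ 3 * H ^ 6 * ι ^ 2 / ε ^ 2) := by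
    calc _ ≤ 2 ^ 34 * 24 ^ 2 * ((p : ℝ) ^ 3 * H ^ 6 * (3 * ι) ^ 2 / (ε / 4) ^ 2) := by
          gcongr
          · linarith
          · norm_num
          · linarith
          · linarith
      _ = (2 ^ 34 * 24 ^ 2 * 9 * 16) * (p ^ 3 * H ^ 6 * ι ^ 2 / ε ^ 2) := by ring
      _ ≤ _ := by gcongr; norm_num
  refine ⟨key, key.trans ?_⟩
  calc 2 ^ 51 * (p ^ 3 * H ^ 6 * ι ^ 2 / ε ^ 2)
      ≤ 2 ^ 51 * ((p : ℝ) ^ 3 * H ^ 6 * (ι ^ 2 * (2 * ι)) / ε ^ 2) := by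
        gcongr
        exact le_mul_of_one_le_right (sq_nonneg _) (by linarith)
    _ = _ := by ring

end Degenerate

end

/-! ### The main theorem -/

theorem mainTheorem8 :
    ∃ c : ℝ, 0 < c ∧
      ∀ (S A : Type*) [MeasurableSpace S] [MeasurableSpace A] (H d p : ℕ) (_ : 1 ≤ d)
        (φ : S × A → Vec p) (_ : IsFeatureMap φ)
        (C : Set (Vec d)) (_ : C.Nonempty) (_ : Convex ℝ C)
        (ε δ : ℝ) (_ : 0 < ε) (_ : ε ≤ H) (_ : 0 < δ) (_ : δ ≤ 1),
        (∃ m : ℕ,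
          (m : ℝ) ≤ c * ((p : ℝ) ^ 3 * (H : ℝ) ^ 6 * Real.log (p * d * H / (ε * δ)) ^ 2 / ε ^ 2) ∧
          ∃ L : Learner S A (Vec d) H m,
            ∀ M : VMDP S A H d, M.IsLinear φ → L.Approaches M C ε δ) ∧
        (∃ m : ℕ,
          (m : ℝ) ≤ c * ((p : ℝ) ^ 3 * (H : ℝ) ^ 6 * Real.log (p * d * H / (ε * δ)) ^ 3 / ε ^ 2) ∧
          ∃ L : Learner S A (Vec d × ℝ) H m,
            ∀ M : CostVMDP S A H d, M.IsLinear φ → M.IsFeasible C → L.SolvesCMDP M C ε δ) := by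
  refine ⟨2 ^ 52, by positivity, fun S A _ _ H d p hd φ hφ C _ _ ε δ hε hεH hδ hδ1 => ?_⟩
  have hH : 1 ≤ H := by
    have h : (0 : ℝ) < H := hε.trans_le hεH
    exact_mod_cast h
  -- For `p = 1` the logarithm can vanish, for example at `d = 1`, `ε = H`, `δ = 1`, so the bound
  -- may allow no episode; any fixed policy then serves as output.
  rcases le_or_gt p 1 with hp | hp
  · obtain ⟨g, hg, -⟩ := hφ.selectors
    have π₀ : Policy S A H := detPolicy (fun _ => g 0) fun _ => hg 0
    constructor
    · refine ⟨0, by rw [Nat.cast_zero]; positivity, .const 0 π₀, fun M hM => ?_⟩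
      refine le_of_eq_of_le (measure_mono_null (t := ∅) (fun D hD => hD fun π => ?_)
        measure_empty) zero_le
      rw [Learner.outTotal_const, Env.total_eq_of_linear hM.1 hp hH hM.2 π₀ π]
      linarith
    · refine ⟨0, ?_, .const 0 π₀, fun M hM hfeas => ?_⟩
      · rw [Nat.cast_zero]
        rcases Nat.eq_zero_or_pos p with rfl | hp0
        · simp
        have hι : 0 ≤ Real.log (p * d * H / (ε * δ)) := by
          refine Real.log_nonneg ?_
          rw [le_div_iff₀ (by positivity), one_mul]
          have h1 : (1 : ℝ) ≤ p * d := by exact_mod_cast Nat.mul_pos hp0 hd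
          calc ε * δ ≤ 1 * H := by
                rw [one_mul]; exact (mul_le_of_le_one_right hε.le hδ1).trans hεH
            _ ≤ _ := by gcongr
        positivity
      · obtain ⟨π₁, hπ₁⟩ := hfeas
        refine le_of_eq_of_le (measure_mono_null (t := ∅) (fun D hD => hD ⟨fun π _ => ?_, ?_⟩)
          measure_empty) zero_le
        · rw [Learner.outTotal_const, Env.total_eq_of_linear hM.1 hp hH hM.2.2 π₀ π]
          linarith
        · rw [Learner.outTotal_const, Env.total_eq_of_linear hM.1 hp hH hM.2.1 π₀ π₁,
            Metric.infDist_zero_of_mem hπ₁]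
          exact hε.le
  -- The estimates are run with accuracy `ε / 4`, since output errors add up to four times the
  -- accuracy.
  · have h4 : 4 * (ε / 4) = ε := by ring
    obtain ⟨h1, h2⟩ := episodes_le (d := d) hp hd hH hε hεH hδ hδ1
    obtain ⟨m, hm, L, hL⟩ := hφ.exists_approaches hp hH hd C (ε := ε / 4) (by positivity)
      (by linarith) hδ hδ1
    obtain ⟨m', hm', L', hL'⟩ := hφ.exists_solvesCMDP hp hH C (ε := ε / 4) (by positivity)
      (by linarith) hδ hδ1
    rw [h4] at hL hL'
    refine ⟨⟨m, (hm.trans h1).trans ?_, L, hL⟩, ⟨m', hm'.trans h2, L', hL'⟩⟩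
    gcongr
    · norm_num
    · norm_num
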